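/- **Extensive-form games.** Consider extensive-form games with perfect recall, given by a finite game tree with chance nodes, with $m\ge 1$ players, exactly $\Phi\ge 1$ information sets for each player, exactly $n\ge 2$ actions at each information set, and payoffs in $[0,1]$ at the terminal nodes. A pure strategy of player $i$ chooses one action at each of its information sets; $\mathcal S_i$ is the set of pure strategies of player $i$ and $\mathcal S=\prod_i\mathcal S_i$. Write $u_i(s)$ for the expected payoff of player $i$ under $s\in\mathcal S$ and, for an information set $h$ of player $i$, $u_i(s;h)=\sum_{\nu\in h}\sum_{z\succeq \nu}\pi(s;z)\gamma_i(z)$, where $z$ ranges over the terminal nodes below $\nu$, $\pi(s;z)$ is the probability that $z$ is reached under $s$ and $\gamma_i(z)$ is the payoff of player $i$ at $z$. A distribution $D$ on $\mathcal S$ is an *$\epsilon$-approximate normal-form correlated equilibrium (NFCE)* if for every player $i$ and every map $\phi:\mathcal S_i\to\mathcal S_i$, $$\mathbb E_{s\sim D}[u_i(s_i,s_{-i})]\ \ge\ \mathbb E_{s\sim D}[u_i(\phi(s_i),s_{-i})]-\epsilon .$$ In *uncoupled dynamics* the game is played for $T\geq 1$ days, where $T$ is computed from $m,n,\Phi$ alone.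 On each day $t$ every player $i$ independently runs a randomized program that outputs a pure strategy; its law $p_{i,t}$ is the mixed strategy of player $i$ on day $t$. The program has access only to $m,n,\Phi,i$, to the pure strategies played on the past days, to the tree of the player's own information sets (for each of them, the last move of player $i$ before it), and to a payoff oracle for player $i$, which on a query $(s,h,b)$ or $(s,b)$ returns $\lfloor 2^b u_i(s;h)\rfloor$ or $\lfloor 2^b u_i(s)\rfloor$. The pure strategies played are made public at the end of the day. The dynamics return the empirical distribution $\frac1T\sum_{t=1}^T p_{1,t}\otimes\cdots\otimes p_{m,t}$ (represented by the history of play, so that it can be sampled by rerunning the programs of a uniformly random day). Programs run on a random access machine with fair coin tosses and logarithmic cost (a query is charged for its length, its precision $b$ and the length of the answer), and running time is the total cost over all days and players. There are a constant $C$ and a function $\omega:\mathbb N\to\mathbb R$ with $\omega(k)\to\infty$ such that for every $0<\epsilon\le 1$ there are uncoupled dynamics (one program for computing $T$ and one program for the players, the same for all games and all $m\ge1$, $n\ge2$, $\Phi\ge1$) that on every such game have total running time, with certainty, at most $$C\,(mn)^{C}\cdot\max\{\Phi\log n,\,1/\epsilon\}^{C/\epsilon},$$ so at most $C\,(mn)^C(\Phi\log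 n)^{C/\epsilon}$ whenever $\epsilon\ge 1/(\Phi\log n)$, and return an $\epsilon$-approximate NFCE with probability at least $1-1/(mn\Phi)^{\omega(mn\Phi)}$ (over the history of play). In particular, for every fixed $\epsilon$ the running time is polynomial in $m,n,\Phi$: this is a PTAS for NFCE. -/

import Mathlib

noncomputable section

namespace EFG

/-! ### Extensive-form games

`m` players, `Φ` information sets per player, `n` actions per information set. The actions of an
information set `h` are labelled by `Fin n`; the pair `(h, a)` identifies an action, so that the
action sets of different information sets are disjoint. -/

/-- Finite game trees. The decision nodes labelled `i`, `h` form the information set `h` of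
player `i`. At a chance node, `p` is the distribution over the `k` outgoing edges. -/
inductive GameTree (m n Φ : ℕ) : Type
  | terminal (γ : Fin m → unitInterval) : GameTree m n Φ
  | chance (k : ℕ) (p : stdSimplex ℝ (Fin k)) (next : Fin k → GameTree m n Φ) : GameTree m n Φ
  | decision (i : Fin m) (h : Fin Φ) (next : Fin n → GameTree m n Φ) : GameTree m n Φ

/-- Pure strategies of a player: one action at every information set. -/
abbrev Strategy (n Φ : ℕ) : Type := Fin Φ → Fin n

/-- Pure strategy profiles. -/
abbrev Profile (m n Φ : ℕ) : Type := Fin m → Strategy n Φ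

namespace GameTree

variable {m n Φ : ℕ}

/-- Expected utility of player `i` when play starts at the root of the (sub)tree and the players
follow `s`. -/
def util (s : Profile m n Φ) (i : Fin m) : GameTree m n Φ → ℝ
  | terminal γ => γ i
  | chance _ p next => ∑ j, p.1 j * util s i (next j)
  | decision j h next => util s i (next (s j h))

/-- `u_i(s; h)`: the sum, over all nodes `ν` of the information set `h` of player `i`, of
`∑_{z ⪰ ν} π(s; z) γ_i(z)`, where `π(s; z)` is the probability that play according to `s`
reaches the terminal node `z` from the root. -/
def infoUtil (s : Profile m n Φ) (i : Fin m) (h : Fin Φ) : GameTree m n Φ → ℝ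
  | terminal _ => 0
  | chance _ p next => ∑ j, p.1 j * infoUtil s i h (next j)
  | decision j g next =>
      (if j = i ∧ g = h then util s i (decision j g next) else 0) + infoUtil s i h (next (s j g))

/-- All pairs `(h, σ)` such that some node of the tree belongs to the information set `h` of
player `i` and `σ` is the sequence of moves of player `i` on the way to that node (preceded by
`σ₀`, the moves made before the root of the tree; the move made at `h` is not included). -/
def occurrences (i : Fin m) :
    GameTree m n Φ → List (Fin Φ × Fin n) → Set (Fin Φ × List (Fin Φ × Fin n))
  | terminal _, _ => ∅
  | chance _ _ next, σ₀ => ⋃ j, occurrences i (next j) σ₀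
  | decision j g next, σ₀ =>
      if j = i then insert (g, σ₀) (⋃ a, occurrences i (next a) (σ₀ ++ [(g, a)]))
      else ⋃ a, occurrences i (next a) σ₀

end GameTree

/-- An extensive-form game with perfect recall. -/
structure Game (m n Φ : ℕ) where
  tree : GameTree m n Φ
  /-- no information set is empty -/
  nonempty : ∀ (i : Fin m) (h : Fin Φ), ∃ σ, (h, σ) ∈ tree.occurrences i []
  /-- all nodes of an information set have the same sequence of own earlier moves -/
  perfect_recall : ∀ (i : Fin m) (h : Fin Φ) (σ σ' : List (Fin Φ × Fin n)),
    (h, σ) ∈ tree.occurrences i [] → (h, σ') ∈ tree.occurrences i [] → σ = σ'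

namespace Game

variable {m n Φ : ℕ}

/-- Expected utility `u_i(s)`. -/
def u (G : Game m n Φ) (i : Fin m) (s : Profile m n Φ) : ℝ := G.tree.util s i

/-- `σ_i(h)`: the moves of player `i` on the way to `h`. -/
def seqTo (G : Game m n Φ) (i : Fin m) (h : Fin Φ) : List (Fin Φ × Fin n) :=
  (G.nonempty i h).choose

/-- `ε`-approximate normal-form correlated equilibrium. -/
def IsNFCE (G : Game m n Φ) (ε : ℝ) (D : PMF (Profile m n Φ)) : Prop :=
  ∀ (i : Fin m) (φ : Strategy n Φ → Strategy n Φ),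
    ∑ s, (D s).toReal * G.u i s ≥
      ∑ s, (D s).toReal * G.u i (Function.update s i (φ (s i))) - ε

end Game

/-! ### Machine model

A random access machine with logarithmic cost, programmed by structured commands. The memory
consists of arrays of natural numbers; arrays and their indices are natural numbers. There are
only `for` loops, so every program halts. -/

abbrev Store : Type := ℕ → ℕ → ℕ

/-- Writing the value `v` to the cell with index `k` of the array `a`. -/
def Store.write (μ : Store) (a k v : ℕ) : Store :=
  Function.update μ a (Function.update (μ a) k v)

inductive Op : Type
  | add | sub | mul | div

/-- Arithmetic on `ℕ`: truncated subtraction, division rounding down (and `x / 0 = 0`). -/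
def Op.apply : Op → ℕ → ℕ → ℕ
  | add, x, y => x + y
  | sub, x, y => x - y
  | mul, x, y => x * y
  | div, x, y => x / y

inductive Term : Type
  | lit (k : ℕ)
  | get (a : ℕ) (idx : Term)
  | bin (o : Op) (x y : Term)

def Term.eval (μ : Store) : Term → ℕ
  | lit k => k
  | get a idx => μ a (idx.eval μ)
  | bin o x y => o.apply (x.eval μ) (y.eval μ)

/-- Logarithmic cost: every operation costs one plus the lengths in binary of the numbers it
handles, addresses included. -/
def Term.cost (μ : Store) : Term → ℕ
  | lit k => 1 + k.size
  | get a idx => idx.cost μ + 1 + (idx.eval μ).size + (μ a (idx.eval μ)).size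
  | bin _ x y => x.cost μ + y.cost μ + 1 + (x.eval μ).size + (y.eval μ).size

/-- * `set a k e`: store `e` in the cell `k` of the array `a`;
* `ite e c d`: run `c` if `e ≠ 0`, otherwise `d`;
* `loop x e c`: run `c` for `e` times, with the cell `0` of the array `x` set to `0, 1, 2, …`;
* `toss a k e`: toss `e` fair coins and store the resulting `e`-bit number;
* `query a k q b`: store the answer of the oracle to the query written in the array `q`, with
  precision `b`. -/
inductive Cmd : Type
  | set (a : ℕ) (k e : Term)
  | seq (c d : Cmd)
  | ite (e : Term) (c d : Cmd)
  | loop (x : ℕ) (e : Term) (c : Cmd)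
  | toss (a : ℕ) (k e : Term)
  | query (a : ℕ) (k : Term) (q : ℕ) (b : Term)

/-- An oracle reads the first `len` cells of the query array and a precision. -/
structure Oracle where
  len : ℕ
  answer : (ℕ → ℕ) → ℕ → ℕ

/-- `repeatCmd body x N μ`: run `body` for `N` times from `μ`, with the loop counter in `x`. -/
def repeatCmd (body : Store → PMF (Store × ℕ)) (x : ℕ) (μ : Store) : ℕ → PMF (Store × ℕ)
  | 0 => PMF.pure (μ, 0)
  | N + 1 => (repeatCmd body x μ N).bind fun r =>
      (body (r.1.write x 0 N)).map fun r' => (r'.1, r.2 + 1 + N.size + r'.2)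

/-- Joint law of the final memory and the running time of a command. -/
def Cmd.exec (O : Oracle) : Cmd → Store → PMF (Store × ℕ)
  | set a k e, μ =>
      PMF.pure (μ.write a (k.eval μ) (e.eval μ),
        k.cost μ + e.cost μ + 1 + (k.eval μ).size + (e.eval μ).size)
  | seq c d, μ => (c.exec O μ).bind fun r =>
      (d.exec O r.1).map fun r' => (r'.1, r.2 + r'.2)
  | ite e c d, μ =>
      (if e.eval μ ≠ 0 then c.exec O μ else d.exec O μ).map fun r =>
        (r.1, e.cost μ + 1 + r.2)
  | loop x e c, μ => (repeatCmd (c.exec O) x μ (e.eval μ)).map fun r =>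
      (r.1, e.cost μ + 1 + r.2)
  | toss a k e, μ => (PMF.uniformOfFintype (Fin (2 ^ e.eval μ))).map fun v =>
      (μ.write a (k.eval μ) v,
        k.cost μ + e.cost μ + 1 + (k.eval μ).size + e.eval μ)
  | query a k q b, μ =>
      PMF.pure (μ.write a (k.eval μ) (O.answer (μ q) (b.eval μ)),
        k.cost μ + b.cost μ + 1 + (k.eval μ).size + (∑ j ∈ Finset.range O.len, (μ q j).size) +
          b.eval μ + (O.answer (μ q) (b.eval μ)).size)

/-! ### Uncoupled dynamics -/

/-- Independent product of finitely many distributions. -/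
def indep {α : Type} : {m : ℕ} → (Fin m → PMF α) → PMF (Fin m → α)
  | 0, _ => PMF.pure Fin.elim0
  | _ + 1, p => (p 0).bind fun x => (indep fun i => p i.succ).map fun f => Fin.cons x f

/-- An array whose cell `j * Φ + h` holds the action of player `j` at `h`, read as a profile. -/
def readProfile (m n Φ : ℕ) [NeZero n] (q : ℕ → ℕ) : Profile m n Φ :=
  fun j h => Fin.ofNat n (q (j * Φ + h))

/-- The inverse: the cell `k` of the array that holds the profile `s`. -/
def profileCell {m n Φ : ℕ} (s : Profile m n Φ) (k : ℕ) : ℕ :=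
  if hk : k / Φ < m ∧ k % Φ < Φ then s ⟨k / Φ, hk.1⟩ ⟨k % Φ, hk.2⟩ else 0

namespace Game

variable {m n Φ : ℕ}

/-- The payoff oracle of player `i`. A query consists of a profile `s` (cells `0, …, m * Φ - 1`)
and an index `h` (cell `m * Φ`); the answer is `⌊2 ^ b * u_i(s; h)⌋`, and `⌊2 ^ b * u_i(s)⌋` when
`h` is not the index of an information set. -/
def oracle (G : Game m n Φ) [NeZero n] (i : Fin m) : Oracle where
  len := m * Φ + 1
  answer q b :=
    if h : q (m * Φ) < Φ then
      ⌊(2 : ℝ) ^ b * G.tree.infoUtil (readProfile m n Φ q) i ⟨q (m * Φ), h⟩⌋₊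
    else ⌊(2 : ℝ) ^ b * G.u i (readProfile m n Φ q)⌋₊

/-- `0` if player `i` makes no move before `h`; otherwise `h' * n + a + 1`, where `a`, made at
`h'`, is the last move of player `i` before `h`. -/
def parentCode (G : Game m n Φ) (i : Fin m) (h : Fin Φ) : ℕ :=
  match (G.seqTo i h).getLast? with
  | none => 0
  | some (h', a) => h' * n + a + 1

/-- What player `i` knows at the start of a day, besides its payoff oracle: in array `0` the
numbers `m, n, Φ, i` and the number of past days, in array `1` the tree of its own information
sets, in array `2` the pure strategies that were played on the past days. -/
def input (G : Game m n Φ) (i : Fin m) (H : List (Profile m n Φ)) : Store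
  | 0 => fun k => [m, n, Φ, (i : ℕ), H.length].getD k 0
  | 1 => fun k => if hk : k < Φ then G.parentCode i ⟨k, hk⟩ else 0
  | 2 => fun k => match H[k / (m * Φ)]? with
    | none => 0
    | some s => profileCell s (k % (m * Φ))
  | _ => fun _ => 0

end Game

/-- Uncoupled dynamics: `horizon` computes the number of days from `m, n, Φ` alone; on every
day, every player runs `player` on its own data and plays the pure strategy found in array `3`.
The strategies played are made public at the end of the day. -/
structure Dynamics where
  horizon : Cmd
  player : Cmd

namespace Dynamics

variable {m n Φ : ℕ} [NeZero n]

/-- Joint law of the pure strategy that player `i` plays after the history `H` and of the time it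
takes to determine and publish it. -/
def move (A : Dynamics) (G : Game m n Φ) (i : Fin m) (H : List (Profile m n Φ)) :
    PMF (Strategy n Φ × ℕ) :=
  (A.player.exec (G.oracle i) (G.input i H)).map fun r =>
    (fun h : Fin Φ => Fin.ofNat n (r.1 3 h), r.2 + Φ * n.size)

/-- The mixed strategy of player `i` on the day after the history `H`. -/
def mixed (A : Dynamics) (G : Game m n Φ) (i : Fin m) (H : List (Profile m n Φ)) :
    PMF (Strategy n Φ) :=
  (A.move G i H).map Prod.fst

/-- Joint law of the history of the first `T` days and of the total time used by all players. -/
def play (A : Dynamics) (G : Game m n Φ) : ℕ → PMF (List (Profile m n Φ) × ℕ)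
  | 0 => PMF.pure ([], 0)
  | T + 1 => (A.play G T).bind fun r =>
      (indep fun i => A.move G i r.1).map fun f =>
        (r.1 ++ [fun i => (f i).1], r.2 + ∑ i, (f i).2)

/-- Joint law of the whole history and of the total running time. -/
def run (A : Dynamics) (G : Game m n Φ) : PMF (List (Profile m n Φ) × ℕ) :=
  (A.horizon.exec ⟨0, fun _ _ => 0⟩ fun a k => if a = 0 then [m, n, Φ].getD k 0 else 0).bind
    fun r => (A.play G (r.1 3 0)).map fun x => (x.1, r.2 + x.2)

/-- The output `(1 / T) ∑_t p_{1,t} ⊗ ⋯ ⊗ p_{m,t}`, where `p_{i,t}` is the mixed strategy of player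
`i` on day `t` of the history `H`. It is represented by `H`: to sample from it, pick a day `t`
uniformly and let the players run their programs on the part of `H` before day `t`. -/
def output (A : Dynamics) (G : Game m n Φ) (H : List (Profile m n Φ)) (hH : 0 < H.length) :
    PMF (Profile m n Φ) :=
  (PMF.uniformOfFinset (Finset.range H.length) (Finset.nonempty_range_iff.2 hH.ne')).bind
    fun t => indep fun i => A.mixed G i (H.take t)

end Dynamics

end EFG

end

noncomputable section

namespace EFG

/-! ### A weakest-precondition calculus for the machine -/

/-! Swap regret is reduced to external regret by learners on nested time scales. Put `E = ⌈1/ε⌉`, `M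
= rounds`, `R = reps` and `K = 2 ^ k`, where `K` is between `4E` and `8E`. Every player has `K`
external-regret learners and plays the average of their mixed strategies. The learner of level `j`
keeps its strategy fixed during rounds of `R * M ^ j` days and starts afresh after `M` rounds, so
one round of level `j + 1` is exactly one complete run of level `j`. During such a round level `j +
1` plays a fixed distribution. For each `s` in its support, `φ s` is a fixed comparator for the run
of level `j`, which therefore earns at least as much up to its regret. Averaging over `s`, the
payoff of level `j + 1` after the swap `φ` is at most the payoff of level `j` plus `3/(4E)` per day
(`deviation_le`). Summed over the levels, the payoffs cancel: only the swapped payoff of level 0 has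
nothing below to be charged to. It is at most 1 per day, hence at most `1/(4E)` after division by `K
≥ 4E`. The swap regret is thus at most `1/E ≤ ε` per day (`swap_regret`). The `R * M ^ K` days
account for the exponent of order `1/ε` in the running time.

The learners use exponential weights on the `n ^ Φ` pure strategies. Against fixed opponents, the
payoff is a constant plus a sum, over the own information sets that the strategy does not exclude,
of advantages that depend only on the action chosen there (`util_eq_add_sum`). Each advantage is the
difference of two payoffs of whole profiles, so the oracle for `u` suffices. Exponential weights for
such a sum factor along the forest of own information sets: with `Z h` the total weight of the
subtree at `h`, choosing `a` at `h` with probability `y h a * below Z h a / Z h`, independently for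
all `h`, has the right expectations (`Partition.expectation`). The usual potential argument with the
logarithm of the total weight then bounds the regret (`hedge`).

The machine has to do this exactly. Scores are integers and the growth factor is `1 + 1/L`, so the
weights are rational with explicit common denominators (`totalN`, `totalD`). A random number with
`coins` bits, read in mixed radix, yields every strategy with at least `1 - 1/L` times its intended
probability (`le_law`), and `hedge` tolerates this one-sided error. Correctness and cost are proved
together: a coin-free command whose loops run at most `ν` times and which stores numbers of at most
`ν` digits costs at most `(ν + 2) ^ deg` (`Cmd.terminates`), and the degree does not depend on `E`
or `k`.

The learners see only sampled pure strategies of the opponents. For one player, one strategy and one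
group of `R` consecutive days, an exponential supermartingale (`exp_moment_le`, `tail_le`) shows
that the realized payoff is within `R/(16E)` of the sum of its conditional expectations. A union
bound (`not_concentrated_le`, `failure_le`) leaves a failure probability of at most `2 ^ (-mnΦ)`,
which is `(mnΦ) ^ (-ω)` for `ω = decayRate`. Outside this event the swap regret bound holds for the
mixed strategies themselves, which is the equilibrium condition for the output
(`isNFCE_of_concentrated`). -/

@[simp] theorem Store.write_apply (μ : Store) (a k v a' k' : ℕ) :
    μ.write a k v a' k' = if a' = a ∧ k' = k then v else μ a' k' := by
  unfold Store.write
  by_cases ha : a' = a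
  · subst ha
    by_cases hk : k' = k <;> simp [hk]
  · simp [ha]

/-- Every cell of the memory holds a number of at most `ν` binary digits. -/
def Store.Bounded (ν : ℕ) (μ : Store) : Prop := ∀ a k, (μ a k).size ≤ ν

theorem Store.Bounded.write {ν : ℕ} {μ : Store} (hμ : μ.Bounded ν) (a k : ℕ) {v : ℕ}
    (hv : v.size ≤ ν) : (μ.write a k v).Bounded ν := by
  intro a' k'
  rw [Store.write_apply]
  split_ifs
  · exact hv
  · exact hμ a' k'

/-- All literals of a term have at most `ν` binary digits. -/
def Term.LitLe (ν : ℕ) : Term → Prop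
  | lit k => k.size ≤ ν
  | get _ idx => idx.LitLe ν
  | bin _ x y => x.LitLe ν ∧ y.LitLe ν

/-- The degree of the polynomial bound on the cost of a term. -/
def Term.deg : Term → ℕ
  | lit _ => 1
  | get _ idx => idx.deg + 2
  | bin _ x y => x.deg + y.deg + 3

/-- The degree of the polynomial bound on the cost of a command. -/
def Cmd.deg : Cmd → ℕ
  | set _ k e => k.deg + e.deg + 3
  | seq c d => c.deg + d.deg + 1
  | ite e c d => e.deg + c.deg + d.deg + 2
  | loop _ e c => e.deg + c.deg + 4
  | toss _ k e => k.deg + e.deg + 5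
  | query _ k _ b => k.deg + b.deg + 6

def Cmd.LitLe (ν : ℕ) : Cmd → Prop
  | set _ k e => k.LitLe ν ∧ e.LitLe ν
  | seq c d => c.LitLe ν ∧ d.LitLe ν
  | ite e c d => e.LitLe ν ∧ c.LitLe ν ∧ d.LitLe ν
  | loop _ e c => e.LitLe ν ∧ c.LitLe ν
  | toss _ k e => k.LitLe ν ∧ e.LitLe ν
  | query _ k _ b => k.LitLe ν ∧ b.LitLe ν

theorem size_apply_le (o : Op) (x y : ℕ) : (o.apply x y).size ≤ x.size + y.size + 1 := by
  have hx := Nat.lt_size_self x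
  have hy := Nat.lt_size_self y
  have h1 : 2 ^ x.size ≤ 2 ^ (x.size + y.size) := Nat.pow_le_pow_right (by norm_num) (by omega)
  have h2 : 2 ^ y.size ≤ 2 ^ (x.size + y.size) := Nat.pow_le_pow_right (by norm_num) (by omega)
  rw [Nat.size_le, pow_succ]
  cases o
  · simp only [Op.apply]; omega
  · simp only [Op.apply]; omega
  · simp only [Op.apply]
    calc x * y < 2 ^ x.size * 2 ^ y.size := Nat.mul_lt_mul'' hx hy
      _ = 2 ^ (x.size + y.size) := by rw [pow_add]
      _ ≤ _ := by omega
  · simp only [Op.apply]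
    have := Nat.div_le_self x y
    omega

/-- The base is at least 2, so one spare unit in the exponent pays for the sum. The additive
constants in `Cmd.deg` provide such spare units. -/
theorem add_two_pow_le {ν a b c : ℕ} (h : a + b + 1 ≤ c) :
    (ν + 2) ^ a + (ν + 2) ^ b ≤ (ν + 2) ^ c := by
  have ha : (ν + 2) ^ a ≤ (ν + 2) ^ (a + b) := Nat.pow_le_pow_right (by omega) (by omega)
  have hb : (ν + 2) ^ b ≤ (ν + 2) ^ (a + b) := Nat.pow_le_pow_right (by omega) (by omega)
  calc (ν + 2) ^ a + (ν + 2) ^ b ≤ (ν + 2) ^ (a + b) * 2 := by omega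
    _ ≤ (ν + 2) ^ (a + b) * (ν + 2) := Nat.mul_le_mul_left _ (by omega)
    _ = (ν + 2) ^ (a + b + 1) := by rw [pow_succ]
    _ ≤ _ := Nat.pow_le_pow_right (by omega) h

/-- The size of the value is included because the enclosing operation is charged for it, and
intermediate values, unlike memory cells, may have more than `ν` digits. -/
theorem Term.cost_add_size_le {ν : ℕ} {μ : Store} (hμ : μ.Bounded ν) :
    ∀ t : Term, t.LitLe ν → t.cost μ + (t.eval μ).size + 1 ≤ 2 * (ν + 2) ^ t.deg
  | lit k, h => by
      simp only [Term.cost, Term.eval, Term.deg, Term.LitLe, pow_one] at *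
      omega
  | get a idx, h => by
      have ih := idx.cost_add_size_le hμ h
      have hc := hμ a (idx.eval μ)
      simp only [Term.cost, Term.eval, Term.deg]
      have : 1 ≤ (ν + 2) ^ idx.deg := Nat.one_le_pow _ _ (by omega)
      rw [pow_add]
      nlinarith [Nat.mul_le_mul_right (ν * ν + 4 * ν + 4) this]
  | bin o x y, h => by
      have ihx := x.cost_add_size_le hμ h.1
      have ihy := y.cost_add_size_le hμ h.2
      have hs := size_apply_le o (x.eval μ) (y.eval μ)
      simp only [Term.cost, Term.eval, Term.deg]
      have h1 : (ν + 2) ^ x.deg + (ν + 2) ^ y.deg ≤ (ν + 2) ^ (x.deg + y.deg + 1) :=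
        add_two_pow_le le_rfl
      have h2 : 1 ≤ (ν + 2) ^ (x.deg + y.deg + 1) := Nat.one_le_pow _ _ (by omega)
      have h3 : (ν + 2) ^ (x.deg + y.deg + 3) = (ν + 2) ^ (x.deg + y.deg + 1) * (ν + 2) ^ 2 := by
        rw [← pow_add]
      have h4 : 4 ≤ (ν + 2) ^ 2 := Nat.pow_le_pow_left (show 2 ≤ ν + 2 by omega) 2
      rw [h3]
      nlinarith [Nat.mul_le_mul_left ((ν + 2) ^ (x.deg + y.deg + 1)) h4]

/-- Run `w` for `N` times, with the loop counter in `x`. -/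
def wpRep (w : (Store → Prop) → Store → Prop) (x : ℕ) : ℕ → (Store → Prop) → Store → Prop
  | 0, Q, μ => Q μ
  | N + 1, Q, μ => wpRep w x N (fun μ' => w Q (μ'.write x 0 N)) μ

/-- `c.wp O ν Q μ`: started in the memory `μ`, the command `c` tosses no coins, runs every loop at
most `ν` times, stores only numbers of at most `ν` digits, and establishes `Q`. -/
def Cmd.wp (O : Oracle) (ν : ℕ) : Cmd → (Store → Prop) → Store → Prop
  | set a k e, Q, μ => (e.eval μ).size ≤ ν ∧ Q (μ.write a (k.eval μ) (e.eval μ))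
  | seq c d, Q, μ => c.wp O ν (d.wp O ν Q) μ
  | ite e c d, Q, μ => (e.eval μ ≠ 0 → c.wp O ν Q μ) ∧ (e.eval μ = 0 → d.wp O ν Q μ)
  | loop x e c, Q, μ => e.eval μ ≤ ν ∧ wpRep (c.wp O ν) x (e.eval μ) Q μ
  | toss _ _ _, _, _ => False
  | query a k q b, Q, μ => b.eval μ ≤ ν ∧ (O.answer (μ q) (b.eval μ)).size ≤ ν ∧
      Q (μ.write a (k.eval μ) (O.answer (μ q) (b.eval μ)))

theorem wpRep_mono {w : (Store → Prop) → Store → Prop}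
    (hw : ∀ (Q Q' : Store → Prop), (∀ μ, Q μ → Q' μ) → ∀ μ, w Q μ → w Q' μ) (x : ℕ) :
    ∀ (N : ℕ) (Q Q' : Store → Prop), (∀ μ, Q μ → Q' μ) → ∀ μ, wpRep w x N Q μ → wpRep w x N Q' μ
  | 0, _, _, h, μ, hQ => h μ hQ
  | N + 1, _, _, h, μ, hQ => wpRep_mono hw x N _ _ (fun _ => hw _ _ h _) μ hQ

theorem Cmd.wp_mono {O : Oracle} {ν : ℕ} : ∀ (c : Cmd) (Q Q' : Store → Prop),
    (∀ μ, Q μ → Q' μ) → ∀ μ, c.wp O ν Q μ → c.wp O ν Q' μ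
  | set _ _ _, _, _, h, _, hQ => ⟨hQ.1, h _ hQ.2⟩
  | seq c d, _, _, h, _, hQ => c.wp_mono _ _ (d.wp_mono _ _ h) _ hQ
  | ite _ c d, _, _, h, _, hQ =>
      ⟨fun he => c.wp_mono _ _ h _ (hQ.1 he), fun he => d.wp_mono _ _ h _ (hQ.2 he)⟩
  | loop x _ c, _, _, h, _, hQ => ⟨hQ.1, wpRep_mono c.wp_mono x _ _ _ h _ hQ.2⟩
  | toss _ _ _, _, _, _, _, hQ => hQ
  | query _ _ _ _, _, _, h, _, hQ => ⟨hQ.1, hQ.2.1, h _ hQ.2.2⟩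

theorem wpRep_of_invariant {w : (Store → Prop) → Store → Prop}
    (hw : ∀ (Q Q' : Store → Prop), (∀ μ, Q μ → Q' μ) → ∀ μ, w Q μ → w Q' μ) {x : ℕ}
    (I : ℕ → Store → Prop) : ∀ (N : ℕ) (Q : Store → Prop) (μ : Store), I 0 μ →
    (∀ j < N, ∀ μ', I j μ' → w (I (j + 1)) (μ'.write x 0 j)) → (∀ μ', I N μ' → Q μ') →
    wpRep w x N Q μ
  | 0, _, μ, h0, _, hQ => hQ μ h0
  | N + 1, _, μ, h0, hs, hQ =>
      wpRep_of_invariant hw I N _ μ h0 (fun j hj => hs j (by omega))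
        fun μ' hμ' => hw _ _ hQ _ (hs N (by omega) μ' hμ')

/-- The loop rule. -/
theorem Cmd.wp_loop {O : Oracle} {ν x : ℕ} {e : Term} {c : Cmd} {Q : Store → Prop} {μ : Store}
    (N : ℕ) (hN : e.eval μ = N) (I : ℕ → Store → Prop) (hν : N ≤ ν) (h0 : I 0 μ)
    (hs : ∀ j < N, ∀ μ', I j μ' → c.wp O ν (I (j + 1)) (μ'.write x 0 j))
    (hQ : ∀ μ', I N μ' → Q μ') : (Cmd.loop x e c).wp O ν Q μ := by
  subst hN
  exact ⟨hν, wpRep_of_invariant c.wp_mono I _ Q μ h0 hs hQ⟩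

/-- Consequence of a terminating, coin-free run. -/
def Terminates (p : PMF (Store × ℕ)) (ν k : ℕ) (Q : Store → Prop) : Prop :=
  ∃ (μ : Store) (t : ℕ), p = PMF.pure (μ, t) ∧ t ≤ k ∧ Q μ ∧ μ.Bounded ν

theorem terminates_repeatCmd {O : Oracle} {ν k x : ℕ} {c : Cmd}
    (hc : ∀ (Q : Store → Prop) (μ : Store), μ.Bounded ν → c.wp O ν Q μ →
      Terminates (c.exec O μ) ν k Q) :
    ∀ (N : ℕ) (Q : Store → Prop) (μ : Store), N ≤ ν → μ.Bounded ν → wpRep (c.wp O ν) x N Q μ →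
      Terminates (repeatCmd (c.exec O) x μ N) ν (N * (1 + ν + k)) Q
  | 0, _, μ, _, hμ, h => ⟨μ, 0, rfl, by simp, h, hμ⟩
  | N + 1, Q, μ, hN, hμ, h => by
      obtain ⟨μ₁, t₁, h1, ht1, hQ1, hb1⟩ :=
        terminates_repeatCmd hc N _ μ (by omega) hμ h
      have hsz : N.size ≤ N := by
        rw [Nat.size_le]; exact Nat.lt_two_pow_self
      obtain ⟨μ₂, t₂, h2, ht2, hQ2, hb2⟩ := hc Q (μ₁.write x 0 N)
        (hb1.write x 0 (by omega)) hQ1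
      refine ⟨μ₂, t₁ + 1 + N.size + t₂, ?_, ?_, hQ2, hb2⟩
      · simp [repeatCmd, h1, h2, PMF.pure_bind, PMF.pure_map]
      · have : (N + 1) * (1 + ν + k) = N * (1 + ν + k) + (1 + ν + k) := by ring
        omega

/-- Induction over the syntax. The precondition bounds the number of iterations of every loop and
the length of everything that is stored, so a time bound comes with each proof of correctness and no
steps have to be counted later. -/
theorem Cmd.terminates {O : Oracle} {ν : ℕ} (hO : O.len ≤ ν) : ∀ (c : Cmd) (Q : Store → Prop)
    (μ : Store), c.LitLe ν → μ.Bounded ν → c.wp O ν Q μ →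
    Terminates (c.exec O μ) ν ((ν + 2) ^ c.deg) Q
  | set a k e, Q, μ, hl, hμ, h => by
      refine ⟨_, _, rfl, ?_, h.2, hμ.write _ _ h.1⟩
      have hk := k.cost_add_size_le hμ hl.1
      have he := e.cost_add_size_le hμ hl.2
      have h1 : (ν + 2) ^ k.deg + (ν + 2) ^ e.deg ≤ (ν + 2) ^ (k.deg + e.deg + 1) :=
        add_two_pow_le le_rfl
      have h3 : (ν + 2) ^ (k.deg + e.deg + 3) =
          (ν + 2) ^ (k.deg + e.deg + 1) * (ν + 2) ^ 2 := by rw [← pow_add]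
      have h4 : 4 ≤ (ν + 2) ^ 2 := Nat.pow_le_pow_left (show 2 ≤ ν + 2 by omega) 2
      simp only [Cmd.deg]
      rw [h3]
      nlinarith [Nat.mul_le_mul_left ((ν + 2) ^ (k.deg + e.deg + 1)) h4]
  | seq c d, Q, μ, hl, hμ, h => by
      obtain ⟨μ₁, t₁, h1, ht1, hQ1, hb1⟩ := c.terminates hO _ μ hl.1 hμ h
      obtain ⟨μ₂, t₂, h2, ht2, hQ2, hb2⟩ := d.terminates hO Q μ₁ hl.2 hb1 hQ1
      refine ⟨μ₂, t₁ + t₂, ?_, ?_, hQ2, hb2⟩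
      · simp [Cmd.exec, h1, h2, PMF.pure_bind, PMF.pure_map]
      · have := add_two_pow_le (ν := ν) (le_refl (c.deg + d.deg + 1))
        simp only [Cmd.deg]
        omega
  | ite e c d, Q, μ, hl, hμ, h => by
      have he := e.cost_add_size_le hμ hl.1
      have key : ∀ t, t ≤ (ν + 2) ^ (c.deg + d.deg) →
          e.cost μ + 1 + t ≤ (ν + 2) ^ (e.deg + c.deg + d.deg + 2) := by
        intro t ht
        have h1 : (ν + 2) ^ e.deg + (ν + 2) ^ (c.deg + d.deg) ≤
            (ν + 2) ^ (e.deg + c.deg + d.deg + 1) := add_two_pow_le (by omega)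
        have h3 : (ν + 2) ^ (e.deg + c.deg + d.deg + 2) =
          (ν + 2) ^ (e.deg + c.deg + d.deg + 1) * (ν + 2) := by rw [← pow_succ]
        rw [h3]
        nlinarith [Nat.zero_le (ν * (ν + 2) ^ (e.deg + c.deg + d.deg + 1))]
      by_cases hz : e.eval μ = 0
      · obtain ⟨μ₁, t₁, h1, ht1, hQ1, hb1⟩ := d.terminates hO _ μ hl.2.2 hμ (h.2 hz)
        exact ⟨μ₁, e.cost μ + 1 + t₁, by simp [Cmd.exec, hz, h1, PMF.pure_map],
          key _ (ht1.trans (Nat.pow_le_pow_right (by omega) (by omega))), hQ1, hb1⟩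
      · obtain ⟨μ₁, t₁, h1, ht1, hQ1, hb1⟩ := c.terminates hO _ μ hl.2.1 hμ (h.1 hz)
        exact ⟨μ₁, e.cost μ + 1 + t₁, by simp [Cmd.exec, hz, h1, PMF.pure_map],
          key _ (ht1.trans (Nat.pow_le_pow_right (by omega) (by omega))), hQ1, hb1⟩
  | loop x e c, Q, μ, hl, hμ, h => by
      have he := e.cost_add_size_le hμ hl.1
      obtain ⟨μ₁, t₁, h1, ht1, hQ1, hb1⟩ := terminates_repeatCmd (k := (ν + 2) ^ c.deg)
        (fun Q μ hμ hw => c.terminates hO Q μ hl.2 hμ hw) _ Q μ h.1 hμ h.2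
      refine ⟨μ₁, e.cost μ + 1 + t₁, by simp [Cmd.exec, h1, PMF.pure_map], ?_, hQ1, hb1⟩
      have hN : t₁ ≤ ν * (1 + ν + (ν + 2) ^ c.deg) :=
        ht1.trans (Nat.mul_le_mul_right _ h.1)
      have hc : 1 ≤ (ν + 2) ^ c.deg := Nat.one_le_pow _ _ (by omega)
      have hd : 1 ≤ (ν + 2) ^ e.deg := Nat.one_le_pow _ _ (by omega)
      have h2 : t₁ + (ν + 2) ^ c.deg ≤ (ν + 2) ^ (c.deg + 2) := by
        rw [pow_add]
        nlinarith [Nat.mul_le_mul_left (ν ^ 2) hc, Nat.mul_le_mul_left ν hc]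
      have h3 : (ν + 2) ^ e.deg + (ν + 2) ^ (c.deg + 2) ≤ (ν + 2) ^ (e.deg + c.deg + 3) :=
        add_two_pow_le (by omega)
      have h4 : (ν + 2) ^ (e.deg + c.deg + 4) = (ν + 2) ^ (e.deg + c.deg + 3) * (ν + 2) := by
        rw [← pow_succ]
      simp only [Cmd.deg]
      rw [h4]
      nlinarith [Nat.zero_le (ν * (ν + 2) ^ (e.deg + c.deg + 3))]
  | toss _ _ _, _, _, _, _, h => h.elim
  | query a k q b, Q, μ, hl, hμ, h => by
      refine ⟨_, _, rfl, ?_, h.2.2, hμ.write _ _ h.2.1⟩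
      have hk := k.cost_add_size_le hμ hl.1
      have hb := b.cost_add_size_le hμ hl.2
      have hs : ∑ j ∈ Finset.range O.len, (μ q j).size ≤ ν * ν := by
        calc ∑ j ∈ Finset.range O.len, (μ q j).size ≤ ∑ j ∈ Finset.range O.len, ν :=
              Finset.sum_le_sum fun j _ => hμ q j
          _ = O.len * ν := by simp
          _ ≤ _ := Nat.mul_le_mul_right _ hO
      have h1 : (ν + 2) ^ k.deg + (ν + 2) ^ b.deg ≤ (ν + 2) ^ (k.deg + b.deg + 1) :=
        add_two_pow_le le_rfl
      have h3 : (ν + 2) ^ (k.deg + b.deg + 6) =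
          (ν + 2) ^ (k.deg + b.deg + 1) * (ν + 2) ^ 5 := by rw [← pow_add]
      have h4 : 4 + (1 + 2 * ν + ν * ν) ≤ (ν + 2) ^ 5 := by
        have : 8 ≤ (ν + 2) ^ 3 := by
          calc 8 = 2 ^ 3 := by norm_num
            _ ≤ _ := Nat.pow_le_pow_left (by omega) 3
        rw [show (ν + 2) ^ 5 = (ν + 2) ^ 3 * (ν + 2) ^ 2 by rw [← pow_add]]
        nlinarith
      have h5 : 1 ≤ (ν + 2) ^ (k.deg + b.deg + 1) := Nat.one_le_pow _ _ (by omega)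
      simp only [Cmd.deg]
      rw [h3]
      have h6 := Nat.mul_le_mul_left ((ν + 2) ^ (k.deg + b.deg + 1)) h4
      have h7 := Nat.mul_le_mul_right (1 + 2 * ν + ν * ν) h5
      have hbν := h.1
      have haν := h.2.1
      nlinarith

end EFG

end

/-! ### The parameters of the dynamics and the program for the horizon -/

noncomputable section

namespace EFG

/-! ### Auxiliary syntax -/

abbrev Term.var (a : ℕ) : Term := .get a (.lit 0)

abbrev Cmd.assign (a : ℕ) (e : Term) : Cmd := .set a (.lit 0) e

/-- A command without effect. -/
abbrev Cmd.skip : Cmd := .loop 0 (.lit 0) (.set 0 (.lit 0) (.lit 0))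

/-- Nonzero iff `x` and `y` have different values. -/
abbrev Term.ne (x y : Term) : Term := .bin .add (.bin .sub x y) (.bin .sub y x)

infixl:65 " +ₜ " => Term.bin Op.add
infixl:65 " -ₜ " => Term.bin Op.sub
infixl:70 " *ₜ " => Term.bin Op.mul
infixl:70 " /ₜ " => Term.bin Op.div
infixr:30 " ;; " => Cmd.seq

/-- The memories `μ` and `μ'` agree outside the arrays in `S`. -/
abbrev Off (S : List ℕ) (μ μ' : Store) : Prop := ∀ a, a ∉ S → μ' a = μ a

theorem Off.refl (S : List ℕ) (μ : Store) : Off S μ μ := fun _ _ => rfl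

theorem Off.write {S : List ℕ} {μ μ' : Store} (h : Off S μ μ') {a : ℕ} (ha : a ∈ S) (k v : ℕ) :
    Off S μ (μ'.write a k v) := by
  intro b hb
  funext c
  rw [Store.write_apply, if_neg, h b hb]
  rintro ⟨rfl, -⟩
  exact hb ha

theorem Off.trans {S S' : List ℕ} {μ μ' μ'' : Store} (h : Off S μ μ') (h' : Off S' μ' μ'')
    (hS : S' ⊆ S) : Off S μ μ'' := fun a ha => (h' a fun hm => ha (hS hm)).trans (h a ha)

theorem size_le_of_le {x ν : ℕ} (h : x ≤ ν) : x.size ≤ ν := by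
  rw [Nat.size_le]
  exact lt_of_le_of_lt h Nat.lt_two_pow_self

theorem size_mono_le {x y ν : ℕ} (h : x ≤ y) (hy : y.size ≤ ν) : x.size ≤ ν :=
  (Nat.size_le_size h).trans hy

@[simp] theorem skip_wp {O : Oracle} {ν : ℕ} {Q : Store → Prop} {μ : Store} :
    Cmd.skip.wp O ν Q μ ↔ Q μ := by
  simp [Cmd.wp, wpRep, Term.eval]

section

variable {O : Oracle} {ν : ℕ} {Q : Store → Prop} {μ : Store}

theorem wp_set {a : ℕ} {k e : Term} : (Cmd.set a k e).wp O ν Q μ ↔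
    (e.eval μ).size ≤ ν ∧ Q (μ.write a (k.eval μ) (e.eval μ)) := Iff.rfl

theorem wp_seq {c d : Cmd} : (c ;; d).wp O ν Q μ ↔ c.wp O ν (d.wp O ν Q) μ := Iff.rfl

theorem wp_ite {e : Term} {c d : Cmd} : (Cmd.ite e c d).wp O ν Q μ ↔
    (e.eval μ ≠ 0 → c.wp O ν Q μ) ∧ (e.eval μ = 0 → d.wp O ν Q μ) := Iff.rfl

theorem wp_query {a : ℕ} {k : Term} {q : ℕ} {b : Term} : (Cmd.query a k q b).wp O ν Q μ ↔
    b.eval μ ≤ ν ∧ (O.answer (μ q) (b.eval μ)).size ≤ ν ∧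
      Q (μ.write a (k.eval μ) (O.answer (μ q) (b.eval μ))) := Iff.rfl

end

theorem sub_add_sub_eq_zero {x y : ℕ} : x - y + (y - x) = 0 ↔ x = y := by
  omega

/-! ### The parameters of the dynamics -/

section Parameters

variable (m n Φ E k : ℕ)

/-- A lower bound for the precision `q = 2 ^ bits`. The rounding errors `6 * Φ / q` and `4 / q` per
round must stay below `1 / (8 * E)`, and the factor `n` gives `log n ≤ bits`. -/
def target : ℕ := 48 * n * Φ * E

/-- Precision of the payoff queries, in bits. -/
def bits : ℕ := Nat.clog 2 (target n Φ E)

def prec : ℕ := 2 ^ bits n Φ E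

/-- The reciprocal of the learning rate. -/
def rate : ℕ := 32 * E * prec n Φ E

/-- The number of rounds of a single learner. -/
def rounds : ℕ := 512 * (E * E) * Φ * bits n Φ E

/-- Upper bound for the scores. -/
def cap : ℕ := rounds n Φ E * prec n Φ E

/-- How often a mixed strategy is repeated. -/
def reps : ℕ := 5120 * (E * E) * 2 ^ k * m * n * Φ * rounds n Φ E

/-- Every subtree total has at most `(n + 2 * cap * rate) * Φ` binary digits and there are `Φ` of
them; `rate` further bits make the relative sampling error at most `1 / rate`. -/
def coins : ℕ := (n + 2 * cap n Φ E * rate n Φ E) * (Φ * Φ) + rate n Φ E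

/-- The number of days. -/
def days : ℕ := reps m n Φ E k * rounds n Φ E ^ 2 ^ k

end Parameters

/-- Arrays: `4` precision, `5` its logarithm, `6` rounds, `7` rate, `8` cap, `9` repetitions. -/
def setup (E k : ℕ) : Cmd :=
  .assign 4 (.lit 1) ;; .assign 5 (.lit 0) ;;
  .loop 14 (.lit 48 *ₜ .get 0 (.lit 1) *ₜ .get 0 (.lit 2) *ₜ .lit E)
    (.ite ((.lit 48 *ₜ .get 0 (.lit 1) *ₜ .get 0 (.lit 2) *ₜ .lit E) -ₜ .var 4)
      (.assign 4 (.var 4 +ₜ .var 4) ;; .assign 5 (.var 5 +ₜ .lit 1)) .skip) ;;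
  .assign 6 (.lit (512 * (E * E)) *ₜ .get 0 (.lit 2) *ₜ .var 5) ;;
  .assign 7 (.lit (32 * E) *ₜ .var 4) ;;
  .assign 8 (.var 6 *ₜ .var 4) ;;
  .assign 9 (.lit (5120 * (E * E) * 2 ^ k) *ₜ .get 0 (.lit 0) *ₜ .get 0 (.lit 1) *ₜ
    .get 0 (.lit 2) *ₜ .var 6)

theorem setup_wp {O : Oracle} {ν E k m n Φ : ℕ} {Q : Store → Prop} {μ : Store}
    (hm : μ 0 0 = m) (hn : μ 0 1 = n) (hΦ : μ 0 2 = Φ) (h1 : 1 ≤ target n Φ E)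
    (h4 : 2 * target n Φ E ≤ ν) (h6 : rounds n Φ E ≤ ν) (h7 : rate n Φ E ≤ ν)
    (h8 : cap n Φ E ≤ ν) (h9 : reps m n Φ E k ≤ ν)
    (hQ : ∀ μ', Off [4, 5, 6, 7, 8, 9, 14] μ μ' → μ' 4 0 = prec n Φ E → μ' 5 0 = bits n Φ E →
      μ' 6 0 = rounds n Φ E → μ' 7 0 = rate n Φ E → μ' 8 0 = cap n Φ E →
      μ' 9 0 = reps m n Φ E k → Q μ') : (setup E k).wp O ν Q μ := by
  have hs1 : (1 : ℕ).size ≤ ν := size_le_of_le (by omega)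
  simp only [setup, wp_seq, wp_set, Term.eval]
  refine ⟨hs1, size_le_of_le (by omega), ?_⟩
  refine Cmd.wp_loop (target n Φ E) (by simp [Term.eval, Op.apply, hn, hΦ, target])
    -- Either the doubling has reached the target, or it has taken place in every iteration so far.
    -- After `target` iterations the second case also suffices, because `2 ^ target ≥ target`.
    (fun j μ' => Off [4, 5, 14] μ μ' ∧ μ' 4 0 = 2 ^ μ' 5 0 ∧ μ' 5 0 ≤ bits n Φ E ∧
      (target n Φ E ≤ μ' 4 0 ∨ μ' 5 0 = j)) (by omega) ?_ ?_ ?_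
  · refine ⟨((Off.refl _ μ).write (by decide) _ _).write (by decide) _ _, ?_, ?_, ?_⟩ <;> simp
  · rintro j hj μ' ⟨hoff, hq, hb, hor⟩
    simp only [wp_seq, wp_set, wp_ite, Term.eval, Op.apply, skip_wp]
    have ht : 48 * n * Φ * E = target n Φ E := rfl
    simp only [Store.write_apply]
    norm_num [hoff 0 (by decide), hn, hΦ, ht]
    have hoff' : Off [4, 5, 14] μ (μ'.write 14 0 j) := hoff.write (by decide) _ _
    constructor
    · intro hlt
      have hlt' : μ' 4 0 < target n Φ E := by omega
      have hb' : μ' 5 0 < bits n Φ E := by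
        rw [hq] at hlt'
        exact (Nat.lt_clog_iff_pow_lt (by norm_num)).2 hlt'
      refine ⟨size_le_of_le (by omega), ?_, ?_, ?_, ?_, ?_⟩
      · have : μ' 5 0 < 2 ^ μ' 5 0 := Nat.lt_two_pow_self
        exact size_le_of_le (by omega)
      · exact (hoff'.write (by decide) _ _).write (by decide) _ _
      · rw [hq, pow_succ]; ring
      · omega
      · right
        rcases hor with h | h
        · omega
        · omega
    · intro hge
      exact ⟨hoff', hq, hb, Or.inl (by omega)⟩
  · rintro μ' ⟨hoff, hq, hb, hor⟩
    have hge : target n Φ E ≤ μ' 4 0 := by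
      rcases hor with h | h
      · exact h
      · rw [hq, h]; exact Nat.lt_two_pow_self.le
    have h5 : μ' 5 0 = bits n Φ E := by
      refine le_antisymm hb ?_
      rw [hq] at hge
      exact (Nat.clog_le_iff_le_pow (by norm_num)).2 hge
    have h4' : μ' 4 0 = prec n Φ E := by rw [hq, h5, prec]
    simp only [wp_seq, wp_set, Term.eval, Op.apply]
    norm_num [hoff 0 (by decide), hm, hn, hΦ, h4', h5]
    refine ⟨size_le_of_le h6, size_le_of_le h7, ?_, ?_, ?_⟩
    · exact size_le_of_le h8
    · exact size_le_of_le h9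
    · apply hQ
      · have : Off [4, 5, 6, 7, 8, 9, 14] μ μ' := (Off.refl _ _).trans hoff (by decide)
        exact (((this.write (by decide) _ _).write (by decide) _ _).write (by decide) _ _).write
          (by decide) _ _
      · simp [h4']
      · simp [h5]
      · simp [rounds]
      · simp [rate]
      · simp [cap, rounds]
      · simp [reps, rounds]

def horizonCmd (E k : ℕ) : Cmd :=
  setup E k ;; .assign 3 (.var 9) ;; .loop 14 (.lit (2 ^ k)) (.assign 3 (.var 3 *ₜ .var 6))

theorem horizonCmd_wp {O : Oracle} {ν E k m n Φ : ℕ} {μ : Store}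
    (hm : μ 0 0 = m) (hn : μ 0 1 = n) (hΦ : μ 0 2 = Φ) (h1 : 1 ≤ target n Φ E)
    (h4 : 2 * target n Φ E ≤ ν) (h6 : rounds n Φ E ≤ ν) (h7 : rate n Φ E ≤ ν)
    (h8 : cap n Φ E ≤ ν) (h9 : days m n Φ E k ≤ ν) (hk : 2 ^ k ≤ ν) (hr : 1 ≤ rounds n Φ E) :
    (horizonCmd E k).wp O ν (fun μ' => μ' 3 0 = days m n Φ E k) μ := by
  have hR : ∀ j ≤ 2 ^ k, reps m n Φ E k * rounds n Φ E ^ j ≤ ν := fun j hj =>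
    (Nat.mul_le_mul_left _ (Nat.pow_le_pow_right hr hj)).trans h9
  refine setup_wp hm hn hΦ h1 h4 h6 h7 h8 (by simpa using hR 0 (by positivity)) ?_
  intro μ₁ hoff hq hb hM hL hX hRR
  simp only [wp_seq, wp_set, Term.eval]
  refine ⟨size_le_of_le (by rw [hRR]; simpa using hR 0 (by positivity)), ?_⟩
  refine Cmd.wp_loop (2 ^ k) rfl (fun j μ' => μ' 6 0 = rounds n Φ E ∧
    μ' 3 0 = reps m n Φ E k * rounds n Φ E ^ j) hk ?_ ?_ ?_
  · simp [hM, hRR]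
  · rintro j hj μ' ⟨h, h'⟩
    simp only [wp_set, Term.eval, Op.apply]
    simp only [Store.write_apply]
    norm_num [h, h']
    refine ⟨size_le_of_le ?_, ?_⟩
    · simpa [pow_succ, mul_assoc] using hR (j + 1) (by omega)
    · ring
  · rintro μ' ⟨-, h⟩
    exact h

end EFG

end

noncomputable section

namespace EFG

/-! ### Evaluating deviations -/

/-- The data that the player's program reads, once the level of the learner has been chosen. -/
structure Data where
  m : ℕ
  n : ℕ
  Φ : ℕ
  i : ℕ
  code : ℕ → ℕ
  hist : ℕ → ℕ
  b : ℕ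
  L : ℕ
  X : ℕ
  B : ℕ
  start : ℕ
  len : ℕ

structure Data.Holds (c : Data) (μ : Store) : Prop where
  m : μ 0 0 = c.m
  n : μ 0 1 = c.n
  Φ : μ 0 2 = c.Φ
  i : μ 0 3 = c.i
  code : μ 1 = c.code
  hist : μ 2 = c.hist
  b : μ 5 0 = c.b
  L : μ 7 0 = c.L
  X : μ 8 0 = c.X
  B : μ 11 0 = c.B
  start : μ 12 0 = c.start
  len : μ 13 0 = c.len

theorem Data.Holds.off {c : Data} {S : List ℕ} {μ μ' : Store} (h : c.Holds μ) (ho : Off S μ μ')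
    (hS : ∀ a ∈ [0, 1, 2, 5, 7, 8, 11, 12, 13], a ∉ S) : c.Holds μ' := by
  have h0 := ho 0 (hS 0 (by simp))
  have h1 := ho 1 (hS 1 (by simp))
  have h2 := ho 2 (hS 2 (by simp))
  have h5 := ho 5 (hS 5 (by simp))
  have h7 := ho 7 (hS 7 (by simp))
  have h8 := ho 8 (hS 8 (by simp))
  have h11 := ho 11 (hS 11 (by simp))
  have h12 := ho 12 (hS 12 (by simp))
  have h13 := ho 13 (hS 13 (by simp))
  constructor
  all_goals simp only [h0, h1, h2, h5, h7, h8, h11, h12, h13, h.m, h.n, h.Φ, h.i, h.code, h.hist,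
    h.b, h.L, h.X, h.B, h.start, h.len]

/-- One step on the way from an information set to the root. -/
def walkStep (n : ℕ) (code : ℕ → ℕ) (p : (ℕ → ℕ) × ℕ) : (ℕ → ℕ) × ℕ :=
  if p.2 = 0 then p
  else (Function.update p.1 ((p.2 - 1) / n) ((p.2 - 1) % n), code ((p.2 - 1) / n))

/-- The strategy that moves to `h`, plays `a` there, and plays `0` everywhere else. -/
def pathRow (n Φ : ℕ) (code : ℕ → ℕ) (h a : ℕ) : ℕ → ℕ :=
  ((walkStep n code)^[Φ] (Function.update 0 h a, code h)).1

/-- The own strategy `row`, with the strategies of the other players from the array `f`. -/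
def splice (Φ i : ℕ) (row f : ℕ → ℕ) (k : ℕ) : ℕ :=
  if i * Φ ≤ k ∧ k < i * Φ + Φ then row (k - i * Φ) else f k

/-- Array `20` becomes the query: the profile of the day `12` + `18`, with the own row replaced by
the strategy that moves to the information set in `16` and plays the action in `17` there. The last
entry, `Φ`, is not the index of an information set, so the oracle answers with the payoff of the
whole game. -/
def loadCmd : Cmd :=
  .loop 19 (.get 0 (.lit 0) *ₜ .get 0 (.lit 2)) (.set 20 (.var 19)
    (.get 2 ((.var 12 +ₜ .var 18) *ₜ (.get 0 (.lit 0) *ₜ .get 0 (.lit 2)) +ₜ .var 19))) ;;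
  .loop 19 (.get 0 (.lit 2))
    (.set 20 (.get 0 (.lit 3) *ₜ .get 0 (.lit 2) +ₜ .var 19) (.lit 0)) ;;
  .set 20 (.get 0 (.lit 3) *ₜ .get 0 (.lit 2) +ₜ .var 16) (.var 17) ;;
  .assign 21 (.get 1 (.var 16)) ;;
  .loop 22 (.get 0 (.lit 2)) (.ite (.var 21)
    (.set 20 (.get 0 (.lit 3) *ₜ .get 0 (.lit 2) +ₜ (.var 21 -ₜ .lit 1) /ₜ .get 0 (.lit 1))
        ((.var 21 -ₜ .lit 1) -ₜ
          (.var 21 -ₜ .lit 1) /ₜ .get 0 (.lit 1) *ₜ .get 0 (.lit 1)) ;;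
      .assign 21 (.get 1 ((.var 21 -ₜ .lit 1) /ₜ .get 0 (.lit 1)))) .skip) ;;
  .set 20 (.get 0 (.lit 0) *ₜ .get 0 (.lit 2)) (.get 0 (.lit 2))

theorem sub_div_mul_self (x n : ℕ) : x - x / n * n = x % n := by
  have := Nat.div_add_mod x n
  rw [mul_comm] at this
  omega

theorem splice_update {Φ i g v : ℕ} {row f : ℕ → ℕ} (hg : g < Φ) (k : ℕ) :
    splice Φ i (Function.update row g v) f k =
      if k = i * Φ + g then v else splice Φ i row f k := by
  unfold splice
  by_cases hk : k = i * Φ + g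
  · rw [if_pos hk, if_pos (by omega), show k - i * Φ = g by omega, Function.update_self]
  · rw [if_neg hk]
    split_ifs with h
    · rw [Function.update_of_ne (by omega)]
    · rfl

theorem loadCmd_wp {c : Data} {O : Oracle} {ν d h a : ℕ} {Q : Store → Prop} {μ : Store}
    (hc : c.Holds μ) (hd : μ 18 0 = d) (hh : μ 16 0 = h) (ha : μ 17 0 = a)
    (hm : 1 ≤ c.m) (hn : 1 ≤ c.n) (hi : c.i < c.m) (hhΦ : h < c.Φ)
    (hcode : ∀ g, c.code g ≤ c.Φ * c.n) (hhist : ∀ x, (c.hist x).size ≤ ν)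
    (haν : a ≤ ν) (hν : c.m * c.Φ ≤ ν) (hν' : c.Φ * c.n ≤ ν)
    (hQ : ∀ μ', Off [19, 20, 21, 22] μ μ' → μ' 20 (c.m * c.Φ) = c.Φ →
      (∀ k < c.m * c.Φ, μ' 20 k = splice c.Φ c.i (pathRow c.n c.Φ c.code h a)
        (fun k => c.hist ((c.start + d) * (c.m * c.Φ) + k)) k) → Q μ') :
    loadCmd.wp O ν Q μ := by
  have hΦm : c.Φ ≤ c.m * c.Φ := Nat.le_mul_of_pos_left _ hm
  have hrow : c.i * c.Φ + c.Φ ≤ c.m * c.Φ := by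
    rw [← Nat.succ_mul]; exact Nat.mul_le_mul_right _ hi
  set f : ℕ → ℕ := fun k => c.hist ((c.start + d) * (c.m * c.Φ) + k) with hf
  simp only [loadCmd, wp_seq]
  refine Cmd.wp_loop (c.m * c.Φ) (by simp [Term.eval, Op.apply, hc.m, hc.Φ])
    (fun j μ' => Off [19, 20, 21, 22] μ μ' ∧ ∀ k < j, μ' 20 k = f k) hν
    ⟨Off.refl _ _, by simp⟩ ?_ ?_
  · rintro j hj μ' ⟨hoff, hk⟩
    have hc' := hc.off hoff (by decide)
    rw [wp_set]
    simp only [Term.eval, Op.apply, Store.write_apply]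
    norm_num [hc'.m, hc'.Φ, hc'.hist, hc'.start, hoff 18 (by decide), hd]
    refine ⟨hhist _, (hoff.write (by decide) _ _).write (by decide) _ _, ?_⟩
    intro k hkj
    by_cases hkj' : k = j
    · subst hkj'; simp [hf]
    · simp [hkj', hk k (by omega)]
  rintro μ₁ ⟨hoff₁, hf₁⟩
  have hc₁ := hc.off hoff₁ (by decide)
  refine Cmd.wp_loop c.Φ (by simp [Term.eval, hc₁.Φ])
    (fun j μ' => Off [19, 20, 21, 22] μ μ' ∧ ∀ k < c.m * c.Φ, μ' 20 k =
      if c.i * c.Φ ≤ k ∧ k < c.i * c.Φ + j then 0 else f k) (by omega)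
    ⟨hoff₁, ?_⟩ ?_ ?_
  · intro k hk
    rw [if_neg (by omega), hf₁ k hk]
  · rintro j hj μ' ⟨hoff, hk⟩
    have hc' := hc.off hoff (by decide)
    rw [wp_set]
    simp only [Term.eval, Op.apply, Store.write_apply]
    norm_num [hc'.i, hc'.Φ]
    refine ⟨(hoff.write (by decide) _ _).write (by decide) _ _, ?_⟩
    intro k hkj
    by_cases hkj' : k = c.i * c.Φ + j
    · subst hkj'; simp
    · rw [if_neg hkj', hk k hkj]
      congr 1
      simp only [eq_iff_iff]
      omega
  rintro μ₂ ⟨hoff₂, hf₂⟩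
  have hc₂ := hc.off hoff₂ (by decide)
  simp only [wp_seq, wp_set, Term.eval, Op.apply, Store.write_apply]
  norm_num [hc₂.i, hc₂.Φ, hc₂.code, hoff₂ 16 (by decide), hoff₂ 17 (by decide), hh, ha]
  refine ⟨size_le_of_le haν, size_le_of_le ((hcode h).trans hν'), ?_⟩
  refine Cmd.wp_loop c.Φ (by simp [Term.eval, hc₂.Φ])
    (fun j μ' => Off [19, 20, 21, 22] μ μ' ∧
      (let p := (walkStep c.n c.code)^[j] (Function.update 0 h a, c.code h)
       μ' 21 0 = p.2 ∧ p.2 ≤ c.Φ * c.n ∧ ∀ k < c.m * c.Φ, μ' 20 k = splice c.Φ c.i p.1 f k))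
    (by omega) ⟨(hoff₂.write (by decide) _ _).write (by decide) _ _, ?_⟩ ?_ ?_
  · refine ⟨by simp, hcode h, ?_⟩
    intro k hk
    simp only [Function.iterate_zero, id, splice_update hhΦ, Store.write_apply]
    norm_num
    split_ifs with hkk
    · rfl
    · rw [hf₂ k hk]
      simp [splice]
  · rintro j hj μ' ⟨hoff, h21, hle, hk⟩
    have hc' := hc.off hoff (by decide)
    set p := (walkStep c.n c.code)^[j] (Function.update 0 h a, c.code h) with hp
    have hoff' : Off [19, 20, 21, 22] μ (μ'.write 22 0 j) := hoff.write (by decide) _ _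
    simp only [wp_ite, wp_seq, wp_set, skip_wp, Term.eval, Op.apply, Store.write_apply,
      Function.iterate_succ_apply', ← hp]
    norm_num [hc'.i, hc'.Φ, hc'.n, hc'.code, h21, sub_div_mul_self]
    constructor
    · intro hne
      have hlt : (p.2 - 1) / c.n < c.Φ := by
        rw [Nat.div_lt_iff_lt_mul hn]; omega
      refine ⟨?_, size_le_of_le ((hcode _).trans hν'),
        (hoff'.write (by decide) _ _).write (by decide) _ _, ?_⟩
      · refine size_le_of_le ((Nat.mod_le _ _).trans ?_)
        omega
      · simp only [walkStep, if_neg hne]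
        refine ⟨trivial, hcode _, ?_⟩
        intro k hkk
        rw [splice_update hlt]
        split_ifs with hkp
        · rfl
        · exact hk k hkk
    · intro hz
      refine ⟨hoff', ?_⟩
      simp only [walkStep, if_pos hz]
      exact ⟨trivial, hle, hk⟩
  rintro μ₃ ⟨hoff₃, -, -, hk₃⟩
  have hc₃ := hc.off hoff₃ (by decide)
  simp only [wp_set, Term.eval, Op.apply]
  norm_num [hc₃.Φ, hc₃.m]
  refine ⟨size_le_of_le (by omega), hQ _ (hoff₃.write (by decide) _ _) (by simp) ?_⟩
  intro k hk
  have : k ≠ c.m * c.Φ := by omega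
  simp only [Store.write_apply, this]
  simpa [pathRow] using hk₃ k hk

/-- The division by the length of a round keeps the scores bounded by a quantity that is independent
of the level, although a round of a high level contains very many days. -/
def scoreCmd : Cmd :=
  .assign 24 (.lit 0) ;;
  .loop 18 (.var 13) (loadCmd ;; .query 23 (.lit 0) 20 (.var 5) ;;
    .assign 24 (.var 24 +ₜ .var 23)) ;;
  .set 25 (.var 16 *ₜ .get 0 (.lit 1) +ₜ .var 17) (.var 24 /ₜ .var 11)

/-- The oracle answers `val d h a` about the strategy that moves to `h` and plays `a` there,
against the other players on day `d`. -/
def Data.Answers (c : Data) (O : Oracle) (val : ℕ → ℕ → ℕ → ℕ) : Prop :=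
  ∀ d < c.start + c.len, ∀ h < c.Φ, ∀ a < c.n, ∀ q : ℕ → ℕ, q (c.m * c.Φ) = c.Φ →
    (∀ k < c.m * c.Φ, q k = splice c.Φ c.i (pathRow c.n c.Φ c.code h a)
      (fun k => c.hist (d * (c.m * c.Φ) + k)) k) → O.answer q c.b = val d h a

/-- The cumulative payoff of an action, in units of one round. -/
def Data.score (c : Data) (val : ℕ → ℕ → ℕ → ℕ) (h a : ℕ) : ℕ :=
  (∑ d ∈ Finset.range c.len, val (c.start + d) h a) / c.B

structure Data.Fits (c : Data) (O : Oracle) (ν : ℕ) (val : ℕ → ℕ → ℕ → ℕ) : Prop where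
  m : 1 ≤ c.m
  n : 1 ≤ c.n
  i : c.i < c.m
  code : ∀ g, c.code g ≤ c.Φ * c.n
  hist : ∀ x, (c.hist x).size ≤ ν
  mΦ : c.m * c.Φ ≤ ν
  Φn : c.Φ * c.n ≤ ν
  b : c.b ≤ ν
  len : c.len ≤ ν
  val_le : ∀ d h a, val d h a ≤ ν
  sum : ∀ l ≤ c.len, ∀ h a, ∑ d ∈ Finset.range l, val (c.start + d) h a ≤ ν
  answers : c.Answers O val

theorem scoreCmd_wp {c : Data} {O : Oracle} {ν h a : ℕ} {val : ℕ → ℕ → ℕ → ℕ}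
    {Q : Store → Prop} {μ : Store} (hf : c.Fits O ν val) (hc : c.Holds μ) (hh : μ 16 0 = h)
    (ha : μ 17 0 = a) (hhΦ : h < c.Φ) (han : a < c.n)
    (hQ : ∀ μ', Off [18, 19, 20, 21, 22, 23, 24, 25] μ μ' →
      (∀ k, μ' 25 k = if k = h * c.n + a then c.score val h a else μ 25 k) → Q μ') :
    scoreCmd.wp O ν Q μ := by
  have haν : a ≤ ν := by
    have := hf.Φn
    nlinarith
  simp only [scoreCmd, wp_seq, wp_set, Term.eval]
  refine ⟨size_le_of_le (by omega), ?_⟩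
  refine Cmd.wp_loop c.len (by simp [Term.eval, hc.len])
    (fun j μ' => Off [18, 19, 20, 21, 22, 23, 24] μ μ' ∧
      μ' 24 0 = ∑ d ∈ Finset.range j, val (c.start + d) h a) hf.len
    ⟨(Off.refl _ _).write (by decide) _ _, by simp⟩ ?_ ?_
  · rintro j hj μ' ⟨hoff, hsum⟩
    have hoff' : Off [18, 19, 20, 21, 22, 23, 24] μ (μ'.write 18 0 j) :=
      hoff.write (by decide) _ _
    have hc' := hc.off hoff' (by decide)
    refine loadCmd_wp (d := j) hc' (by simp) (by rw [hoff' 16 (by decide), hh])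
      (by rw [hoff' 17 (by decide), ha]) hf.m hf.n hf.i hhΦ hf.code hf.hist haν hf.mΦ hf.Φn ?_
    intro μ'' hoff'' hlast hrow
    have hoff₂ : Off [18, 19, 20, 21, 22, 23, 24] μ μ'' := hoff'.trans hoff'' (by decide)
    have hc'' := hc.off hoff₂ (by decide)
    have hans : O.answer (μ'' 20) c.b = val (c.start + j) h a :=
      hf.answers _ (by omega) h hhΦ a han _ hlast hrow
    have h24 : μ'' 24 0 = ∑ d ∈ Finset.range j, val (c.start + d) h a := by
      rw [hoff'' 24 (by decide)]; simpa using hsum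
    simp only [wp_seq, wp_query, wp_set, Term.eval, Op.apply, Store.write_apply]
    norm_num [hc''.b, hans, h24]
    rw [← Finset.sum_range_succ (fun d => val (c.start + d) h a) j]
    exact ⟨hf.b, size_le_of_le (hf.val_le _ _ _), size_le_of_le (hf.sum _ (by omega) _ _),
      (hoff₂.write (by decide) _ _).write (by decide) _ _, rfl⟩
  · rintro μ' ⟨hoff, hsum⟩
    have hc' := hc.off hoff (by decide)
    simp only [wp_set, Term.eval, Op.apply]
    rw [hoff 16 (by decide), hoff 17 (by decide), hh, ha, hsum, hc'.n, hc'.B]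
    refine ⟨size_le_of_le ((Nat.div_le_self _ _).trans (hf.sum _ le_rfl _ _)), hQ _ ?_ ?_⟩
    · exact ((Off.refl _ _).trans hoff (by decide)).write (by decide) _ _
    · intro k
      rw [Store.write_apply]
      simp [Data.score, hoff 25 (by decide)]

def scoresCmd : Cmd := .loop 16 (.get 0 (.lit 2)) (.loop 17 (.get 0 (.lit 1)) scoreCmd)

theorem index_inj {n h a h' a' : ℕ} (ha : a < n) (ha' : a' < n)
    (e : h * n + a = h' * n + a') : h = h' ∧ a = a' := by
  have h1 : (h * n + a) / n = h := by
    rw [mul_comm, Nat.mul_add_div (by omega), Nat.div_eq_of_lt ha, add_zero]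
  have h2 : (h' * n + a') / n = h' := by
    rw [mul_comm, Nat.mul_add_div (by omega), Nat.div_eq_of_lt ha', add_zero]
  have : h = h' := by rw [← h1, ← h2, e]
  subst this
  exact ⟨rfl, by omega⟩

theorem scoresCmd_wp {c : Data} {O : Oracle} {ν : ℕ} {val : ℕ → ℕ → ℕ → ℕ}
    {Q : Store → Prop} {μ : Store} (hf : c.Fits O ν val) (hc : c.Holds μ)
    (hQ : ∀ μ', Off [16, 17, 18, 19, 20, 21, 22, 23, 24, 25] μ μ' →
      (∀ h < c.Φ, ∀ a < c.n, μ' 25 (h * c.n + a) = c.score val h a) → Q μ') :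
    scoresCmd.wp O ν Q μ := by
  have hΦν : c.Φ ≤ ν := (Nat.le_mul_of_pos_left _ hf.m).trans hf.mΦ
  refine Cmd.wp_loop c.Φ (by simp [Term.eval, hc.Φ])
    (fun j μ' => Off [16, 17, 18, 19, 20, 21, 22, 23, 24, 25] μ μ' ∧
      ∀ h < j, ∀ a < c.n, μ' 25 (h * c.n + a) = c.score val h a) hΦν
    ⟨Off.refl _ _, by simp⟩ ?_ ?_
  · rintro j hj μ₁ ⟨hoff₁, h₁⟩
    have hoff₁' : Off [16, 17, 18, 19, 20, 21, 22, 23, 24, 25] μ (μ₁.write 16 0 j) :=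
      hoff₁.write (by decide) _ _
    have hc₁ := hc.off hoff₁' (by decide)
    have hnν : c.n ≤ ν := (Nat.le_mul_of_pos_left _ (by omega)).trans hf.Φn
    refine Cmd.wp_loop c.n (by simpa [Term.eval] using hc₁.n)
      (fun l μ' => Off [16, 17, 18, 19, 20, 21, 22, 23, 24, 25] μ μ' ∧ μ' 16 0 = j ∧
        (∀ h < j, ∀ a < c.n, μ' 25 (h * c.n + a) = c.score val h a) ∧
        ∀ a < l, μ' 25 (j * c.n + a) = c.score val j a) hnν
      ⟨hoff₁', by simp, by simpa using h₁, by simp⟩ ?_ ?_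
    · rintro l hl μ₂ ⟨hoff₂, hj₂, h₂, h₂'⟩
      have hoff₂' : Off [16, 17, 18, 19, 20, 21, 22, 23, 24, 25] μ (μ₂.write 17 0 l) :=
        hoff₂.write (by decide) _ _
      refine scoreCmd_wp hf (hc.off hoff₂' (by decide)) (h := j) (a := l) (by simp [hj₂])
        (by simp) hj hl ?_
      intro μ₃ hoff₃ h25
      refine ⟨hoff₂'.trans hoff₃ (by decide), ?_, ?_, ?_⟩
      · rw [hoff₃ 16 (by decide)]; simp [hj₂]
      · intro h hh a ha
        rw [h25, if_neg]
        · simpa using h₂ h hh a ha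
        · intro e
          have := (index_inj ha hl e).1
          omega
      · intro a ha
        rw [h25]
        split_ifs with e
        · rw [(index_inj (by omega) hl e).2]
        · have : a ≠ l := fun e' => e (by rw [e'])
          simpa using h₂' a (by omega)
    · rintro μ₂ ⟨hoff₂, -, h₂, h₂'⟩
      refine ⟨hoff₂, fun h hh a ha => ?_⟩
      by_cases e : h = j
      · subst e; exact h₂' a ha
      · exact h₂ h (by omega) a ha
  · rintro μ' ⟨hoff, h⟩
    exact hQ _ hoff h

end EFG

end

noncomputable section

namespace EFG

/-! ### Total weights of the subtrees -/

section Recursion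

variable (n Φ : ℕ) (code : ℕ → ℕ) (base : ℕ) (wgt : ℕ → ℕ → ℕ) (N D : ℕ → ℕ)

/-- The contribution of `h'` to the common denominator at `h`. -/
def facD (h h' : ℕ) : ℕ := if code h' ≠ 0 ∧ (code h' - 1) / n = h then D h' else 1

/-- The contribution of `h'` to the weight of the action `a` at `h`. -/
def facN (h a h' : ℕ) : ℕ := if code h' = h * n + a + 1 then N h' else facD n code D h h'

def nextD (h : ℕ) : ℕ := base * ∏ h' ∈ Finset.range Φ, facD n code D h h'

def nextW (h a : ℕ) : ℕ := wgt h a * ∏ h' ∈ Finset.range Φ, facN n code N D h a h'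

def nextN (h : ℕ) : ℕ := ∑ a ∈ Finset.range n, nextW n Φ code wgt N D h a

variable {n Φ code base wgt N D} {N' D' : ℕ → ℕ}

theorem facD_mono (hD : ∀ h < Φ, D h ≤ D' h) (h : ℕ) {h' : ℕ} (hh : h' < Φ) :
    facD n code D h h' ≤ facD n code D' h h' := by
  unfold facD
  split_ifs
  · exact hD _ hh
  · exact le_rfl

theorem facN_mono (hN : ∀ h < Φ, N h ≤ N' h) (hD : ∀ h < Φ, D h ≤ D' h) (h a : ℕ) {h' : ℕ}
    (hh : h' < Φ) : facN n code N D h a h' ≤ facN n code N' D' h a h' := by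
  unfold facN
  split_ifs
  · exact hN _ hh
  · exact facD_mono hD h hh

/-- A partial product of smaller factors stays below the full product because the missing factors
are at least 1. This bounds the accumulator of a multiplication loop by its intended final value. -/
theorem prod_range_le {f g : ℕ → ℕ} {j : ℕ} (hj : j ≤ Φ) (hfg : ∀ h < Φ, f h ≤ g h)
    (hg : ∀ h < Φ, 1 ≤ g h) : ∏ h ∈ Finset.range j, f h ≤ ∏ h ∈ Finset.range Φ, g h :=
  (Finset.prod_le_prod' fun h hh => hfg h (by rw [Finset.mem_range] at hh; omega)).trans
    (Finset.prod_le_prod_of_subset_of_one_le' (Finset.range_subset_range.2 hj)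
      fun h hh _ => hg h (Finset.mem_range.1 hh))

theorem one_le_facD (hD : ∀ h < Φ, 1 ≤ D h) (h : ℕ) {h' : ℕ} (hh : h' < Φ) :
    1 ≤ facD n code D h h' := by
  unfold facD
  split_ifs
  · exact hD _ hh
  · exact le_rfl

theorem one_le_facN (hN : ∀ h < Φ, 1 ≤ N h) (hD : ∀ h < Φ, 1 ≤ D h) (h a : ℕ) {h' : ℕ}
    (hh : h' < Φ) : 1 ≤ facN n code N D h a h' := by
  unfold facN
  split_ifs
  · exact hN _ hh
  · exact one_le_facD hD h hh

end Recursion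

/-- The numerator of the exponential weight with score `y`, relative to the reference score
`y₀`. -/
def weight (L X y y₀ : ℕ) : ℕ := (L + 1) ^ (X + y - y₀) * L ^ (X + y₀ - y)

/-- The current weights: arrays `26` (denominators), `27` (sums) and `29` (weights of actions)
are computed from the scores in array `25`. -/
def updateCmd : Cmd :=
  .assign 32 (.var 28) ;;
  .loop 31 (.get 0 (.lit 2)) (.ite (.get 1 (.var 31))
    (.ite (.ne ((.get 1 (.var 31) -ₜ .lit 1) /ₜ .get 0 (.lit 1)) (.var 16)) .skip
      (.assign 32 (.var 32 *ₜ .get 26 (.var 31)))) .skip) ;;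
  .set 26 (.var 16) (.var 32) ;;
  .assign 33 (.lit 0) ;;
  .loop 17 (.get 0 (.lit 1)) (
    .assign 32 (.lit 1) ;;
    .loop 14 ((.var 8 +ₜ .get 25 (.var 16 *ₜ .get 0 (.lit 1) +ₜ .var 17)) -ₜ
        .get 25 (.var 16 *ₜ .get 0 (.lit 1)))
      (.assign 32 (.var 32 *ₜ (.var 7 +ₜ .lit 1))) ;;
    .loop 14 ((.var 8 +ₜ .get 25 (.var 16 *ₜ .get 0 (.lit 1))) -ₜ
        .get 25 (.var 16 *ₜ .get 0 (.lit 1) +ₜ .var 17))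
      (.assign 32 (.var 32 *ₜ .var 7)) ;;
    .loop 31 (.get 0 (.lit 2))
      (.ite (.ne (.get 1 (.var 31)) (.var 16 *ₜ .get 0 (.lit 1) +ₜ .var 17 +ₜ .lit 1))
        (.ite (.get 1 (.var 31))
          (.ite (.ne ((.get 1 (.var 31) -ₜ .lit 1) /ₜ .get 0 (.lit 1)) (.var 16)) .skip
            (.assign 32 (.var 32 *ₜ .get 26 (.var 31)))) .skip)
        (.assign 32 (.var 32 *ₜ .get 27 (.var 31)))) ;;
    .set 29 (.var 16 *ₜ .get 0 (.lit 1) +ₜ .var 17) (.var 32) ;;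
    .assign 33 (.var 33 +ₜ .var 32)) ;;
  .set 27 (.var 16) (.var 33)

/-- The weight system that `updateCmd` iterates, with the solution `N`, `D`. -/
structure Data.Solves (c : Data) (ν base : ℕ) (Y : ℕ → ℕ → ℕ) (N D : ℕ → ℕ) : Prop where
  D_eq : ∀ h < c.Φ, D h = nextD c.n c.Φ c.code base D h
  N_eq : ∀ h < c.Φ, N h =
    nextN c.n c.Φ c.code (fun h a => weight c.L c.X (Y h a) (Y h 0)) N D h
  base : 1 ≤ base
  L : 1 ≤ c.L
  n : 1 ≤ c.n
  D_pos : ∀ h < c.Φ, 1 ≤ D h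
  N_pos : ∀ h < c.Φ, 1 ≤ N h
  D_le : ∀ h < c.Φ, (D h).size ≤ ν
  N_le : ∀ h < c.Φ, (N h).size ≤ ν
  Y_le : ∀ h < c.Φ, ∀ a < c.n, Y h a ≤ c.X
  X_le : 2 * c.X ≤ ν
  Φ_pos : 1 ≤ c.Φ
  Φ_le : c.Φ ≤ ν
  n_le : c.n ≤ ν

variable {c : Data} {O : Oracle} {ν base : ℕ} {Y : ℕ → ℕ → ℕ} {N D : ℕ → ℕ}

theorem Data.Solves.nextW_le (hs : c.Solves ν base Y N D) {h a : ℕ} (hh : h < c.Φ)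
    (ha : a < c.n) :
    nextW c.n c.Φ c.code (fun h a => weight c.L c.X (Y h a) (Y h 0)) N D h a ≤ N h := by
  rw [hs.N_eq h hh]
  exact Finset.single_le_sum (f := nextW c.n c.Φ c.code _ N D h) (fun _ _ => Nat.zero_le _)
    (Finset.mem_range.2 ha)

theorem power_loop_wp {O : Oracle} {ν p x w : ℕ} {e t : Term} {Q : Store → Prop} {μ : Store}
    (he : e.eval μ = p) (hw : μ 32 0 = w) (hp : p ≤ ν)
    (ht : ∀ μ', Off [14, 32] μ μ' → t.eval μ' = x) (hle : ∀ j ≤ p, (w * x ^ j).size ≤ ν)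
    (hQ : ∀ μ', Off [14, 32] μ μ' → μ' 32 0 = w * x ^ p → Q μ') :
    (Cmd.loop 14 e (.assign 32 (.var 32 *ₜ t))).wp O ν Q μ := by
  refine Cmd.wp_loop p he (fun j μ' => Off [14, 32] μ μ' ∧ μ' 32 0 = w * x ^ j) hp
    ⟨Off.refl _ _, by simp [hw]⟩ ?_ ?_
  · rintro j hj μ' ⟨hoff, h⟩
    have hoff' : Off [14, 32] μ (μ'.write 14 0 j) := hoff.write (by decide) _ _
    simp only [wp_set, Term.eval, Op.apply, ht _ hoff']
    have e : μ'.write 14 0 j 32 0 * x = w * x ^ (j + 1) := by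
      simp [h, pow_succ, mul_assoc]
    rw [e]
    exact ⟨hle (j + 1) (by omega), hoff'.write (by decide) _ _, by simp⟩
  · rintro μ' ⟨hoff, h⟩
    exact hQ _ hoff h

/-- The arrays need not be correct yet, only below the solution `N`, `D`. The recursion is monotone,
so every intermediate number is below a final one and inherits its bound on the number of digits. -/
theorem updateCmd_wp {h : ℕ} {Q : Store → Prop} {μ : Store} (hs : c.Solves ν base Y N D)
    (hc : c.Holds μ) (hh : μ 16 0 = h) (hhΦ : h < c.Φ) (hbase : μ 28 0 = base)
    (hY : ∀ h < c.Φ, ∀ a < c.n, μ 25 (h * c.n + a) = Y h a)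
    (hD : ∀ h < c.Φ, μ 26 h ≤ D h) (hN : ∀ h < c.Φ, μ 27 h ≤ N h)
    (hQ : ∀ μ', Off [14, 17, 26, 27, 29, 31, 32, 33] μ μ' →
      (∀ k, μ' 26 k = if k = h then nextD c.n c.Φ c.code base (μ 26) h else μ 26 k) →
      (∀ k, μ' 27 k = if k = h then nextN c.n c.Φ c.code
        (fun h a => weight c.L c.X (Y h a) (Y h 0)) (μ 27) (μ' 26) h else μ 27 k) →
      (∀ k < c.Φ, ∀ a < c.n, μ' 29 (k * c.n + a) = if k = h then nextW c.n c.Φ c.code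
        (fun h a => weight c.L c.X (Y h a) (Y h 0)) (μ 27) (μ' 26) h a
        else μ 29 (k * c.n + a)) → Q μ') :
    updateCmd.wp O ν Q μ := by
  have hbD : ∀ j ≤ c.Φ,
      base * ∏ h' ∈ Finset.range j, facD c.n c.code (μ 26) h h' ≤ D h := by
    intro j hj
    rw [hs.D_eq h hhΦ]
    exact Nat.mul_le_mul_left _ (prod_range_le hj (fun h' hh' => facD_mono hD h hh')
      fun h' hh' => one_le_facD hs.D_pos h hh')
  simp only [updateCmd, wp_seq, wp_set, Term.eval]
  have hb0 : base.size ≤ ν := size_mono_le (by simpa using hbD 0 (by omega)) (hs.D_le h hhΦ)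
  refine ⟨by rwa [hbase], ?_⟩
  refine Cmd.wp_loop c.Φ (by simp [Term.eval, hc.Φ])
    (fun j μ' => Off [31, 32] μ μ' ∧
      μ' 32 0 = base * ∏ h' ∈ Finset.range j, facD c.n c.code (μ 26) h h') hs.Φ_le
    ⟨(Off.refl _ _).write (by decide) _ _, by simp [hbase]⟩ ?_ ?_
  · rintro j hj μ' ⟨hoff, h32⟩
    have hoff' : Off [31, 32] μ (μ'.write 31 0 j) := hoff.write (by decide) _ _
    have hc' := hc.off hoff (by decide)
    have hle := size_mono_le (hbD (j + 1) (by omega)) (hs.D_le h hhΦ)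
    simp only [wp_ite, wp_set, skip_wp, sub_add_sub_eq_zero, ne_eq, Term.eval, Op.apply,
      Store.write_apply]
    norm_num [-mul_eq_mul_left_iff, hc'.code, hc'.n, hoff 16 (by decide), hh, h32,
      hoff 26 (by decide)]
    rw [Finset.prod_range_succ, ← mul_assoc] at hle ⊢
    refine ⟨fun h1 => ⟨fun h2 => ?_, fun h2 => ?_⟩, fun h1 => ?_⟩
    · rw [facD, if_neg (by tauto), mul_one]
      exact ⟨hoff', rfl⟩
    · have hfac : facD c.n c.code (μ 26) h j = μ 26 j := by rw [facD, if_pos ⟨h1, h2⟩]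
      rw [hfac] at hle ⊢
      exact ⟨hle, hoff'.write (by decide) _ _, rfl⟩
    · rw [facD, if_neg (by tauto), mul_one]
      exact ⟨hoff', rfl⟩
  rintro μ₁ ⟨hoff₁, h32₁⟩
  rw [show base * ∏ h' ∈ Finset.range c.Φ, facD c.n c.code (μ 26) h h' =
    nextD c.n c.Φ c.code base (μ 26) h from rfl] at h32₁
  simp only [wp_seq, wp_set, Term.eval, h32₁, hoff₁ 16 (by decide), hh]
  refine ⟨size_mono_le (hbD c.Φ le_rfl) (hs.D_le h hhΦ), size_le_of_le (by omega), ?_⟩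
  set μ₂ := (μ₁.write 26 h (nextD c.n c.Φ c.code base (μ 26) h)).write 33 0 0 with hμ₂
  have hoff₂ : Off [26, 31, 32, 33] μ μ₂ :=
    (((Off.refl _ _).trans hoff₁ (by decide)).write (by decide) _ _).write (by decide) _ _
  have h26 : ∀ k, μ₂ 26 k = if k = h then nextD c.n c.Φ c.code base (μ 26) h else μ 26 k := by
    intro k
    simp [hμ₂, hoff₁ 26 (by decide)]
  have hD₂ : ∀ k < c.Φ, μ₂ 26 k ≤ D k := by
    intro k hk
    rw [h26]
    split_ifs with e
    · subst e; exact hbD c.Φ le_rfl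
    · exact hD k hk
  have h33 : μ₂ 33 0 = 0 := by simp [hμ₂]
  clear_value μ₂
  have hWN : ∀ a < c.n, ∀ j ≤ c.Φ, weight c.L c.X (Y h a) (Y h 0) *
      ∏ h' ∈ Finset.range j, facN c.n c.code (μ 27) (μ₂ 26) h a h' ≤
      nextW c.n c.Φ c.code (fun h a => weight c.L c.X (Y h a) (Y h 0)) N D h a := by
    intro a ha j hj
    exact Nat.mul_le_mul_left _ (prod_range_le hj (fun h' hh' => facN_mono hN hD₂ h a hh')
      fun h' hh' => one_le_facN hs.N_pos hs.D_pos h a hh')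
  have hW : ∀ a < c.n, ∀ j ≤ c.Φ, (weight c.L c.X (Y h a) (Y h 0) *
      ∏ h' ∈ Finset.range j, facN c.n c.code (μ 27) (μ₂ 26) h a h').size ≤ ν :=
    fun a ha j hj => size_mono_le ((hWN a ha j hj).trans (hs.nextW_le hhΦ ha)) (hs.N_le h hhΦ)
  have hS : ∀ l ≤ c.n, (∑ a ∈ Finset.range l, nextW c.n c.Φ c.code
      (fun h a => weight c.L c.X (Y h a) (Y h 0)) (μ 27) (μ₂ 26) h a).size ≤ ν := by
    intro l hl
    refine size_mono_le ?_ (hs.N_le h hhΦ)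
    rw [hs.N_eq h hhΦ]
    refine (Finset.sum_le_sum fun a ha => ?_).trans
      (Finset.sum_le_sum_of_subset (Finset.range_subset_range.2 hl))
    exact hWN a (by rw [Finset.mem_range] at ha; omega) c.Φ le_rfl
  have hc₂ := hc.off hoff₂ (by decide)
  have hn1 := hs.n
  refine Cmd.wp_loop c.n (by simp [Term.eval, hc₂.n])
    (fun l μ' => Off [14, 17, 29, 31, 32, 33] μ₂ μ' ∧
      μ' 33 0 = ∑ a ∈ Finset.range l, nextW c.n c.Φ c.code
        (fun h a => weight c.L c.X (Y h a) (Y h 0)) (μ 27) (μ₂ 26) h a ∧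
      ∀ k < c.Φ, ∀ a < c.n, μ' 29 (k * c.n + a) = if k = h ∧ a < l then nextW c.n c.Φ c.code
        (fun h a => weight c.L c.X (Y h a) (Y h 0)) (μ 27) (μ₂ 26) h a
        else μ 29 (k * c.n + a)) hs.n_le
    ⟨Off.refl _ _, by simp [h33], by simp [hoff₂ 29 (by decide)]⟩ ?_ ?_
  · rintro l hl μ₃ ⟨hoff₃, h33₃, h29₃⟩
    simp only [wp_seq, wp_set, Term.eval]
    refine ⟨size_le_of_le (by have := hs.n_le; omega), ?_⟩
    set μ₄ := (μ₃.write 17 0 l).write 32 0 1 with hμ₄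
    have hoff₄ : Off [14, 17, 29, 31, 32, 33] μ₂ μ₄ :=
      (hoff₃.write (by decide) _ _).write (by decide) _ _
    have h17 : μ₄ 17 0 = l := by simp [hμ₄]
    have h32₄ : μ₄ 32 0 = 1 := by simp [hμ₄]
    have h33₄ : μ₄ 33 0 = μ₃ 33 0 := by simp [hμ₄]
    have h29₄ : ∀ k, μ₄ 29 k = μ₃ 29 k := by simp [hμ₄]
    clear_value μ₄
    have hc₄ := hc₂.off hoff₄ (by decide)
    have h16₄ : μ₄ 16 0 = h := by rw [hoff₄ 16 (by decide), hoff₂ 16 (by decide), hh]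
    have hYl : μ₄ 25 (h * c.n + l) = Y h l := by
      rw [hoff₄ 25 (by decide), hoff₂ 25 (by decide), hY h hhΦ l hl]
    have hY0 : μ₄ 25 (h * c.n) = Y h 0 := by
      rw [hoff₄ 25 (by decide), hoff₂ 25 (by decide)]
      exact hY h hhΦ 0 (by omega)
    have hYl' := hs.Y_le h hhΦ l hl
    have hY0' := hs.Y_le h hhΦ 0 (by omega)
    have hX := hs.X_le
    have hL := hs.L
    have hwν : (weight c.L c.X (Y h l) (Y h 0)).size ≤ ν := by
      simpa using hW l hl 0 (by omega)
    refine power_loop_wp (p := c.X + Y h l - Y h 0) (x := c.L + 1) (w := 1)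
      (by simp [Term.eval, Op.apply, hc₄.X, hc₄.n, h16₄, h17, hYl, hY0]) h32₄ (by omega)
      (fun μ' ho => by simp [Term.eval, Op.apply, (hc₄.off ho (by decide)).L]) ?_ ?_
    · intro j hj
      rw [one_mul]
      refine size_mono_le ?_ hwν
      exact (Nat.pow_le_pow_right (by omega) hj).trans
        (Nat.le_mul_of_pos_right _ (Nat.pow_pos (by omega)))
    intro μ₅ hoff₅ h32₅
    have hc₅ := hc₄.off hoff₅ (by decide)
    refine power_loop_wp (p := c.X + Y h 0 - Y h l) (x := c.L)
      (w := (c.L + 1) ^ (c.X + Y h l - Y h 0))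
      (by simp [Term.eval, Op.apply, hc₅.X, hc₅.n, hoff₅ 16 (by decide), hoff₅ 25 (by decide),
        hoff₅ 17 (by decide), h16₄, h17, hYl, hY0]) (by rw [h32₅, one_mul]) (by omega)
      (fun μ' ho => by simp [Term.eval, (hc₅.off ho (by decide)).L]) ?_ ?_
    · intro j hj
      refine size_mono_le ?_ hwν
      exact Nat.mul_le_mul_left _ (Nat.pow_le_pow_right (by omega) hj)
    intro μ₆ hoff₆ h32₆
    have hoff₆' : Off [14, 32] μ₄ μ₆ := hoff₅.trans hoff₆ (by decide)
    have hc₆ := hc₅.off hoff₆ (by decide)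
    refine Cmd.wp_loop c.Φ (by simp [Term.eval, hc₆.Φ])
      (fun j μ' => Off [14, 31, 32] μ₄ μ' ∧ μ' 32 0 = weight c.L c.X (Y h l) (Y h 0) *
        ∏ h' ∈ Finset.range j, facN c.n c.code (μ 27) (μ₂ 26) h l h') hs.Φ_le
      ⟨(Off.refl _ _).trans hoff₆' (by decide), by simp [h32₆, weight]⟩ ?_ ?_
    · rintro j hj μ' ⟨hoff, h32⟩
      have hoff' : Off [14, 31, 32] μ₄ (μ'.write 31 0 j) := hoff.write (by decide) _ _
      have hc' := hc₄.off hoff (by decide)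
      have hle := hW l hl (j + 1) (by omega)
      have h27 : μ' 27 = μ 27 := by
        rw [hoff 27 (by decide), hoff₄ 27 (by decide), hoff₂ 27 (by decide)]
      have h26' : μ' 26 = μ₂ 26 := by rw [hoff 26 (by decide), hoff₄ 26 (by decide)]
      simp only [wp_ite, wp_set, skip_wp, sub_add_sub_eq_zero, ne_eq, Term.eval, Op.apply,
        Store.write_apply]
      norm_num [-mul_eq_mul_left_iff, hc'.code, hc'.n, hoff 16 (by decide), h16₄,
        hoff 17 (by decide), h17, h32, h27,
        h26']
      rw [Finset.prod_range_succ, ← mul_assoc] at hle ⊢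
      refine ⟨fun h0 => ⟨fun h1 => ⟨fun h2 => ?_, fun h2 => ?_⟩, fun h1 => ?_⟩, fun h0 => ?_⟩
      · rw [facN, if_neg h0, facD, if_neg (by tauto), mul_one]
        exact ⟨hoff', rfl⟩
      · have hfac : facN c.n c.code (μ 27) (μ₂ 26) h l j = μ₂ 26 j := by
          rw [facN, if_neg h0, facD, if_pos ⟨h1, h2⟩]
        rw [hfac] at hle ⊢
        exact ⟨hle, hoff'.write (by decide) _ _, rfl⟩
      · rw [facN, if_neg h0, facD, if_neg (by tauto), mul_one]
        exact ⟨hoff', rfl⟩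
      · have hfac : facN c.n c.code (μ 27) (μ₂ 26) h l j = μ 27 j := by
          rw [facN, if_pos h0]
        rw [hfac] at hle ⊢
        exact ⟨hle, hoff'.write (by decide) _ _, rfl⟩
    rintro μ₇ ⟨hoff₇, h32₇⟩
    have hc₇ := hc₄.off hoff₇ (by decide)
    have hoff₇' : Off [14, 17, 29, 31, 32, 33] μ₂ μ₇ := hoff₄.trans hoff₇ (by decide)
    rw [show weight c.L c.X (Y h l) (Y h 0) *
      ∏ h' ∈ Finset.range c.Φ, facN c.n c.code (μ 27) (μ₂ 26) h l h' = nextW c.n c.Φ c.code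
        (fun h a => weight c.L c.X (Y h a) (Y h 0)) (μ 27) (μ₂ 26) h l from rfl] at h32₇
    simp only [wp_seq, wp_set, Term.eval, Op.apply, Store.write_apply]
    norm_num [hc₇.n, hoff₇ 16 (by decide), h16₄, hoff₇ 17 (by decide), h17, h32₇,
      hoff₇ 33 (by decide), h33₄, h33₃]
    rw [← Finset.sum_range_succ (fun a => nextW c.n c.Φ c.code
        (fun h a => weight c.L c.X (Y h a) (Y h 0)) (μ 27) (μ₂ 26) h a) l]
    refine ⟨hW l hl c.Φ le_rfl, hS (l + 1) (by omega),
      (hoff₇'.write (by decide) _ _).write (by decide) _ _, rfl, ?_⟩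
    intro k hk a ha
    split_ifs with e1 e2 e2
    · rw [(index_inj ha hl e1).2]
    · have := index_inj ha hl e1
      omega
    · have hal : a ≠ l := fun e => e1 (by rw [e2.1, e])
      rw [hoff₇ 29 (by decide), h29₄, h29₃ k hk a ha, if_pos ⟨e2.1, by omega⟩]
    · rw [hoff₇ 29 (by decide), h29₄, h29₃ k hk a ha, if_neg (fun e => e2 ⟨e.1, by omega⟩)]
  · rintro μ₃ ⟨hoff₃, h33₃, h29₃⟩
    have h16₃ : μ₃ 16 0 = h := by rw [hoff₃ 16 (by decide), hoff₂ 16 (by decide), hh]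
    simp only [wp_set, Term.eval, h16₃, h33₃]
    refine ⟨hS c.n le_rfl, hQ _ ?_ ?_ ?_ ?_⟩
    · exact (((Off.refl _ _).trans hoff₂ (by decide)).trans hoff₃ (by decide)).write
        (by decide) _ _
    · intro k
      simp [hoff₃ 26 (by decide), h26]
    · intro k
      have e26 : (μ₃.write 27 h (∑ a ∈ Finset.range c.n, nextW c.n c.Φ c.code
          (fun h a => weight c.L c.X (Y h a) (Y h 0)) (μ 27) (μ₂ 26) h a)) 26 = μ₂ 26 := by
        funext k
        simp [hoff₃ 26 (by decide)]
      rw [e26, Store.write_apply]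
      simp [nextN, hoff₃ 27 (by decide), hoff₂ 27 (by decide)]
    · intro k hk a ha
      have e26 : (μ₃.write 27 h (∑ a ∈ Finset.range c.n, nextW c.n c.Φ c.code
          (fun h a => weight c.L c.X (Y h a) (Y h 0)) (μ 27) (μ₂ 26) h a)) 26 = μ₂ 26 := by
        funext k
        simp [hoff₃ 26 (by decide)]
      rw [e26, Store.write_apply]
      norm_num
      rw [h29₃ k hk a ha]
      simp [ha]

end EFG

end

/-! ### Iterated passes over the forest, sampling, and the program of the players -/

noncomputable section

namespace EFG

variable {c : Data} {O : Oracle} {ν base : ℕ} {Y : ℕ → ℕ → ℕ} {N D : ℕ → ℕ}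

theorem nextD_congr {n Φ h : ℕ} {code D D' : ℕ → ℕ}
    (hD : ∀ h' < Φ, code h' ≠ 0 → (code h' - 1) / n = h → D h' = D' h') :
    nextD n Φ code base D h = nextD n Φ code base D' h := by
  unfold nextD
  congr 1
  refine Finset.prod_congr rfl fun h' hh' => ?_
  unfold facD
  split_ifs with e
  · exact hD h' (Finset.mem_range.1 hh') e.1 e.2
  · rfl

theorem nextW_congr {n Φ h a : ℕ} {code D D' N N' : ℕ → ℕ} {wgt : ℕ → ℕ → ℕ} (ha : a < n)
    (hD : ∀ h' < Φ, code h' ≠ 0 → (code h' - 1) / n = h → D h' = D' h' ∧ N h' = N' h') :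
    nextW n Φ code wgt N D h a = nextW n Φ code wgt N' D' h a := by
  unfold nextW
  congr 1
  refine Finset.prod_congr rfl fun h' hh' => ?_
  unfold facN facD
  split_ifs with e e'
  · refine (hD h' (Finset.mem_range.1 hh') (by omega) ?_).2
    rw [e, Nat.add_sub_cancel, mul_comm, Nat.mul_add_div (by omega), Nat.div_eq_of_lt ha,
      add_zero]
  · exact (hD h' (Finset.mem_range.1 hh') e'.1 e'.2).1
  · rfl

theorem nextN_congr {n Φ h : ℕ} {code D D' N N' : ℕ → ℕ} {wgt : ℕ → ℕ → ℕ}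
    (hD : ∀ h' < Φ, code h' ≠ 0 → (code h' - 1) / n = h → D h' = D' h' ∧ N h' = N' h') :
    nextN n Φ code wgt N D h = nextN n Φ code wgt N' D' h :=
  Finset.sum_congr rfl fun _ ha => nextW_congr (Finset.mem_range.1 ha) hD

theorem nextN_mono {n Φ h : ℕ} {code D D' N N' : ℕ → ℕ} {wgt : ℕ → ℕ → ℕ}
    (hN : ∀ h < Φ, N h ≤ N' h) (hD : ∀ h < Φ, D h ≤ D' h) :
    nextN n Φ code wgt N D h ≤ nextN n Φ code wgt N' D' h :=
  Finset.sum_le_sum fun _ _ => Nat.mul_le_mul_left _ (Finset.prod_le_prod' fun _ hh' =>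
    facN_mono hN hD _ _ (Finset.mem_range.1 hh'))

theorem nextD_mono {n Φ h : ℕ} {code D D' : ℕ → ℕ} (hD : ∀ h < Φ, D h ≤ D' h) :
    nextD n Φ code base D h ≤ nextD n Φ code base D' h :=
  Nat.mul_le_mul_left _ (Finset.prod_le_prod' fun _ hh' =>
    facD_mono hD _ (Finset.mem_range.1 hh'))

def passesCmd : Cmd := .loop 30 (.get 0 (.lit 2)) (.loop 16 (.get 0 (.lit 2)) updateCmd)

/-- The arrays computed by `passesCmd` hold the final values at `h`. -/
def Data.Correct (c : Data) (Y : ℕ → ℕ → ℕ) (N D : ℕ → ℕ) (μ : Store) (h : ℕ) : Prop :=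
  μ 26 h = D h ∧ μ 27 h = N h ∧ ∀ a < c.n, μ 29 (h * c.n + a) =
    nextW c.n c.Φ c.code (fun h a => weight c.L c.X (Y h a) (Y h 0)) N D h a

/-- The values at `h` depend only on those at the children of `h`. Hence after `p` passes, in
whatever order the information sets are numbered, all values at depth at least `Φ - p` are final,
and `Φ` passes settle everything. Entries that are not final yet stay below the solution. -/
theorem passesCmd_wp {dep : ℕ → ℕ} {Q : Store → Prop} {μ : Store} (hs : c.Solves ν base Y N D)
    (hc : c.Holds μ) (hbase : μ 28 0 = base)
    (hY : ∀ h < c.Φ, ∀ a < c.n, μ 25 (h * c.n + a) = Y h a)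
    (hD : ∀ h < c.Φ, μ 26 h ≤ D h) (hN : ∀ h < c.Φ, μ 27 h ≤ N h)
    (hdep : ∀ h' < c.Φ, c.code h' ≠ 0 → dep ((c.code h' - 1) / c.n) < dep h')
    (hdepΦ : ∀ h < c.Φ, dep h < c.Φ)
    (hQ : ∀ μ', Off [14, 16, 17, 26, 27, 29, 30, 31, 32, 33] μ μ' →
      (∀ h < c.Φ, c.Correct Y N D μ' h) → Q μ') :
    passesCmd.wp O ν Q μ := by
  refine Cmd.wp_loop c.Φ (by simp [Term.eval, hc.Φ])
    (fun p μ' => Off [14, 16, 17, 26, 27, 29, 30, 31, 32, 33] μ μ' ∧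
      (∀ h < c.Φ, μ' 26 h ≤ D h ∧ μ' 27 h ≤ N h) ∧
      ∀ h < c.Φ, c.Φ ≤ dep h + p → c.Correct Y N D μ' h) hs.Φ_le
    ⟨Off.refl _ _, fun h hh => ⟨hD h hh, hN h hh⟩, fun h hh hle => ?_⟩ ?_ ?_
  · have := hdepΦ h hh
    omega
  · rintro p hp μ₁ ⟨hoff₁, hle₁, hcor₁⟩
    have hoff₁' : Off [14, 16, 17, 26, 27, 29, 30, 31, 32, 33] μ (μ₁.write 30 0 p) :=
      hoff₁.write (by decide) _ _
    have hc₁ := hc.off hoff₁' (by decide)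
    refine Cmd.wp_loop c.Φ (by simpa [Term.eval] using hc₁.Φ)
      (fun j μ' => Off [14, 16, 17, 26, 27, 29, 30, 31, 32, 33] μ μ' ∧
        (∀ h < c.Φ, μ' 26 h ≤ D h ∧ μ' 27 h ≤ N h) ∧
        ∀ h < c.Φ, c.Φ ≤ dep h + p ∨ (h < j ∧ c.Φ ≤ dep h + (p + 1)) →
          c.Correct Y N D μ' h) hs.Φ_le
      ⟨hoff₁', by simpa using hle₁, ?_⟩ ?_ ?_
    · intro h hh hor
      have := hcor₁ h hh (by omega)
      simpa [Data.Correct] using this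
    · rintro j hj μ₂ ⟨hoff₂, hle₂, hcor₂⟩
      have hoff₂' : Off [14, 16, 17, 26, 27, 29, 30, 31, 32, 33] μ (μ₂.write 16 0 j) :=
        hoff₂.write (by decide) _ _
      set μ₃ := μ₂.write 16 0 j with hμ₃
      have hle₃ : ∀ h < c.Φ, μ₃ 26 h ≤ D h ∧ μ₃ 27 h ≤ N h := by
        simpa [hμ₃] using hle₂
      have hcor₃ : ∀ h < c.Φ, c.Φ ≤ dep h + p ∨ (h < j ∧ c.Φ ≤ dep h + (p + 1)) →
          c.Correct Y N D μ₃ h := by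
        intro h hh hor
        simpa [hμ₃, Data.Correct] using hcor₂ h hh hor
      have h16 : μ₃ 16 0 = j := by simp [hμ₃]
      clear_value μ₃
      refine updateCmd_wp hs (hc.off hoff₂' (by decide)) (h := j) h16 hj
        (by rw [hoff₂' 28 (by decide), hbase])
        (fun h hh a ha => by rw [hoff₂' 25 (by decide), hY h hh a ha])
        (fun h hh => (hle₃ h hh).1) (fun h hh => (hle₃ h hh).2) ?_
      intro μ₄ hoff₄ h26 h27 h29
      have hle26 : ∀ h < c.Φ, μ₄ 26 h ≤ D h := by
        intro h hh
        rw [h26]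
        split_ifs with e
        · subst e
          rw [hs.D_eq h hh]
          exact nextD_mono fun h hh => (hle₃ h hh).1
        · exact (hle₃ h hh).1
      refine ⟨hoff₂'.trans hoff₄ (by decide), fun h hh => ⟨hle26 h hh, ?_⟩, ?_⟩
      · rw [h27]
        split_ifs with e
        · subst e
          rw [hs.N_eq h hh]
          exact nextN_mono (fun h hh => (hle₃ h hh).2) hle26
        · exact (hle₃ h hh).2
      · intro h hh hor
        by_cases e : h = j
        · subst e
          have hchild : ∀ h' < c.Φ, c.code h' ≠ 0 → (c.code h' - 1) / c.n = h →
              μ₃ 26 h' = D h' ∧ μ₃ 27 h' = N h' ∧ h' ≠ h := by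
            intro h' hh' h0 h1
            have hlt := hdep h' hh' h0
            rw [h1] at hlt
            have := hcor₃ h' hh' (by omega)
            exact ⟨this.1, this.2.1, fun e => by rw [e] at hlt; omega⟩
          have hchild' : ∀ h' < c.Φ, c.code h' ≠ 0 → (c.code h' - 1) / c.n = h →
              μ₄ 26 h' = D h' ∧ μ₃ 27 h' = N h' := by
            intro h' hh' h0 h1
            obtain ⟨h2, h3, h4⟩ := hchild h' hh' h0 h1
            rw [h26, if_neg h4]
            exact ⟨h2, h3⟩
          refine ⟨?_, ?_, fun a ha => ?_⟩
          · rw [h26, if_pos rfl, hs.D_eq h hh]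
            exact nextD_congr fun h' hh' h0 h1 => (hchild h' hh' h0 h1).1
          · rw [h27, if_pos rfl, hs.N_eq h hh]
            exact nextN_congr hchild'
          · rw [h29 h hh a ha, if_pos rfl]
            exact nextW_congr ha hchild'
        · obtain ⟨h1, h2, h3⟩ := hcor₃ h hh (by omega)
          refine ⟨by rw [h26, if_neg e, h1], by rw [h27, if_neg e, h2], fun a ha => ?_⟩
          rw [h29 h hh a ha, if_neg e, h3 a ha]
    · rintro μ₂ ⟨hoff₂, hle₂, hcor₂⟩
      exact ⟨hoff₂, hle₂, fun h hh hle => hcor₂ h hh (Or.inr ⟨hh, hle⟩)⟩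
  · rintro μ' ⟨hoff, -, hcor⟩
    exact hQ _ hoff fun h hh => hcor h hh (by omega)

/-! ### Sampling -/

/-- The first action whose cumulative weight exceeds `y`. -/
def pick (n : ℕ) (W : ℕ → ℕ) (y : ℕ) : ℕ :=
  ((Finset.range n).filter fun a => ∑ a' ∈ Finset.range (a + 1), W a' ≤ y).card

/-- Array `10` holds what is left of the random number: its remainder modulo the total at `h` is the
digit used at `h`, its quotient is passed on. The action is found by counting the cumulative weights
that do not exceed the digit. -/
def sampleCmd : Cmd :=
  .loop 16 (.get 0 (.lit 2)) (
    .assign 35 (.var 10 -ₜ .var 10 /ₜ .get 27 (.var 16) *ₜ .get 27 (.var 16)) ;;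
    .assign 10 (.var 10 /ₜ .get 27 (.var 16)) ;;
    .assign 34 (.lit 0) ;;
    .set 3 (.var 16) (.lit 0) ;;
    .loop 17 (.get 0 (.lit 1)) (
      .assign 34 (.var 34 +ₜ .get 29 (.var 16 *ₜ .get 0 (.lit 1) +ₜ .var 17)) ;;
      .ite (.var 34 -ₜ .var 35) .skip (.set 3 (.var 16) (.get 3 (.var 16) +ₜ .lit 1))))

theorem sampleCmd_wp {v : ℕ} {W : ℕ → ℕ → ℕ} {Q : Store → Prop} {μ : Store}
    (hc : c.Holds μ) (hv : μ 10 0 = v) (hN : ∀ h < c.Φ, μ 27 h = N h)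
    (hW : ∀ h < c.Φ, ∀ a < c.n, μ 29 (h * c.n + a) = W h a)
    (hsum : ∀ h < c.Φ, N h = ∑ a ∈ Finset.range c.n, W h a)
    (hNν : ∀ h < c.Φ, (N h).size ≤ ν) (hvν : v.size ≤ ν) (hΦ : c.Φ ≤ ν) (hn : c.n ≤ ν)
    (hQ : ∀ μ', (∀ h < c.Φ,
      μ' 3 h = pick c.n (W h) ((v / ∏ h' ∈ Finset.range h, N h') % N h)) → Q μ') :
    sampleCmd.wp O ν Q μ := by
  refine Cmd.wp_loop c.Φ (by simp [Term.eval, hc.Φ])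
    (fun j μ' => Off [3, 10, 16, 17, 34, 35] μ μ' ∧
      μ' 10 0 = v / ∏ h' ∈ Finset.range j, N h' ∧
      ∀ h < j, μ' 3 h = pick c.n (W h) ((v / ∏ h' ∈ Finset.range h, N h') % N h)) hΦ
    ⟨Off.refl _ _, by simp [hv], by simp⟩ ?_ ?_
  · rintro j hj μ₁ ⟨hoff₁, h10, h3⟩
    have hc₁ := hc.off hoff₁ (by decide)
    set w := v / ∏ h' ∈ Finset.range j, N h' with hw
    have hwν : w.size ≤ ν := size_mono_le (Nat.div_le_self _ _) hvν
    simp only [wp_seq, wp_set, Term.eval, Op.apply, Store.write_apply]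
    norm_num [h10, hoff₁ 27 (by decide), hN j hj, sub_div_mul_self]
    refine ⟨size_mono_le (Nat.mod_le _ _) hwν, size_mono_le (Nat.div_le_self _ _) hwν, ?_⟩
    refine Cmd.wp_loop c.n (by simpa [Term.eval] using hc₁.n)
      (fun l μ' => Off [3, 10, 16, 17, 34, 35] μ μ' ∧ μ' 16 0 = j ∧
        μ' 10 0 = w / N j ∧ μ' 35 0 = w % N j ∧ μ' 34 0 = ∑ a ∈ Finset.range l, W j a ∧
        (∀ h < j, μ' 3 h = pick c.n (W h) ((v / ∏ h' ∈ Finset.range h, N h') % N h)) ∧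
        μ' 3 j = pick l (W j) (w % N j)) hn ⟨?_, ?_⟩ ?_ ?_
    · exact ((((hoff₁.write (by decide) _ _).write (by decide) _ _).write (by decide) _ _).write
        (by decide) _ _).write (by decide) _ _
    · refine ⟨by simp, by simp, by simp, by simp, ?_, by simp [pick]⟩
      intro h hh
      have : h ≠ j := by omega
      simpa [this] using h3 h hh
    · rintro l hl μ₂ ⟨hoff₂, h16, h10', h35, h34, h3', h3j⟩
      have hc₂ := hc.off hoff₂ (by decide)
      have hoff₂' : Off [3, 10, 16, 17, 34, 35] μ (μ₂.write 17 0 l) :=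
        hoff₂.write (by decide) _ _
      have hpl : pick l (W j) (w % N j) ≤ l := by
        unfold pick
        exact (Finset.card_filter_le _ _).trans (by simp)
      have hp1 : pick (l + 1) (W j) (w % N j) = pick l (W j) (w % N j) +
          if ∑ a ∈ Finset.range (l + 1), W j a ≤ w % N j then 1 else 0 := by
        unfold pick
        rw [Finset.range_add_one, Finset.filter_insert, Finset.range_add_one]
        split_ifs with e
        · rw [Finset.card_insert_of_notMem (by simp)]
        · rfl
      simp only [wp_seq, wp_set, wp_ite, skip_wp, Term.eval, Op.apply, Store.write_apply]
      norm_num [h16, hc₂.n, h34, h35, h3j, hoff₂ 29 (by decide), hW j hj l hl]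
      rw [← Finset.sum_range_succ]
      have hoff₃ : Off [3, 10, 16, 17, 34, 35] μ
          ((μ₂.write 17 0 l).write 34 0 (∑ a ∈ Finset.range (l + 1), W j a)) :=
        hoff₂'.write (by decide) _ _
      refine ⟨?_, fun hlt => ?_, fun hge => ?_⟩
      · refine size_mono_le ?_ (hNν j hj)
        rw [hsum j hj]
        exact Finset.sum_le_sum_of_subset (Finset.range_subset_range.2 (by omega))
      · rw [hp1, if_neg (by omega), add_zero]
        exact ⟨hoff₃, h10', rfl, h3', rfl⟩
      · rw [hp1, if_pos (by omega)]
        refine ⟨size_le_of_le (by omega), hoff₃.write (by decide) _ _, h10', rfl, ?_, rfl⟩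
        intro h hh
        rw [if_neg (by omega)]
        exact h3' h hh
    · rintro μ₂ ⟨hoff₂, -, h10', -, -, h3', h3j⟩
      refine ⟨hoff₂, ?_, ?_⟩
      · rw [h10', hw, Nat.div_div_eq_div_mul, Finset.prod_range_succ]
      · intro h hh
        by_cases e : h = j
        · subst e; rw [h3j, hw]
        · exact h3' h (by omega)
  · rintro μ' ⟨-, -, h⟩
    exact hQ _ h

/-! ### The program of the players -/

/-- What a player does after its coins have been tossed. -/
def decideCmd (k : ℕ) : Cmd :=
  .assign 11 (.var 9) ;;
  .loop 15 (.var 10 -ₜ .var 10 /ₜ .lit (2 ^ k) *ₜ .lit (2 ^ k))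
    (.assign 11 (.var 11 *ₜ .var 6)) ;;
  .assign 10 (.var 10 /ₜ .lit (2 ^ k)) ;;
  .assign 12 (.get 0 (.lit 4) /ₜ (.var 11 *ₜ .var 6) *ₜ (.var 11 *ₜ .var 6)) ;;
  .assign 13 (.get 0 (.lit 4) /ₜ .var 11 *ₜ .var 11 -ₜ .var 12) ;;
  scoresCmd ;;
  .assign 28 (.lit 1) ;;
  .loop 14 (.var 8) (.assign 28 (.var 28 *ₜ (.var 7 *ₜ (.var 7 +ₜ .lit 1)))) ;;
  passesCmd ;; sampleCmd

/-- All coins are tossed at once. The lowest `k` bits select the level of the learner, the others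
its pure strategy. -/
def playerCmd (E k : ℕ) : Cmd :=
  (setup E k ;;
    .assign 36 (.lit k +ₜ ((.get 0 (.lit 1) +ₜ .lit 2 *ₜ .var 8 *ₜ .var 7) *ₜ
      (.get 0 (.lit 2) *ₜ .get 0 (.lit 2)) +ₜ .var 7))) ;;
  .toss 10 (.lit 0) (.var 36) ;; decideCmd k

/-- `start` is the day of the last restart of the selected learner and `len` the number of days in
its completed rounds since then. The unfinished round is ignored, which keeps the mixed strategy of
a learner constant during a round. -/
theorem decideCmd_wp {k R M t v : ℕ} {val : ℕ → ℕ → ℕ → ℕ} {dep : ℕ → ℕ} {Q : Store → Prop}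
    {μ : Store} (hm : μ 0 0 = c.m) (hn : μ 0 1 = c.n) (hΦ : μ 0 2 = c.Φ) (hi : μ 0 3 = c.i)
    (ht : μ 0 4 = t) (hcode : μ 1 = c.code) (hhist : μ 2 = c.hist) (hb : μ 5 0 = c.b)
    (hM : μ 6 0 = M) (hL : μ 7 0 = c.L) (hX : μ 8 0 = c.X) (hR : μ 9 0 = R) (hv : μ 10 0 = v)
    (h26 : ∀ h, μ 26 h = 0) (h27 : ∀ h, μ 27 h = 0)
    (hB : c.B = R * M ^ (v % 2 ^ k)) (hstart : c.start = t / (c.B * M) * (c.B * M))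
    (hlen : c.len = t / c.B * c.B - c.start)
    (hf : c.Fits O ν val) (hs : c.Solves ν ((c.L * (c.L + 1)) ^ c.X) (c.score val) N D)
    (hdep : ∀ h' < c.Φ, c.code h' ≠ 0 → dep ((c.code h' - 1) / c.n) < dep h')
    (hdepΦ : ∀ h < c.Φ, dep h < c.Φ)
    (htν : t ≤ ν) (hvν : v.size ≤ ν) (hk : 2 ^ k ≤ ν) (hM1 : 1 ≤ M) (hRM : R * M ^ 2 ^ k ≤ ν)
    (hQ : ∀ μ', (∀ h < c.Φ, μ' 3 h = pick c.n
      (nextW c.n c.Φ c.code (fun h a => weight c.L c.X (c.score val h a) (c.score val h 0)) N D h)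
      ((v / 2 ^ k / ∏ h' ∈ Finset.range h, N h') % N h)) → Q μ') :
    (decideCmd k).wp O ν Q μ := by
  have hk0 : 0 < 2 ^ k := by positivity
  have hRj : ∀ j ≤ 2 ^ k, R * M ^ j ≤ ν := fun j hj =>
    (Nat.mul_le_mul_left _ (Nat.pow_le_pow_right hM1 hj)).trans hRM
  have hmod : v % 2 ^ k < 2 ^ k := Nat.mod_lt _ hk0
  simp only [decideCmd, wp_seq, wp_set, Term.eval]
  refine ⟨size_le_of_le (by rw [hR]; simpa using hRj 0 (by omega)), ?_⟩
  refine Cmd.wp_loop (v % 2 ^ k) (by simp [Term.eval, Op.apply, hv, sub_div_mul_self])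
    (fun j μ' => Off [11, 15] μ μ' ∧ μ' 11 0 = R * M ^ j) (by omega)
    ⟨(Off.refl _ _).write (by decide) _ _, by simp [hR]⟩ ?_ ?_
  · rintro j hj μ' ⟨hoff, h⟩
    simp only [wp_set, Term.eval, Op.apply, Store.write_apply]
    norm_num [h, hoff 6 (by decide), hM]
    rw [mul_assoc, ← pow_succ]
    exact ⟨size_le_of_le (hRj _ (by omega)), (hoff.write (by decide) _ _).write (by decide) _ _,
      rfl⟩
  rintro μ₁ ⟨hoff₁, h11⟩
  rw [← hB] at h11
  simp only [wp_seq, wp_set, Term.eval, Op.apply, Store.write_apply]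
  norm_num [hoff₁ 10 (by decide), hoff₁ 0 (by decide), hoff₁ 6 (by decide), hv, ht, hM, h11]
  rw [← hstart, ← hlen]
  have hst : c.start ≤ t := by rw [hstart]; exact Nat.div_mul_le_self _ _
  have hln : c.len ≤ t := by
    rw [hlen]; exact (Nat.sub_le _ _).trans (Nat.div_mul_le_self _ _)
  refine ⟨size_mono_le (Nat.div_le_self _ _) hvν, size_le_of_le (hst.trans htν),
    size_le_of_le (hln.trans htν), ?_⟩
  set μ₂ := ((μ₁.write 10 0 (v / 2 ^ k)).write 12 0 c.start).write 13 0 c.len with hμ₂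
  have hoff₂ : Off [10, 11, 12, 13, 15] μ μ₂ :=
    ((((Off.refl _ _).trans hoff₁ (by decide)).write (by decide) _ _).write (by decide) _ _).write
      (by decide) _ _
  have h10 : μ₂ 10 0 = v / 2 ^ k := by simp [hμ₂]
  have hc₂ : c.Holds μ₂ := by
    constructor
    · rw [hoff₂ 0 (by decide), hm]
    · rw [hoff₂ 0 (by decide), hn]
    · rw [hoff₂ 0 (by decide), hΦ]
    · rw [hoff₂ 0 (by decide), hi]
    · rw [hoff₂ 1 (by decide), hcode]
    · rw [hoff₂ 2 (by decide), hhist]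
    · rw [hoff₂ 5 (by decide), hb]
    · rw [hoff₂ 7 (by decide), hL]
    · rw [hoff₂ 8 (by decide), hX]
    · simp [hμ₂, h11]
    · simp [hμ₂]
    · simp [hμ₂]
  clear_value μ₂
  refine scoresCmd_wp hf hc₂ ?_
  intro μ₃ hoff₃ h25
  have hc₃ := hc₂.off hoff₃ (by decide)
  have hXν := hs.X_le
  have hLpos := hs.L
  simp only [wp_seq, wp_set, Term.eval]
  refine ⟨size_le_of_le (by omega), ?_⟩
  have hdecide : ∀ μ₄, Off [14, 28] μ₃ μ₄ → μ₄ 28 0 = (c.L * (c.L + 1)) ^ c.X →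
      passesCmd.wp O ν (sampleCmd.wp O ν Q) μ₄ := by
    intro μ₄ hoff₄ h28
    have hc₄ := hc₃.off hoff₄ (by decide)
    refine passesCmd_wp (dep := dep) hs hc₄ h28 ?_ ?_ ?_ hdep hdepΦ ?_
    · intro h hh a ha
      rw [hoff₄ 25 (by decide), h25 h hh a ha]
    · intro h hh
      rw [hoff₄ 26 (by decide), hoff₃ 26 (by decide), hoff₂ 26 (by decide), h26]
      omega
    · intro h hh
      rw [hoff₄ 27 (by decide), hoff₃ 27 (by decide), hoff₂ 27 (by decide), h27]
      omega
    intro μ₅ hoff₅ hcor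
    exact sampleCmd_wp (hc₄.off hoff₅ (by decide))
      (by rw [hoff₅ 10 (by decide), hoff₄ 10 (by decide), hoff₃ 10 (by decide), h10])
      (fun h hh => (hcor h hh).2.1) (fun h hh => (hcor h hh).2.2) (fun h hh => hs.N_eq h hh)
      hs.N_le (size_mono_le (Nat.div_le_self _ _) hvν) hs.Φ_le hs.n_le hQ
  have hpos := hs.Φ_pos
  have hbase : ((c.L * (c.L + 1)) ^ c.X).size ≤ ν := by
    refine size_mono_le ?_ (hs.D_le 0 hpos)
    rw [hs.D_eq 0 hpos]
    exact Nat.le_mul_of_pos_right _ (Finset.prod_pos fun h hh =>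
      one_le_facD hs.D_pos 0 (Finset.mem_range.1 hh))
  refine Cmd.wp_loop c.X (by simp [Term.eval, hc₃.X])
    (fun j μ' => Off [14, 28] μ₃ μ' ∧ μ' 28 0 = (c.L * (c.L + 1)) ^ j) (by omega)
    ⟨(Off.refl _ _).write (by decide) _ _, by simp⟩ ?_ ?_
  · rintro j hj μ' ⟨hoff, h⟩
    simp only [wp_set, Term.eval, Op.apply, Store.write_apply]
    norm_num [h, hoff 7 (by decide), hc₃.L]
    rw [← pow_succ]
    refine ⟨size_mono_le ?_ hbase, (hoff.write (by decide) _ _).write (by decide) _ _, rfl⟩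
    exact Nat.pow_le_pow_right (by positivity) (by omega)
  · rintro μ' ⟨hoff, h⟩
    exact hdecide _ hoff h

end EFG

end

noncomputable section

namespace EFG

/-! ### Sums over product spaces -/

section Product

variable {ι β : Type*} [Fintype ι] [DecidableEq ι] [Fintype β]

/-- Exchanging the `i`-th coordinate of `s` with `a` is an involution on the pairs `(s, a)`. -/
theorem sum_sum_update (i : ι) (F : (ι → β) → ℝ) :
    ∑ s, ∑ a, F (Function.update s i a) = Fintype.card β * ∑ s, F s := by
  have h1 : ∑ s : ι → β, ∑ a : β, F (Function.update s i a) =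
      ∑ p : (ι → β) × β, F (Function.update p.1 i p.2) := by
    rw [Fintype.sum_prod_type]
  have h2 : ∑ p : (ι → β) × β, F (Function.update p.1 i p.2) = ∑ p : (ι → β) × β, F p.1 := by
    refine Finset.sum_bij' (fun p _ => (Function.update p.1 i p.2, p.1 i))
      (fun p _ => (Function.update p.1 i p.2, p.1 i)) ?_ ?_ ?_ ?_ ?_ <;> simp
  rw [h1, h2, Fintype.sum_prod_type]
  simp [Finset.mul_sum]

/-- `G` does not depend on the coordinate `i`, so this coordinate can be summed out first. -/
theorem sum_mul_eq_of_sum_update_eq [Nonempty β] (i : ι) {G K K' : (ι → β) → ℝ}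
    (hG : ∀ s a, G (Function.update s i a) = G s)
    (hK : ∀ s, ∑ a, K (Function.update s i a) = ∑ a, K' (Function.update s i a)) :
    ∑ s, G s * K s = ∑ s, G s * K' s := by
  have hc : (Fintype.card β : ℝ) ≠ 0 := by
    exact_mod_cast Fintype.card_ne_zero
  refine mul_left_cancel₀ hc ?_
  rw [← sum_sum_update i (fun s => G s * K s), ← sum_sum_update i (fun s => G s * K' s)]
  refine Finset.sum_congr rfl fun s _ => ?_
  simp only [hG, ← Finset.mul_sum, hK]

theorem sum_prod_eq_one (p : ι → β → ℝ) (hp : ∀ i, ∑ a, p i a = 1) :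
    ∑ s : ι → β, ∏ i, p i (s i) = 1 := by
  have := Finset.prod_univ_sum (fun _ : ι => (Finset.univ : Finset β)) p
  rw [Fintype.piFinset_univ] at this
  rw [← this]
  simp [hp]

/-- Resampling one coordinate of a product distribution. -/
theorem sum_prod_resample [Nonempty β] (p : ι → β → ℝ) (hp : ∀ i, ∑ a, p i a = 1) (i : ι)
    (F : β → (ι → β) → ℝ) (hF : ∀ a s b, F a (Function.update s i b) = F a s) :
    ∑ s, (∏ j, p j (s j)) * F (s i) s = ∑ a, p i a * ∑ s, (∏ j, p j (s j)) * F a s := by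
  have hsplit : ∀ s : ι → β, ∏ j, p j (s j) =
      (∏ j ∈ Finset.univ.erase i, p j (s j)) * p i (s i) := fun s =>
    (Finset.prod_erase_mul _ _ (Finset.mem_univ i)).symm
  have h1 : ∑ s, (∏ j, p j (s j)) * F (s i) s =
      ∑ s, (∏ j ∈ Finset.univ.erase i, p j (s j)) *
        (p i (s i) * ∑ a, p i a * F a s) := by
    simp only [hsplit, mul_assoc]
    refine sum_mul_eq_of_sum_update_eq i ?_ ?_
    · intro s a
      refine Finset.prod_congr rfl fun j hj => ?_
      rw [Function.update_of_ne (Finset.ne_of_mem_erase hj)]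
    · intro s
      simp only [Function.update_self, hF]
      rw [← Finset.sum_mul, hp, one_mul]
  rw [h1]
  simp only [Finset.mul_sum]
  rw [Finset.sum_comm]
  refine Finset.sum_congr rfl fun a _ => Finset.sum_congr rfl fun s _ => ?_
  rw [hsplit]
  ring

end Product

/-! ### The tree of the information sets of one player -/

/-- The sequences of own moves that lead to the information sets of a player. -/
structure Forest (n Φ : ℕ) where
  seq : Fin Φ → List (Fin Φ × Fin n)
  closed : ∀ h l g a, seq h = l ++ [(g, a)] → seq g = l

namespace Forest

variable {n Φ : ℕ} (F : Forest n Φ)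

/-- The last own move before an information set. -/
def par (h : Fin Φ) : Option (Fin Φ × Fin n) := (F.seq h).getLast?

def dep (h : Fin Φ) : ℕ := (F.seq h).length

/-- The strategy `s` does not exclude that `h` is reached. -/
def Reach (s : Strategy n Φ) (h : Fin Φ) : Prop := ∀ p ∈ F.seq h, s p.1 = p.2

instance (s : Strategy n Φ) (h : Fin Φ) : Decidable (F.Reach s h) :=
  inferInstanceAs (Decidable (∀ p ∈ F.seq h, s p.1 = p.2))

variable {F}

theorem par_eq_some {h g : Fin Φ} {a : Fin n} :
    F.par h = some (g, a) ↔ F.seq h = F.seq g ++ [(g, a)] := by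
  constructor
  · intro e
    obtain ⟨l, hl⟩ := List.getLast?_eq_some_iff.1 e
    rw [hl, F.closed h l g a hl]
  · intro e
    rw [par, e, List.getLast?_append]
    rfl

theorem par_eq_none {h : Fin Φ} : F.par h = none ↔ F.seq h = [] := by
  simp [par]

theorem dep_of_par {h g : Fin Φ} {a : Fin n} (e : F.par h = some (g, a)) :
    F.dep h = F.dep g + 1 := by
  rw [dep, par_eq_some.1 e, List.length_append]
  rfl

theorem induction_on {P : Fin Φ → Prop} (h0 : ∀ h, F.par h = none → P h)
    (h1 : ∀ h g a, F.par h = some (g, a) → P g → P h) (h : Fin Φ) : P h := by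
  induction hd : F.dep h generalizing h with
  | zero => exact h0 h (par_eq_none.2 (List.length_eq_zero_iff.1 hd))
  | succ d ih =>
    cases hp : F.par h with
    | none => exact h0 h hp
    | some p => exact h1 h p.1 p.2 hp (ih p.1 (by have := dep_of_par hp; omega))

theorem dep_lt_of_mem {h : Fin Φ} {p : Fin Φ × Fin n} (hp : p ∈ F.seq h) :
    F.dep p.1 < F.dep h := by
  revert p
  refine F.induction_on (P := fun h => ∀ {p}, p ∈ F.seq h → F.dep p.1 < F.dep h) ?_ ?_ h
  · intro h e p hp
    rw [par_eq_none.1 e] at hp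
    simp at hp
  · intro h g a e ih p hp
    rw [par_eq_some.1 e, List.mem_append, List.mem_singleton] at hp
    have := dep_of_par e
    rcases hp with hp | rfl
    · have := ih hp
      omega
    · simp only
      omega

/-- The depth increases strictly along a sequence of own moves, so no information set is met twice.
In particular every depth is less than `Φ`. -/
theorem nodup_seq (h : Fin Φ) : (h :: (F.seq h).map Prod.fst).Nodup := by
  refine F.induction_on (P := fun h => (h :: (F.seq h).map Prod.fst).Nodup) ?_ ?_ h
  · intro h e
    simp [par_eq_none.1 e]
  · intro h g a e ih
    rw [List.nodup_cons]
    constructor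
    · intro hm
      obtain ⟨p, hp, hph⟩ := List.mem_map.1 hm
      have := dep_lt_of_mem hp
      rw [hph] at this
      omega
    · rw [par_eq_some.1 e, List.map_append, List.nodup_append]
      rw [List.nodup_cons] at ih
      refine ⟨ih.2, by simp, ?_⟩
      intro x hx y hy
      simp only [List.map_cons, List.map_nil, List.mem_singleton] at hy
      subst hy
      exact fun e => ih.1 (e ▸ hx)

theorem dep_lt (h : Fin Φ) : F.dep h < Φ := by
  have := (F.nodup_seq h).length_le_card
  simpa [dep] using this

theorem reach_of_par {s : Strategy n Φ} {h g : Fin Φ} {a : Fin n} (e : F.par h = some (g, a)) :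
    F.Reach s h ↔ F.Reach s g ∧ s g = a := by
  simp only [Reach, par_eq_some.1 e, List.mem_append, List.mem_singleton, or_imp, forall_and,
    forall_eq]

theorem reach_of_par_eq_none {s : Strategy n Φ} {h : Fin Φ} (e : F.par h = none) :
    F.Reach s h := by
  simp [Reach, par_eq_none.1 e]

/-- Only actions at information sets of strictly smaller depth matter for reaching `h`. -/
theorem reach_update {s : Strategy n Φ} {h g : Fin Φ} (a : Fin n) (hg : F.dep h ≤ F.dep g) :
    F.Reach (Function.update s g a) h ↔ F.Reach s h := by
  refine forall₂_congr fun p hp => ?_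
  have := dep_lt_of_mem hp
  rw [Function.update_of_ne (fun e => by rw [e] at this; omega)]

variable (F)

/-- Playing `y` where the own moves lead, and `c` elsewhere, is a probability distribution. -/
theorem sum_prod_reach [NeZero n] {y c : Fin Φ → Fin n → ℝ} (hy : ∀ h, ∑ a, y h a = 1)
    (hc : ∀ h, ∑ a, c h a = 1) :
    ∑ s : Strategy n Φ, ∏ h, (if F.Reach s h then y h (s h) else c h (s h)) = 1 := by
  -- Generalized to a set `A` on which `y` may be used, `A` can lose its deepest element `g`. No
  -- reach condition in `A` involves the action at `g`, so this action can be summed out, and its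
  -- total probability is 1 under `y` as well as under `c`.
  suffices H : ∀ (N : ℕ) (A : Finset (Fin Φ)), A.card = N → ∑ s : Strategy n Φ,
      ∏ h, (if h ∈ A ∧ F.Reach s h then y h (s h) else c h (s h)) = 1 by
    simpa using H _ Finset.univ rfl
  intro N
  induction N with
  | zero =>
    intro A hA
    rw [Finset.card_eq_zero] at hA
    subst hA
    simpa using sum_prod_eq_one c hc
  | succ N ih =>
    intro A hA
    obtain ⟨g, hg, hmax⟩ := A.exists_max_image F.dep (Finset.card_pos.1 (by omega))
    rw [← ih (A.erase g) (by rw [Finset.card_erase_of_mem hg, hA]; rfl)]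
    have hsplit : ∀ f : Fin Φ → ℝ, ∏ h, f h =
        (∏ h ∈ Finset.univ.erase g, f h) * f g := fun f =>
      (Finset.prod_erase_mul _ _ (Finset.mem_univ g)).symm
    have hrest : ∀ s : Strategy n Φ, ∏ h ∈ Finset.univ.erase g,
        (if h ∈ A.erase g ∧ F.Reach s h then y h (s h) else c h (s h)) =
        ∏ h ∈ Finset.univ.erase g,
          (if h ∈ A ∧ F.Reach s h then y h (s h) else c h (s h)) := by
      intro s
      refine Finset.prod_congr rfl fun h hh => ?_
      simp [Finset.ne_of_mem_erase hh]
    simp only [hsplit, hrest]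
    refine sum_mul_eq_of_sum_update_eq g ?_ ?_
    · intro s a
      refine Finset.prod_congr rfl fun h hh => ?_
      rw [Function.update_of_ne (Finset.ne_of_mem_erase hh)]
      by_cases hA : h ∈ A
      · simp only [hA, true_and, reach_update a (hmax h hA)]
      · simp [hA]
    · intro s
      simp only [Function.update_self, reach_update _ le_rfl]
      by_cases hr : F.Reach s g <;> simp [hg, hr, hy, hc]

/-- A product over the reached information sets telescopes. -/
theorem prod_reach_telescope {Z : Fin Φ → ℝ} (hZ : ∀ h, Z h ≠ 0) (w : Fin Φ → ℝ)
    (s : Strategy n Φ) :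
    ∏ h, (if F.Reach s h then
      w h * (∏ h', if F.par h' = some (h, s h) then Z h' else 1) / Z h else 1) =
    (∏ h, if F.Reach s h then w h else 1) / ∏ h, if F.par h = none then Z h else 1 := by
  have h1 : ∏ h, (if F.Reach s h then
      w h * (∏ h', if F.par h' = some (h, s h) then Z h' else 1) / Z h else 1) =
      (∏ h, if F.Reach s h then w h else 1) *
      (∏ h, if F.Reach s h then (∏ h', if F.par h' = some (h, s h) then Z h' else 1) else 1) /
      ∏ h, (if F.Reach s h then Z h else 1) := by
    rw [← Finset.prod_mul_distrib, ← Finset.prod_div_distrib]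
    refine Finset.prod_congr rfl fun h _ => ?_
    split_ifs <;> simp
  -- A reached information set that is not a root is the child of exactly one information set, which
  -- is reached as well and at which `s` takes the right action. Regrouping by children therefore
  -- counts it once.
  have h2 : (∏ h, if F.Reach s h then (∏ h', if F.par h' = some (h, s h) then Z h' else 1)
      else 1) = ∏ h', if F.par h' ≠ none ∧ F.Reach s h' then Z h' else 1 := by
    have : ∀ h, (if F.Reach s h then (∏ h', if F.par h' = some (h, s h) then Z h' else 1)
      else 1) = ∏ h', if F.Reach s h ∧ F.par h' = some (h, s h) then Z h' else 1 := by
      intro h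
      split_ifs with e <;> simp [e]
    simp only [this]
    rw [Finset.prod_comm]
    refine Finset.prod_congr rfl fun h' _ => ?_
    cases hp : F.par h' with
    | none => simp
    | some p =>
      obtain ⟨g, a⟩ := p
      rw [Finset.prod_eq_single g]
      · simp [reach_of_par hp, eq_comm]
      · intro b _ hb
        rw [if_neg]
        rintro ⟨-, e⟩
        simp only [Option.some.injEq, Prod.mk.injEq] at e
        exact hb e.1.symm
      · simp
  have h3 : (∏ h, if F.Reach s h then Z h else 1) =
      (∏ h', if F.par h' ≠ none ∧ F.Reach s h' then Z h' else 1) *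
        ∏ h, if F.par h = none then Z h else 1 := by
    rw [← Finset.prod_mul_distrib]
    refine Finset.prod_congr rfl fun h _ => ?_
    by_cases e : F.par h = none
    · simp [e, reach_of_par_eq_none e]
    · simp [e]
  have h4 : (∏ h', if F.par h' ≠ none ∧ F.Reach s h' then Z h' else 1) ≠ 0 :=
    Finset.prod_ne_zero_iff.2 fun h _ => by split_ifs <;> simp [hZ]
  have h5 : (∏ h, if F.par h = none then Z h else 1) ≠ 0 :=
    Finset.prod_ne_zero_iff.2 fun h _ => by split_ifs <;> simp [hZ]
  rw [h1, h2, h3]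
  field_simp

/-! ### Exponential weights -/

/-- The product of the values of the children of the action `a` at `h`. -/
def below (Z : Fin Φ → ℝ) (h : Fin Φ) (a : Fin n) : ℝ :=
  ∏ h', if F.par h' = some (h, a) then Z h' else 1

/-- The product of the values of the roots. -/
def root (Z : Fin Φ → ℝ) : ℝ := ∏ h, if F.par h = none then Z h else 1

/-- `Z` holds the total weights of the subtrees, for the weights `y` of the actions. -/
structure Partition (y : Fin Φ → Fin n → ℝ) (Z : Fin Φ → ℝ) : Prop where
  weight_pos : ∀ h a, 0 < y h a
  pos : ∀ h, 0 < Z h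
  eq : ∀ h, Z h = ∑ a, y h a * F.below Z h a

variable {F} {y y' : Fin Φ → Fin n → ℝ} {Z Z' : Fin Φ → ℝ}

theorem below_pos (hZ : ∀ h, 0 < Z h) (h : Fin Φ) (a : Fin n) : 0 < F.below Z h a :=
  Finset.prod_pos fun h' _ => by split_ifs <;> simp [hZ]

theorem root_pos (hZ : ∀ h, 0 < Z h) : 0 < F.root Z :=
  Finset.prod_pos fun h' _ => by split_ifs <;> simp [hZ]

theorem Partition.sum_eq_one (hy : F.Partition y Z) (h : Fin Φ) :
    ∑ a, y h a * F.below Z h a / Z h = 1 := by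
  rw [← Finset.sum_div, ← hy.eq, div_self (hy.pos h).ne']

theorem Partition.prod_reach (hy : F.Partition y Z) (s : Strategy n Φ) :
    ∏ h, (if F.Reach s h then y h (s h) * F.below Z h (s h) / Z h else 1) =
      (∏ h, if F.Reach s h then y h (s h) else 1) / F.root Z :=
  F.prod_reach_telescope (fun h => (hy.pos h).ne') (fun h => y h (s h)) s

/-- The likelihood ratio on the reached information sets turns the behaviour given by `y` into the
one given by `y'` there and leaves it alone elsewhere, up to the factor `root Z' / root Z`. The
modified density has total mass 1 by `sum_prod_reach`. This is what makes a product of independent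
choices as good as exponential weights on pure strategies. -/
theorem Partition.expectation [NeZero n] (hy : F.Partition y Z) (hy' : F.Partition y' Z') :
    ∑ s : Strategy n Φ, (∏ h, y h (s h) * F.below Z h (s h) / Z h) *
      (∏ h, if F.Reach s h then y' h (s h) / y h (s h) else 1) = F.root Z' / F.root Z := by
  have hZZ : ∀ h, 0 < Z' h / Z h := fun h => div_pos (hy'.pos h) (hy.pos h)
  have key : ∀ s : Strategy n Φ, ∏ h, (if F.Reach s h then
      y' h (s h) * F.below Z' h (s h) / Z' h else y h (s h) * F.below Z h (s h) / Z h) =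
      (∏ h, y h (s h) * F.below Z h (s h) / Z h) *
      (∏ h, if F.Reach s h then y' h (s h) / y h (s h) else 1) / (F.root Z' / F.root Z) := by
    intro s
    have h1 := F.prod_reach_telescope (Z := fun h => Z' h / Z h) (fun h => (hZZ h).ne')
      (fun h => y' h (s h) / y h (s h)) s
    have h2 : (∏ h, if F.par h = none then Z' h / Z h else 1) = F.root Z' / F.root Z := by
      rw [root, root, ← Finset.prod_div_distrib]
      refine Finset.prod_congr rfl fun h _ => ?_
      split_ifs <;> simp
    rw [h2] at h1
    rw [mul_div_assoc, ← h1, ← Finset.prod_mul_distrib]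
    refine Finset.prod_congr rfl fun h _ => ?_
    split_ifs with hr
    · have h3 : (∏ h', if F.par h' = some (h, s h) then Z' h' / Z h' else 1) =
          F.below Z' h (s h) / F.below Z h (s h) := by
        rw [below, below, ← Finset.prod_div_distrib]
        refine Finset.prod_congr rfl fun h _ => ?_
        split_ifs <;> simp
      rw [h3]
      have := (hy.pos h).ne'
      have := (hy'.pos h).ne'
      have := (hy.weight_pos h (s h)).ne'
      have := (below_pos (F := F) hy.pos h (s h)).ne'
      field_simp
    · simp
  have hsum := F.sum_prod_reach hy'.sum_eq_one hy.sum_eq_one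
  simp only [key] at hsum
  rw [← Finset.sum_div, div_eq_one_iff_eq] at hsum
  · exact hsum
  · exact (div_pos (root_pos hy'.pos) (root_pos hy.pos)).ne'

/-- The quotient of the two sides is a product of probabilities. -/
theorem Partition.le_root (hy : F.Partition y Z) (s : Strategy n Φ) :
    (∏ h, if F.Reach s h then y h (s h) else 1) ≤ F.root Z := by
  have h1 := hy.prod_reach s
  have h2 : ∏ h, (if F.Reach s h then y h (s h) * F.below Z h (s h) / Z h else 1) ≤ 1 := by
    refine Finset.prod_le_one (fun h _ => ?_) fun h _ => ?_
    · split_ifs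
      · exact div_nonneg (mul_nonneg (hy.weight_pos _ _).le (below_pos hy.pos _ _).le)
          (hy.pos h).le
      · exact zero_le_one
    · split_ifs
      · rw [← hy.sum_eq_one h]
        refine Finset.single_le_sum (f := fun a => y h a * F.below Z h a / Z h)
          (fun a _ => ?_) (Finset.mem_univ (s h))
        exact div_nonneg (mul_nonneg (hy.weight_pos _ _).le (below_pos hy.pos _ _).le)
          (hy.pos h).le
      · exact le_rfl
  rw [h1, div_le_one (root_pos hy.pos)] at h2
  exact h2

/-- Instead of counting strategies: choose at every information set an action of probability at
least `1 / n`. For unit weights, the probabilities at the reached information sets multiply to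
exactly `1 / root Z`. -/
theorem Partition.root_le [NeZero n] (hy : F.Partition y Z) (h1 : ∀ h a, y h a = 1) :
    F.root Z ≤ (n : ℝ) ^ Φ := by
  have hn : (0 : ℝ) < n := by exact_mod_cast Nat.pos_of_ne_zero (NeZero.ne n)
  have hex : ∀ h, ∃ a, 1 / (n : ℝ) ≤ y h a * F.below Z h a / Z h := by
    intro h
    by_contra! hlt
    have := Finset.sum_lt_sum_of_nonempty (Finset.univ_nonempty (α := Fin n))
      (fun a _ => hlt a)
    rw [hy.sum_eq_one h] at this
    simp [hn.ne'] at this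
  choose s hs using hex
  have h2 := hy.prod_reach s
  have h3 : (∏ h, if F.Reach s h then y h (s h) else 1) = 1 := by simp [h1]
  have h4 : (1 / (n : ℝ)) ^ Φ ≤
      ∏ h, (if F.Reach s h then y h (s h) * F.below Z h (s h) / Z h else 1) := by
    calc (1 / (n : ℝ)) ^ Φ = ∏ _h : Fin Φ, 1 / (n : ℝ) := by simp
      _ ≤ _ := by
        refine Finset.prod_le_prod (fun _ _ => by positivity) fun h _ => ?_
        split_ifs
        · exact hs h
        · rw [div_le_one hn]
          exact_mod_cast Nat.one_le_iff_ne_zero.2 (NeZero.ne n)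
  rw [h2, h3, one_div_pow] at h4
  exact (one_div_le_one_div (by positivity) (root_pos hy.pos)).1 h4

end Forest

end EFG

end

/-! ### The regret bound for exponential weights on the forest -/

noncomputable section

namespace EFG

namespace Forest

variable {n Φ : ℕ} (F : Forest n Φ)

/-- The gain of a strategy when the scores change from `x` to `x'`. -/
def gain (x x' : Fin Φ → Fin n → ℤ) (s : Strategy n Φ) : ℝ :=
  ∑ h, if F.Reach s h then (x' h (s h) : ℝ) - x h (s h) else 0

variable {F}

theorem prod_zpow_eq {β : ℝ} (hβ : 0 < β) (x x' : Fin Φ → Fin n → ℤ) (s : Strategy n Φ) :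
    (∏ h, if F.Reach s h then β ^ (x' h (s h)) / β ^ (x h (s h)) else 1) =
      Real.exp (Real.log β * F.gain x x' s) := by
  rw [gain, Finset.mul_sum, Real.exp_sum]
  refine Finset.prod_congr rfl fun h _ => ?_
  split_ifs
  · rw [← zpow_sub₀ hβ.ne', ← Real.rpow_intCast, Real.rpow_def_of_pos hβ]
    push_cast
    rfl
  · simp

theorem log_one_add_inv_bounds {L : ℝ} (hL : 2 ≤ L) :
    1 / (2 * L) ≤ Real.log (1 + 1 / L) ∧ Real.log (1 + 1 / L) ≤ 1 / L := by
  have h0 : 0 < 1 + 1 / L := by positivity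
  constructor
  · have h1 := Real.one_sub_inv_le_log_of_pos h0
    refine le_trans ?_ h1
    have : 1 - (1 + 1 / L)⁻¹ = 1 / (L + 1) := by field_simp; ring
    rw [this]
    exact one_div_le_one_div_of_le (by linarith) (by linarith)
  · have := Real.log_le_sub_one_of_pos h0
    linarith

theorem neg_two_mul_le_log_one_sub {θ : ℝ} (h0 : 0 ≤ θ) (h : θ ≤ 1 / 2) :
    -2 * θ ≤ Real.log (1 - θ) := by
  have h1 : 0 < 1 - θ := by linarith
  have h2 := Real.one_sub_inv_le_log_of_pos h1
  refine le_trans ?_ h2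
  rw [← sub_nonneg]
  have : 1 - (1 - θ)⁻¹ - -2 * θ = θ * (1 - 2 * θ) / (1 - θ) := by field_simp; ring
  rw [this]
  exact div_nonneg (mul_nonneg h0 (by linarith)) h1.le

/-- The regret of exponential weights on the pure strategies, where the distribution that is
played has to dominate the exponential weights up to the factor `1 - 1 / L` only. -/
theorem hedge [NeZero n] {L q : ℝ} (hL : 2 ≤ L) (hqL : 2 * q ≤ L) {M : ℕ}
    (x : ℕ → Fin Φ → Fin n → ℤ) (hx0 : ∀ h a, x 0 h a = 0) (Z : ℕ → Fin Φ → ℝ)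
    (hZ : ∀ r ≤ M, F.Partition (fun h a => (1 + 1 / L) ^ (x r h a)) (Z r))
    (P : ℕ → Strategy n Φ → ℝ) (hP0 : ∀ r < M, ∀ s, 0 ≤ P r s) (hP1 : ∀ r < M, ∑ s, P r s = 1)
    (hlow : ∀ r < M, ∀ s, (1 - 1 / L) *
      ∏ h, (1 + 1 / L) ^ (x r h (s h)) * F.below (Z r) h (s h) / Z r h ≤ P r s)
    (hgain : ∀ r < M, ∀ s, |F.gain (x r) (x (r + 1)) s| ≤ 2 * q) (s' : Strategy n Φ) :
    ∑ r ∈ Finset.range M, (F.gain (x r) (x (r + 1)) s' -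
      ∑ s, P r s * F.gain (x r) (x (r + 1)) s) ≤
      2 * L * (Φ * Real.log n) + M * (4 * q ^ 2 / L + 4) := by
  set β : ℝ := 1 + 1 / L with hβ
  set ρ : ℝ := Real.log β with hρ
  have hβ0 : 0 < β := by positivity
  obtain ⟨hρ1, hρ2⟩ := log_one_add_inv_bounds hL
  rw [← hβ, ← hρ] at hρ1 hρ2
  have hρ0 : 0 < ρ := lt_of_lt_of_le (by positivity) hρ1
  have hLi : 1 / L ≤ 1 / 2 := one_div_le_one_div_of_le (by norm_num) hL
  have hLi0 : 0 < 1 / L := by positivity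
  -- one round
  have hround : ∀ r < M, -2 * (1 / L) + (Real.log (F.root (Z (r + 1))) -
      Real.log (F.root (Z r))) ≤
      ρ * ∑ s, P r s * F.gain (x r) (x (r + 1)) s + 4 * ρ ^ 2 * q ^ 2 := by
    intro r hr
    set δ := F.gain (x r) (x (r + 1)) with hδ
    have hZ0 := hZ r hr.le
    have hZ1 := hZ (r + 1) hr
    have hexp := hZ0.expectation hZ1
    have hr0 := root_pos (F := F) hZ0.pos
    have hr1 := root_pos (F := F) hZ1.pos
    -- The ratio of the potentials is the mean of `exp (ρ * δ)` under the exact exponential weights.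
    -- As this function is positive, the lower bound on `P` is enough.
    have h1 : (1 - 1 / L) * (F.root (Z (r + 1)) / F.root (Z r)) ≤
        ∑ s, P r s * Real.exp (ρ * δ s) := by
      rw [← hexp, Finset.mul_sum]
      refine Finset.sum_le_sum fun s _ => ?_
      rw [prod_zpow_eq hβ0, ← mul_assoc]
      exact mul_le_mul_of_nonneg_right (hlow r hr s) (Real.exp_pos _).le
    -- Uses `exp x ≤ 1 + x + x ^ 2`, legitimate since `|ρ * δ s| ≤ 2 * q / L ≤ 1`.
    have h2 : ∑ s, P r s * Real.exp (ρ * δ s) ≤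
        ∑ s, P r s * (1 + ρ * δ s + 4 * ρ ^ 2 * q ^ 2) := by
      refine Finset.sum_le_sum fun s _ => mul_le_mul_of_nonneg_left ?_ (hP0 r hr s)
      have hg := hgain r hr s
      have habs : |ρ * δ s| ≤ 1 := by
        rw [abs_mul, abs_of_pos hρ0]
        calc ρ * |δ s| ≤ 1 / L * (2 * q) := by gcongr
          _ ≤ 1 := by
            rw [one_div, inv_mul_le_iff₀ (by linarith)]
            linarith
      have h3 := Real.abs_exp_sub_one_sub_id_le habs
      have h4 : (ρ * δ s) ^ 2 ≤ 4 * ρ ^ 2 * q ^ 2 := by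
        have : δ s ^ 2 ≤ (2 * q) ^ 2 := sq_le_sq' (by linarith [neg_abs_le (δ s)])
          (by linarith [le_abs_self (δ s)])
        rw [mul_pow]
        nlinarith [sq_nonneg ρ]
      have := (abs_le.1 h3).2
      linarith
    have h3 : ∑ s, P r s * (1 + ρ * δ s + 4 * ρ ^ 2 * q ^ 2) =
        1 + (ρ * ∑ s, P r s * δ s + 4 * ρ ^ 2 * q ^ 2) := by
      have : ∀ s, P r s * (1 + ρ * δ s + 4 * ρ ^ 2 * q ^ 2) =
          P r s * (1 + 4 * ρ ^ 2 * q ^ 2) + ρ * (P r s * δ s) := fun s => by ring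
      simp only [this]
      rw [Finset.sum_add_distrib, ← Finset.sum_mul, hP1 r hr, ← Finset.mul_sum]
      ring
    have h4 : (1 - 1 / L) * (F.root (Z (r + 1)) / F.root (Z r)) ≤
        Real.exp (ρ * ∑ s, P r s * δ s + 4 * ρ ^ 2 * q ^ 2) := by
      refine (h1.trans (h2.trans_eq h3)).trans ?_
      rw [add_comm]
      exact Real.add_one_le_exp _
    have h5 := Real.log_le_log (mul_pos (by linarith) (div_pos hr1 hr0)) h4
    rw [Real.log_exp, Real.log_mul (by linarith) (div_pos hr1 hr0).ne',
      Real.log_div hr1.ne' hr0.ne'] at h5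
    have := neg_two_mul_le_log_one_sub hLi0.le hLi
    linarith
  have hsum := Finset.sum_le_sum fun r hr => hround r (Finset.mem_range.1 hr)
  rw [Finset.sum_add_distrib, Finset.sum_range_sub (fun r => Real.log (F.root (Z r))),
    Finset.sum_add_distrib] at hsum
  simp only [Finset.sum_const, Finset.card_range, nsmul_eq_mul] at hsum
  rw [← Finset.mul_sum] at hsum
  -- the two ends
  have hn : (0 : ℝ) < n := by exact_mod_cast Nat.pos_of_ne_zero (NeZero.ne n)
  have hstart : Real.log (F.root (Z 0)) ≤ Φ * Real.log n := by
    have := (hZ 0 (Nat.zero_le _)).root_le (fun h a => by simp [hx0])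
    rw [← Real.log_pow]
    exact Real.log_le_log (root_pos (hZ 0 (Nat.zero_le _)).pos) this
  have hend : ρ * ∑ r ∈ Finset.range M, F.gain (x r) (x (r + 1)) s' ≤
      Real.log (F.root (Z M)) := by
    have h1 := (hZ M le_rfl).le_root s'
    have h2 : (∏ h, if F.Reach s' h then β ^ (x M h (s' h)) else 1) =
        Real.exp (ρ * F.gain (x 0) (x M) s') := by
      rw [← prod_zpow_eq hβ0]
      simp [hx0]
    -- The gains of a fixed strategy telescope, because the information sets it reaches do not
    -- depend on the round.
    have h3 : ∑ r ∈ Finset.range M, F.gain (x r) (x (r + 1)) s' = F.gain (x 0) (x M) s' := by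
      simp only [gain]
      rw [Finset.sum_comm]
      refine Finset.sum_congr rfl fun h _ => ?_
      split_ifs
      · rw [Finset.sum_range_sub (fun r => (x r h (s' h) : ℝ))]
      · simp
    rw [h3, ← Real.log_exp (ρ * _), ← h2]
    exact Real.log_le_log (by rw [h2]; exact Real.exp_pos _) h1
  rw [Finset.sum_sub_distrib]
  set A := ∑ r ∈ Finset.range M, F.gain (x r) (x (r + 1)) s'
  set B := ∑ r ∈ Finset.range M, ∑ s, P r s * F.gain (x r) (x (r + 1)) s
  have hlogn : 0 ≤ Φ * Real.log n := by
    have : 0 ≤ Real.log n := Real.log_natCast_nonneg n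
    positivity
  have key : ρ * (A - B) ≤ Φ * Real.log n + M * (4 * ρ ^ 2 * q ^ 2 + 2 * (1 / L)) := by
    linarith
  have h6 : A - B ≤ (Φ * Real.log n + M * (4 * ρ ^ 2 * q ^ 2 + 2 * (1 / L))) / ρ := by
    rw [le_div_iff₀ hρ0]
    linarith
  refine h6.trans ?_
  -- The bound `ρ ≥ 1 / (2 * L)` serves the initial potential and the sampling loss; the
  -- second-order term uses `ρ ≤ 1 / L`.
  have hi : 1 / ρ ≤ 2 * L := by
    rw [div_le_iff₀ hρ0]
    have := mul_le_mul_of_nonneg_left hρ1 (show 0 ≤ 2 * L by linarith)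
    rwa [mul_one_div_cancel (by linarith)] at this
  have h7 : (Φ * Real.log n + M * (4 * ρ ^ 2 * q ^ 2 + 2 * (1 / L))) / ρ =
      (1 / ρ) * (Φ * Real.log n) + M * (4 * ρ * q ^ 2 + 2 * (1 / L) * (1 / ρ)) := by
    field_simp
  rw [h7]
  have h8 : 2 * (1 / L) * (1 / ρ) ≤ 4 := by
    calc 2 * (1 / L) * (1 / ρ) ≤ 2 * (1 / L) * (2 * L) := by gcongr
      _ = 4 := by field_simp; norm_num
  have h9 : 4 * ρ * q ^ 2 ≤ 4 * q ^ 2 / L := by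
    calc 4 * ρ * q ^ 2 ≤ 4 * (1 / L) * q ^ 2 := by gcongr
      _ = 4 * q ^ 2 / L := by ring
  gcongr

end Forest

end EFG

end

/-! ### Decomposition of the payoff along the own information sets -/

noncomputable section

namespace EFG

namespace Forest

variable {n Φ : ℕ} [NeZero n] (F : Forest n Φ)

open Classical in
/-- The strategy that moves to `h`, plays `a` there, and plays `0` everywhere else. -/
def path (h : Fin Φ) (a : Fin n) : Strategy n Φ := fun g =>
  if g = h then a else if hx : ∃ x, (g, x) ∈ F.seq h then hx.choose else 0

variable {F}

theorem path_self (h : Fin Φ) (a : Fin n) : F.path h a h = a := by simp [path]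

theorem eq_of_mem_seq {h g : Fin Φ} {x y : Fin n} (hx : (g, x) ∈ F.seq h)
    (hy : (g, y) ∈ F.seq h) : x = y := by
  have := List.inj_on_of_nodup_map (List.nodup_cons.1 (F.nodup_seq h)).2 hx hy rfl
  simpa using this

theorem path_of_mem {h g : Fin Φ} {x : Fin n} (a : Fin n) (hx : (g, x) ∈ F.seq h) :
    F.path h a g = x := by
  have hne : g ≠ h := fun e => by
    have := dep_lt_of_mem hx
    rw [e] at this
    simp at this
  have hex : ∃ x, (g, x) ∈ F.seq h := ⟨x, hx⟩
  simp only [path, if_neg hne, dif_pos hex]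
  exact eq_of_mem_seq hex.choose_spec hx

theorem path_of_notMem {h g : Fin Φ} (a : Fin n) (hne : g ≠ h)
    (hx : ∀ x, (g, x) ∉ F.seq h) : F.path h a g = 0 := by
  have hex : ¬ ∃ x, (g, x) ∈ F.seq h := fun ⟨x, h⟩ => hx x h
  simp only [path, if_neg hne, dif_neg hex]

theorem path_eq_path {h g : Fin Φ} (a b : Fin n) (hne : g ≠ h) :
    F.path h a g = F.path h b g := by
  simp only [path, if_neg hne]

end Forest

namespace GameTree

variable {m n Φ : ℕ}

theorem prefix_of_mem_occurrences {i : Fin m} {h : Fin Φ} {σ : List (Fin Φ × Fin n)}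
    (t : GameTree m n Φ) : ∀ {σ₀ : List (Fin Φ × Fin n)}, (h, σ) ∈ t.occurrences i σ₀ →
    σ₀ <+: σ := by
  induction t with
  | terminal γ => intro σ₀ hm; simp [occurrences] at hm
  | chance k p next ih =>
    intro σ₀ hm
    simp only [occurrences, Set.mem_iUnion] at hm
    obtain ⟨j, hj⟩ := hm
    exact ih j hj
  | decision j g next ih =>
    intro σ₀ hm
    simp only [occurrences] at hm
    split_ifs at hm
    · rcases hm with hm | hm
      · simp only [Prod.mk.injEq] at hm
        rw [hm.2]
      · obtain ⟨a, ha⟩ := Set.mem_iUnion.1 hm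
        exact (List.prefix_append _ _).trans (ih a ha)
    · obtain ⟨a, ha⟩ := Set.mem_iUnion.1 hm
      exact ih a ha

/-- The last own move on the way to a node was made at another node of the tree, unless it was made
before the root of the subtree. This is why the own sequences of a game form a `Forest`. -/
theorem mem_occurrences_of_append {i : Fin m} {h g : Fin Φ} {a : Fin n}
    {l : List (Fin Φ × Fin n)} (t : GameTree m n Φ) : ∀ {σ₀ : List (Fin Φ × Fin n)},
    (h, l ++ [(g, a)]) ∈ t.occurrences i σ₀ → σ₀ ≠ l ++ [(g, a)] →
    (g, l) ∈ t.occurrences i σ₀ := by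
  induction t with
  | terminal γ => intro σ₀ hm; simp [occurrences] at hm
  | chance k p next ih =>
    intro σ₀ hm hne
    simp only [occurrences, Set.mem_iUnion] at hm ⊢
    obtain ⟨j, hj⟩ := hm
    exact ⟨j, ih j hj hne⟩
  | decision j g₀ next ih =>
    intro σ₀ hm hne
    simp only [occurrences] at hm ⊢
    split_ifs at hm ⊢
    · rcases hm with hm | hm
      · simp only [Prod.mk.injEq] at hm
        exact absurd hm.2.symm hne
      · obtain ⟨b, hb⟩ := Set.mem_iUnion.1 hm
        by_cases e : σ₀ ++ [(g₀, b)] = l ++ [(g, a)]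
        · left
          have := List.append_inj' e rfl
          simp only [List.cons.injEq, Prod.mk.injEq, and_true] at this
          rw [this.1, this.2.1]
        · right
          exact Set.mem_iUnion.2 ⟨b, ih b hb e⟩
    · obtain ⟨b, hb⟩ := Set.mem_iUnion.1 hm
      exact Set.mem_iUnion.2 ⟨b, ih b hb hne⟩

theorem util_congr {i : Fin m} {s : Profile m n Φ} {r r' : Strategy n Φ} (t : GameTree m n Φ) :
    ∀ {σ₀ : List (Fin Φ × Fin n)}, (∀ g σ, (g, σ) ∈ t.occurrences i σ₀ → r g = r' g) →
    util (Function.update s i r) i t = util (Function.update s i r') i t := by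
  induction t with
  | terminal γ => intro _ _; rfl
  | chance k p next ih =>
    intro σ₀ hr
    simp only [util]
    refine Finset.sum_congr rfl fun j _ => ?_
    rw [ih j fun g σ hg => hr g σ (Set.mem_iUnion.2 ⟨j, hg⟩)]
  | decision j g next ih =>
    intro σ₀ hr
    simp only [util]
    simp only [occurrences] at hr
    split_ifs at hr with e
    · subst e
      simp only [Function.update_self]
      rw [hr g σ₀ (Or.inl rfl)]
      exact ih _ fun g' σ hg => hr g' σ (Or.inr (Set.mem_iUnion.2 ⟨_, hg⟩))
    · simp only [Function.update_of_ne e]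
      exact ih _ fun g' σ hg => hr g' σ (Set.mem_iUnion.2 ⟨_, hg⟩)

theorem util_mem_Icc {i : Fin m} {s : Profile m n Φ} (t : GameTree m n Φ) :
    util s i t ∈ Set.Icc (0 : ℝ) 1 := by
  induction t with
  | terminal γ => exact (γ i).2
  | chance k p next ih =>
    simp only [util]
    constructor
    · exact Finset.sum_nonneg fun j _ => mul_nonneg (p.2.1 j) (ih j).1
    · calc ∑ j, p.1 j * util s i (next j) ≤ ∑ j, p.1 j * 1 :=
            Finset.sum_le_sum fun j _ => mul_le_mul_of_nonneg_left (ih j).2 (p.2.1 j)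
        _ = 1 := by simpa using p.2.2
  | decision j g next ih => exact ih _

/-- The payoff of a strategy is the payoff of the reference strategy `0`, plus the advantages of
its actions at the information sets that it can reach. -/
theorem util_eq_add_sum [NeZero n] (F : Forest n Φ) {i : Fin m} {s : Profile m n Φ}
    {r : Strategy n Φ} (t : GameTree m n Φ) : ∀ {σ₀ : List (Fin Φ × Fin n)},
    (∀ h σ, (h, σ) ∈ t.occurrences i σ₀ → F.seq h = σ) → (∀ p ∈ σ₀, r p.1 = p.2) →
    util (Function.update s i r) i t = util (Function.update s i 0) i t +
      ∑ h, if F.Reach r h then util (Function.update s i (F.path h (r h))) i t -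
        util (Function.update s i (F.path h 0)) i t else 0 := by
  induction t with
  | terminal γ => intro _ _ _; simp [util]
  | chance k p next ih =>
    intro σ₀ hocc hr
    have h1 : ∀ j, util (Function.update s i r) i (next j) = _ := fun j =>
      ih j (σ₀ := σ₀) (fun h σ hm => hocc h σ (Set.mem_iUnion.2 ⟨j, hm⟩)) hr
    simp only [util]
    rw [Finset.sum_congr rfl fun j _ => by rw [h1 j]]
    simp only [mul_add, Finset.sum_add_distrib, Finset.mul_sum]
    congr 1
    rw [Finset.sum_comm]
    refine Finset.sum_congr rfl fun h _ => ?_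
    split_ifs
    · rw [← Finset.sum_sub_distrib]
      exact Finset.sum_congr rfl fun j _ => by ring
    · simp
  | decision j g next ih =>
    intro σ₀ hocc hr
    by_cases e : j = i
    · subst e
      simp only [occurrences, if_true] at hocc
      have hseq : F.seq g = σ₀ := hocc g σ₀ (Or.inl rfl)
      have hnext : ∀ b h σ, (h, σ) ∈ (next b).occurrences j (σ₀ ++ [(g, b)]) →
          F.seq h = σ ∧ (g, b) ∈ F.seq h ∧ h ≠ g ∧ ∀ x, (h, x) ∉ F.seq g := by
        intro b h σ hm
        have h1 := hocc h σ (Or.inr (Set.mem_iUnion.2 ⟨b, hm⟩))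
        have h2 : (g, b) ∈ F.seq h := by
          rw [h1]
          exact (prefix_of_mem_occurrences _ hm).subset (by simp)
        have h3 := Forest.dep_lt_of_mem h2
        refine ⟨h1, h2, fun e => by rw [e] at h3; simp at h3, fun x hx => ?_⟩
        have := Forest.dep_lt_of_mem hx
        simp only at h3 this
        omega
      simp only [util, Function.update_self]
      have hr' : ∀ p ∈ σ₀ ++ [(g, r g)], r p.1 = p.2 := by
        intro p hp
        rw [List.mem_append, List.mem_singleton] at hp
        rcases hp with hp | rfl
        · exact hr p hp
        · rfl
      rw [ih (r g) (fun h σ hm => (hnext _ h σ hm).1) hr']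
      -- Past `g`, the strategy `path g b` plays 0 everywhere: no information set there is `g` or on
      -- the way to `g`.
      have hpath : ∀ b : Fin n, util (Function.update s j (F.path g b)) j (next b) =
          util (Function.update s j 0) j (next b) := by
        intro b
        refine util_congr _ (σ₀ := σ₀ ++ [(g, b)]) fun h σ hm => ?_
        obtain ⟨-, -, h3, h4⟩ := hnext b h σ hm
        exact Forest.path_of_notMem b h3 h4
      have hpath' : ∀ b x y : Fin n, util (Function.update s j (F.path g x)) j (next b) =
          util (Function.update s j (F.path g y)) j (next b) := by
        intro b x y
        refine util_congr _ (σ₀ := σ₀ ++ [(g, b)]) fun h σ hm => ?_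
        exact Forest.path_eq_path _ _ (hnext b h σ hm).2.2.1
      have hreach : F.Reach r g := fun p hp => hr p (hseq ▸ hp)
      -- Passing from the current node to its successor changes only the advantage at `g`. If `g`
      -- lies on the way to a reached `h`, both paths to `h` make the move at `g` that `r` makes.
      -- Otherwise, for `h ≠ g`, the two paths agree at `g` and on everything below, so both
      -- differences vanish.
      have hterm : ∀ h, (if F.Reach r h then
          util (Function.update s j (F.path h (r h))) j (next (F.path h (r h) g)) -
          util (Function.update s j (F.path h 0)) j (next (F.path h 0 g)) else 0) =
          (if F.Reach r h then
            util (Function.update s j (F.path h (r h))) j (next (r g)) -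
            util (Function.update s j (F.path h 0)) j (next (r g)) else 0) +
          if h = g then util (Function.update s j 0) j (next (r g)) -
            util (Function.update s j 0) j (next 0) else 0 := by
        intro h
        by_cases hg : h = g
        · subst hg
          simp only [if_pos hreach, if_true, Forest.path_self]
          rw [hpath, hpath, hpath' (r h) 0 (r h), hpath]
          ring
        · rw [if_neg hg, add_zero]
          split_ifs with hh
          · by_cases hx : ∃ x, (g, x) ∈ F.seq h
            · obtain ⟨x, hx⟩ := hx
              rw [Forest.path_of_mem _ hx, Forest.path_of_mem _ hx, hh _ hx]
            · have hno : ∀ b, util (Function.update s j (F.path h (r h))) j (next b) =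
                  util (Function.update s j (F.path h 0)) j (next b) := by
                intro b
                refine util_congr _ (σ₀ := σ₀ ++ [(g, b)]) fun h' σ hm => ?_
                refine Forest.path_eq_path _ _ fun e => hx ⟨b, ?_⟩
                rw [← e]
                exact (hnext b h' σ hm).2.1
              rw [Forest.path_eq_path (r h) 0 (Ne.symm hg), hno, hno, sub_self, sub_self]
          · rfl
      rw [Finset.sum_congr rfl fun h _ => hterm h, Finset.sum_add_distrib]
      simp only [Finset.sum_ite_eq', Finset.mem_univ, if_true, Pi.zero_apply]
      ring
    · simp only [occurrences, if_neg e] at hocc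
      simp only [util, Function.update_of_ne e]
      exact ih _ (fun h σ hm => hocc h σ (Set.mem_iUnion.2 ⟨_, hm⟩)) hr

end GameTree

namespace Game

variable {m n Φ : ℕ} (G : Game m n Φ) (i : Fin m)

theorem seqTo_mem (h : Fin Φ) : (h, G.seqTo i h) ∈ G.tree.occurrences i [] :=
  (G.nonempty i h).choose_spec

theorem seqTo_eq {h : Fin Φ} {σ : List (Fin Φ × Fin n)}
    (hm : (h, σ) ∈ G.tree.occurrences i []) : G.seqTo i h = σ :=
  G.perfect_recall i h _ _ (G.seqTo_mem i h) hm

def forest : Forest n Φ where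
  seq := G.seqTo i
  closed h l g a e := by
    refine G.seqTo_eq i (GameTree.mem_occurrences_of_append (h := h) (a := a) _ ?_ (by simp))
    rw [← e]
    exact G.seqTo_mem i h

theorem u_mem_Icc (s : Profile m n Φ) : G.u i s ∈ Set.Icc (0 : ℝ) 1 :=
  GameTree.util_mem_Icc _

theorem u_eq_add_sum [NeZero n] (s : Profile m n Φ) (r : Strategy n Φ) :
    G.u i (Function.update s i r) = G.u i (Function.update s i 0) +
      ∑ h, if (G.forest i).Reach r h then
        G.u i (Function.update s i ((G.forest i).path h (r h))) -
        G.u i (Function.update s i ((G.forest i).path h 0)) else 0 :=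
  GameTree.util_eq_add_sum (G.forest i) G.tree
    (fun _ _ hm => G.seqTo_eq i hm) (by simp)

end Game

end EFG

end

noncomputable section

namespace EFG

/-! ### The tree of the information sets in the memory of the machine -/

namespace Forest

variable {n Φ : ℕ} (F : Forest n Φ)

/-- The code of the last move of a sequence. -/
def codeOf (l : List (Fin Φ × Fin n)) : ℕ :=
  match l.getLast? with
  | none => 0
  | some (g, a) => g * n + a + 1

@[simp] theorem codeOf_nil : codeOf ([] : List (Fin Φ × Fin n)) = 0 := rfl

@[simp] theorem codeOf_append (l : List (Fin Φ × Fin n)) (g : Fin Φ) (a : Fin n) :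
    codeOf (l ++ [(g, a)]) = g * n + a + 1 := by
  simp [codeOf]

/-- The array `code` describes the forest. -/
def Codes (code : ℕ → ℕ) : Prop := ∀ h : Fin Φ, code h = codeOf (F.seq h)

variable {F} {code : ℕ → ℕ}

theorem Codes.eq_iff (hc : F.Codes code) {h h' : Fin Φ} {a : Fin n} :
    code h' = h * n + a + 1 ↔ F.par h' = some (h, a) := by
  rw [hc h', codeOf, ← par]
  cases F.par h' with
  | none => simp
  | some p =>
    obtain ⟨g, b⟩ := p
    simp only [Option.some.injEq, Prod.mk.injEq]
    constructor
    · intro e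
      have := index_inj (n := n) b.2 a.2 (by omega : (g : ℕ) * n + b = h * n + a)
      exact ⟨Fin.ext this.1, Fin.ext this.2⟩
    · rintro ⟨rfl, rfl⟩
      rfl

theorem codeOf_div (g : Fin Φ) (b : Fin n) : ((g : ℕ) * n + b + 1 - 1) / n = g := by
  rw [Nat.add_sub_cancel, mul_comm, Nat.mul_add_div (by have := b.2; omega),
    Nat.div_eq_of_lt b.2, add_zero]

theorem codeOf_mod (g : Fin Φ) (b : Fin n) : ((g : ℕ) * n + b + 1 - 1) % n = b := by
  rw [Nat.add_sub_cancel, mul_comm, Nat.mul_add_mod, Nat.mod_eq_of_lt b.2]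

theorem Codes.parent_iff (hc : F.Codes code) {h h' : Fin Φ} :
    (code h' ≠ 0 ∧ (code h' - 1) / n = h) ↔ ∃ a, F.par h' = some (h, a) := by
  rw [hc h', codeOf, ← par]
  cases F.par h' with
  | none => simp
  | some p =>
    obtain ⟨g, b⟩ := p
    simp only [codeOf_div, Option.some.injEq, Prod.mk.injEq]
    constructor
    · rintro ⟨-, e⟩
      exact ⟨b, Fin.ext e, rfl⟩
    · rintro ⟨a, rfl, -⟩
      exact ⟨by omega, rfl⟩

theorem seq_of_append {h g : Fin Φ} {x : Fin n} : ∀ {l rest : List (Fin Φ × Fin n)},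
    F.seq h = l ++ (g, x) :: rest → F.seq g = l := by
  refine F.induction_on (P := fun h => ∀ {l rest : List (Fin Φ × Fin n)},
    F.seq h = l ++ (g, x) :: rest → F.seq g = l) ?_ ?_ h
  · intro h e l rest e'
    rw [par_eq_none.1 e] at e'
    simp at e'
  · intro h g' b e ih l rest e'
    rcases List.eq_nil_or_concat rest with rfl | ⟨rest', p, rfl⟩
    · exact F.closed h l g x e'
    · rw [par_eq_some.1 e] at e'
      have e2 : F.seq g' ++ [(g', b)] = (l ++ (g, x) :: rest') ++ [p] := by
        rw [e']; simp
      exact ih (List.append_inj' e2 rfl).1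

/-- The machine computes `path`. -/
theorem Codes.pathRow_eq [NeZero n] (hc : F.Codes code) (h : Fin Φ) (a : Fin n) (g : Fin Φ) :
    pathRow n Φ code h a g = F.path h a g := by
  -- Invariant of the walk towards the root: the moves in `rest` have been written, and the pointer
  -- holds the code of the remaining initial segment `l`. As the depth is less than `Φ`, after `Φ`
  -- steps `l` is empty.
  have key : ∀ k, ∃ l rest, F.seq h = l ++ rest ∧ l.length = F.dep h - k ∧
      ((walkStep n code)^[k] (Function.update 0 (h : ℕ) (a : ℕ), code h)).2 = codeOf l ∧
      ((walkStep n code)^[k] (Function.update 0 (h : ℕ) (a : ℕ), code h)).1 h = a ∧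
      (∀ p ∈ rest, ((walkStep n code)^[k]
        (Function.update 0 (h : ℕ) (a : ℕ), code h)).1 (p.1 : Fin Φ) = (p.2 : Fin n)) ∧
      ∀ g : Fin Φ, g ≠ h → (∀ x, (g, x) ∉ rest) → ((walkStep n code)^[k]
        (Function.update 0 (h : ℕ) (a : ℕ), code h)).1 g = 0 := by
    intro k
    induction k with
    | zero =>
      refine ⟨F.seq h, [], by simp, by simp [dep], hc h, by simp, by simp, ?_⟩
      intro g hg _
      have : (g : ℕ) ≠ h := fun e => hg (Fin.ext e)
      simp [this]
    | succ k ih =>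
      obtain ⟨l, rest, e1, e2, e3, e4, e5, e6⟩ := ih
      set p := (walkStep n code)^[k] (Function.update 0 (h : ℕ) (a : ℕ), code h) with hp
      simp only [Function.iterate_succ_apply', ← hp]
      rcases List.eq_nil_or_concat l with rfl | ⟨l', ⟨g', x⟩, rfl⟩
      · have : walkStep n code p = p := by
          rw [walkStep, if_pos (by simpa using e3)]
        rw [this]
        exact ⟨[], rest, e1, by simp at e2 ⊢; omega, e3, e4, e5, e6⟩
      · have e3' : p.2 = (g' : ℕ) * n + x + 1 := by simpa using e3
        have e1' : F.seq h = l' ++ (g', x) :: rest := by rw [e1]; simp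
        have hstep : walkStep n code p =
            (Function.update p.1 (g' : ℕ) (x : ℕ), code g') := by
          rw [walkStep, if_neg (by omega), e3', codeOf_div, codeOf_mod]
        have hmem : (g', x) ∈ F.seq h := by rw [e1']; simp
        have hg'h : (h : ℕ) ≠ g' := fun e => by
          have := dep_lt_of_mem hmem
          rw [← Fin.ext e] at this
          simp at this
        rw [hstep]
        refine ⟨l', (g', x) :: rest, e1', ?_, ?_, ?_, ?_, ?_⟩
        · simp at e2; omega
        · simp only
          rw [hc g', seq_of_append e1']
        · simp [Function.update_of_ne hg'h, e4]
        · intro q hq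
          have hq' : q ∈ F.seq h := by rw [e1']; exact List.mem_append_right _ hq
          by_cases e : q.1 = g'
          · have : q.2 = x := by
              refine eq_of_mem_seq (F := F) (h := h) (g := g') ?_ hmem
              rw [← e]; exact hq'
            simp [e, this]
          · have : (q.1 : ℕ) ≠ g' := fun e' => e (Fin.ext e')
            rw [List.mem_cons] at hq
            rcases hq with rfl | hq
            · exact absurd rfl e
            · simp [Function.update_of_ne this, e5 q hq]
        · intro g hg hno
          have : (g : ℕ) ≠ g' := fun e' => hno x (by rw [Fin.ext e']; simp)
          simp only [Function.update_of_ne this]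
          exact e6 g hg fun y hy => hno y (List.mem_cons_of_mem _ hy)
  obtain ⟨l, rest, e1, e2, -, e4, e5, e6⟩ := key Φ
  have hl : l = [] := List.length_eq_zero_iff.1 (by have := F.dep_lt h; omega)
  subst hl
  rw [List.nil_append] at e1
  unfold pathRow
  by_cases hg : g = h
  · subst hg
    rw [path_self, e4]
  · by_cases hx : ∃ x, (g, x) ∈ F.seq h
    · obtain ⟨x, hx⟩ := hx
      rw [path_of_mem a hx]
      exact e5 (g, x) (e1 ▸ hx)
    · rw [path_of_notMem a hg fun x h => hx ⟨x, h⟩, e6 g hg fun x h => hx ⟨x, e1 ▸ h⟩]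
      simp

/-! ### Integer weights of the subtrees -/

section Totals

variable (F) [NeZero n]

-- The product runs over the children of `h` under all actions, so this is a denominator common to
-- all actions at `h`.
open Classical in
def totalD (base : ℕ) (h : Fin Φ) : ℕ :=
  base * ∏ h', if _hh : ∃ a, F.par h' = some (h, a) then totalD base h' else 1
termination_by Φ - F.dep h
decreasing_by
  obtain ⟨a, ha⟩ := _hh
  have := dep_of_par ha
  have := F.dep_lt h'
  omega

-- Numerators over `totalD`: children under the other actions contribute their denominator, that is,
-- the fraction 1.
open Classical in
def totalN (wgt : Fin Φ → Fin n → ℕ) (base : ℕ) (h : Fin Φ) : ℕ :=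
  ∑ a, wgt h a * ∏ h', if _hh : F.par h' = some (h, a) then totalN wgt base h' else
    if ∃ b, F.par h' = some (h, b) then F.totalD base h' else 1
termination_by Φ - F.dep h
decreasing_by
  have := dep_of_par _hh
  have := F.dep_lt h'
  omega

open Classical in
/-- The weight of an action: total weight of the strategies that start with this action. -/
def actionWeight (wgt : Fin Φ → Fin n → ℕ) (base : ℕ) (h : Fin Φ) (a : Fin n) : ℕ :=
  wgt h a * ∏ h', if F.par h' = some (h, a) then F.totalN wgt base h' else
    if ∃ b, F.par h' = some (h, b) then F.totalD base h' else 1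

variable {F} {wgt : Fin Φ → Fin n → ℕ} {base : ℕ}

open Classical in
theorem totalD_eq (h : Fin Φ) : F.totalD base h =
    base * ∏ h', if ∃ a, F.par h' = some (h, a) then F.totalD base h' else 1 := by
  rw [totalD]
  simp only [dite_eq_ite]

theorem totalN_eq (h : Fin Φ) : F.totalN wgt base h = ∑ a, F.actionWeight wgt base h a := by
  rw [totalN]
  simp only [dite_eq_ite]
  rfl

theorem induction_up {P : Fin Φ → Prop}
    (h1 : ∀ h, (∀ h' a, F.par h' = some (h, a) → P h') → P h) (h : Fin Φ) : P h := by
  induction hd : Φ - F.dep h using Nat.strong_induction_on generalizing h with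
  | _ d ih =>
    refine h1 h fun h' a e => ih (Φ - F.dep h') ?_ h' rfl
    have := dep_of_par e
    have := F.dep_lt h'
    omega

theorem totalD_pos (hb : 1 ≤ base) (h : Fin Φ) : 1 ≤ F.totalD base h := by
  refine F.induction_up (P := fun h => 1 ≤ F.totalD base h) (fun h ih => ?_) h
  rw [totalD_eq]
  refine Nat.mul_pos hb (Finset.prod_pos fun h' _ => ?_)
  split_ifs with e
  · obtain ⟨a, ha⟩ := e
    exact ih h' a ha
  · exact one_pos

theorem totalN_pos (hb : 1 ≤ base) (hw : ∀ h a, 1 ≤ wgt h a) (h : Fin Φ) :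
    1 ≤ F.totalN wgt base h := by
  refine F.induction_up (P := fun h => 1 ≤ F.totalN wgt base h) (fun h ih => ?_) h
  rw [totalN_eq]
  refine Nat.succ_le_of_lt (Finset.sum_pos (fun a _ => ?_) Finset.univ_nonempty)
  refine Nat.mul_pos (hw h a) (Finset.prod_pos fun h' _ => ?_)
  split_ifs with e e'
  · exact ih h' a e
  · exact totalD_pos hb h'
  · exact one_pos

theorem totalD_mono {base' : ℕ} (hb : base ≤ base') (h : Fin Φ) :
    F.totalD base h ≤ F.totalD base' h := by
  refine F.induction_up (P := fun h => F.totalD base h ≤ F.totalD base' h) (fun h ih => ?_) h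
  rw [totalD_eq, totalD_eq]
  refine Nat.mul_le_mul hb (Finset.prod_le_prod' fun h' _ => ?_)
  split_ifs with e
  · obtain ⟨a, ha⟩ := e
    exact ih h' a ha
  · exact le_rfl

/-- If every weight is replaced by `top`, the sum over the actions has `n` equal terms, and the
recursion for the numerators turns into the one for denominators with base `n * top`. -/
theorem totalN_le {top : ℕ} (hw : ∀ h a, wgt h a ≤ top) (hb : base ≤ n * top) (h : Fin Φ) :
    F.totalN wgt base h ≤ F.totalD (n * top) h := by
  refine F.induction_up (P := fun h => F.totalN wgt base h ≤ F.totalD (n * top) h)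
    (fun h ih => ?_) h
  rw [totalN_eq, totalD_eq]
  calc ∑ a, F.actionWeight wgt base h a ≤ ∑ _a : Fin n, top *
        ∏ h', (open Classical in
          if ∃ a, F.par h' = some (h, a) then F.totalD (n * top) h' else 1) := by
        refine Finset.sum_le_sum fun a _ => Nat.mul_le_mul (hw h a)
          (Finset.prod_le_prod' fun h' _ => ?_)
        by_cases e : F.par h' = some (h, a)
        · rw [if_pos e, if_pos ⟨a, e⟩]
          exact ih h' a e
        · rw [if_neg e]
          split_ifs
          · exact totalD_mono hb h'
          · exact le_rfl
    _ = _ := by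
        rw [Finset.sum_const, Finset.card_univ, Fintype.card_fin, smul_eq_mul, mul_assoc]

-- Multiply the recursions for all `h`. The base occurs `Φ` times and every information set that is
-- not a root occurs once on each side, so that only the roots remain.
open Classical in
theorem prod_root_totalD (hb : 1 ≤ base) :
    (∏ h, if F.par h = none then F.totalD base h else 1) = base ^ Φ := by
  have h1 : ∏ h, F.totalD base h = base ^ Φ *
      ∏ h', (if F.par h' ≠ none then F.totalD base h' else 1) := by
    conv_lhs => rw [Finset.prod_congr rfl fun h _ => totalD_eq (F := F) (base := base) h]
    rw [Finset.prod_mul_distrib, Finset.prod_const, Finset.card_univ, Fintype.card_fin,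
      Finset.prod_comm]
    congr 1
    refine Finset.prod_congr rfl fun h' _ => ?_
    cases hp : F.par h' with
    | none => simp
    | some p =>
      obtain ⟨g, a⟩ := p
      rw [Finset.prod_eq_single g]
      · simp
      · intro b _ hb
        rw [if_neg]
        rintro ⟨x, e⟩
        simp only [Option.some.injEq, Prod.mk.injEq] at e
        exact hb e.1.symm
      · simp
  have h2 : ∏ h, F.totalD base h = (∏ h, if F.par h = none then F.totalD base h else 1) *
      ∏ h', (if F.par h' ≠ none then F.totalD base h' else 1) := by
    rw [← Finset.prod_mul_distrib]
    refine Finset.prod_congr rfl fun h _ => ?_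
    by_cases e : F.par h = none <;> simp [e]
  have h3 : 0 < ∏ h', (if F.par h' ≠ none then F.totalD base h' else 1) :=
    Finset.prod_pos fun h _ => by
      split_ifs
      · exact totalD_pos hb h
      · exact one_pos
  exact Nat.eq_of_mul_eq_mul_right h3 (h2.symm.trans h1)

/-- A denominator is a factor of the one at its parent, so it suffices to consider a root, and there
`prod_root_totalD` applies. -/
theorem totalD_le (hb : 1 ≤ base) (h : Fin Φ) : F.totalD base h ≤ base ^ Φ := by
  classical
  refine F.induction_on (P := fun h => F.totalD base h ≤ base ^ Φ) ?_ ?_ h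
  · intro h e
    rw [← prod_root_totalD (F := F) hb]
    have := Finset.single_le_prod' (s := Finset.univ)
      (f := fun h => if F.par h = none then F.totalD base h else 1) (fun h _ => by
        split_ifs
        · exact totalD_pos hb h
        · exact le_rfl) (Finset.mem_univ h)
    simpa [e] using this
  · intro h g a e ih
    refine le_trans ?_ ih
    rw [totalD_eq g]
    have := Finset.single_le_prod' (s := Finset.univ)
      (f := fun h => if ∃ a, F.par h = some (g, a) then F.totalD base h else 1) (fun h _ => by
        split_ifs
        · exact totalD_pos hb h
        · exact le_rfl) (Finset.mem_univ h)
    rw [if_pos ⟨a, e⟩] at this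
    exact this.trans (Nat.le_mul_of_pos_left _ hb)

end Totals

/-- A function on `Fin Φ` as an array. -/
def toArray (f : Fin Φ → ℕ) (k : ℕ) : ℕ := if hk : k < Φ then f ⟨k, hk⟩ else 0

@[simp] theorem toArray_val (f : Fin Φ → ℕ) (h : Fin Φ) : toArray f h = f h := by
  simp [toArray]

theorem Codes.facD_eq (hc : F.Codes code) (D : Fin Φ → ℕ) (h h' : Fin Φ) :
    facD n code (toArray D) h h' =
      open Classical in if ∃ a, F.par h' = some (h, a) then D h' else 1 := by
  rw [facD]
  simp only [hc.parent_iff, toArray_val]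

variable [NeZero n] {wgt : Fin Φ → Fin n → ℕ} {wgt' : ℕ → ℕ → ℕ} {base : ℕ}

theorem Codes.nextD_eq (hc : F.Codes code) (h : Fin Φ) :
    nextD n Φ code base (toArray (F.totalD base)) h = F.totalD base h := by
  rw [nextD, totalD_eq, Finset.prod_range]
  simp only [hc.facD_eq]

theorem Codes.nextW_eq (hc : F.Codes code) (hw : ∀ (h : Fin Φ) (a : Fin n), wgt' h a = wgt h a)
    (h : Fin Φ) (a : Fin n) : nextW n Φ code wgt' (toArray (F.totalN wgt base))
      (toArray (F.totalD base)) h a = F.actionWeight wgt base h a := by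
  rw [nextW, actionWeight, Finset.prod_range, hw]
  simp only [facN, hc.eq_iff, hc.facD_eq, toArray_val]

theorem Codes.nextN_eq (hc : F.Codes code) (hw : ∀ (h : Fin Φ) (a : Fin n), wgt' h a = wgt h a)
    (h : Fin Φ) : nextN n Φ code wgt' (toArray (F.totalN wgt base))
      (toArray (F.totalD base)) h = F.totalN wgt base h := by
  rw [nextN, totalN_eq, Finset.sum_range]
  simp only [hc.nextW_eq hw]

end Forest

end EFG

end

noncomputable section

namespace EFG

/-! ### The integer weights are exponential weights -/

/-- With `z = y - y₀`, this is `(L + 1) ^ (X + z) * L ^ (X - z) = (L * (L + 1)) ^ X * ((L + 1) / L)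
^ z`. Scores bounded by `X` keep both exponents nonnegative, so that the truncated subtractions are
exact. -/
theorem weight_eq {L X y y₀ : ℕ} (hL : 1 ≤ L) (hy : y ≤ X) (hy₀ : y₀ ≤ X) :
    (weight L X y y₀ : ℝ) = ((L * (L + 1)) ^ X : ℕ) * (1 + 1 / (L : ℝ)) ^ ((y : ℤ) - y₀) := by
  have hL0 : (L : ℝ) ≠ 0 := by positivity
  have hL1 : (L : ℝ) + 1 ≠ 0 := by positivity
  have e1 : ((L : ℝ) + 1) ^ (X + y - y₀) = ((L : ℝ) + 1) ^ ((X : ℤ) + (y - y₀)) := by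
    rw [← zpow_natCast]
    congr 1
    omega
  have e2 : (L : ℝ) ^ (X + y₀ - y) = (L : ℝ) ^ ((X : ℤ) - (y - y₀)) := by
    rw [← zpow_natCast]
    congr 1
    omega
  have e3 : 1 + 1 / (L : ℝ) = (L + 1) / L := by field_simp
  rw [weight]
  push_cast
  rw [e1, e2, e3, zpow_add₀ hL1, zpow_sub₀ hL0, div_zpow, mul_pow, zpow_natCast, zpow_natCast]
  ring

theorem weight_le {L X y y₀ : ℕ} (hy : y ≤ X) (hy₀ : y₀ ≤ X) :
    weight L X y y₀ ≤ (L + 1) ^ (2 * X) := by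
  calc weight L X y y₀ ≤ (L + 1) ^ (X + y - y₀) * (L + 1) ^ (X + y₀ - y) :=
        Nat.mul_le_mul_left _ (Nat.pow_le_pow_left (by omega) _)
    _ = (L + 1) ^ (2 * X) := by
        rw [← pow_add]
        congr 1
        omega

theorem one_le_weight {L X y y₀ : ℕ} (hL : 1 ≤ L) : 1 ≤ weight L X y y₀ :=
  Nat.mul_pos (Nat.pow_pos (by omega)) (Nat.pow_pos hL)

theorem top_lt {n L X : ℕ} : n * (L + 1) ^ (2 * X) < 2 ^ (n + 2 * X * L) := by
  have h1 : (L + 1) ^ (2 * X) ≤ 2 ^ (2 * X * L) := by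
    have : L + 1 ≤ 2 ^ L := Nat.lt_two_pow_self
    calc (L + 1) ^ (2 * X) ≤ (2 ^ L) ^ (2 * X) := Nat.pow_le_pow_left this _
      _ = 2 ^ (2 * X * L) := by rw [← pow_mul, mul_comm]
  rw [pow_add]
  calc n * (L + 1) ^ (2 * X) ≤ n * 2 ^ (2 * X * L) := Nat.mul_le_mul_left _ h1
    _ < 2 ^ n * 2 ^ (2 * X * L) :=
        Nat.mul_lt_mul_of_pos_right Nat.lt_two_pow_self (by positivity)

namespace Forest

variable {n Φ : ℕ} [NeZero n] (F : Forest n Φ) (L X : ℕ) (Y : Fin Φ → Fin n → ℕ)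

/-- The common denominator of the weights at one information set. -/
def expBase (L X : ℕ) : ℕ := (L * (L + 1)) ^ X

def expWeight (h : Fin Φ) (a : Fin n) : ℕ := weight L X (Y h a) (Y h 0)

/-- The total weight of a subtree. -/
def expTotal (h : Fin Φ) : ℕ := F.totalN (expWeight L X Y) (expBase L X) h

def expAction (h : Fin Φ) (a : Fin n) : ℕ := F.actionWeight (expWeight L X Y) (expBase L X) h a

/-- The total weight of a subtree, normalized. -/
def expZ (h : Fin Φ) : ℝ := F.expTotal L X Y h / F.totalD (expBase L X) h

variable {F L X Y}

theorem one_le_expBase (hL : 1 ≤ L) : 1 ≤ expBase L X := Nat.pow_pos (by positivity)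

theorem expAction_eq (hL : 1 ≤ L) (hY : ∀ h a, Y h a ≤ X) (h : Fin Φ) (a : Fin n) :
    (F.expAction L X Y h a : ℝ) = F.totalD (expBase L X) h *
      ((1 + 1 / (L : ℝ)) ^ ((Y h a : ℤ) - Y h 0) * F.below (F.expZ L X Y) h a) := by
  classical
  have hD : ∀ h, (F.totalD (expBase L X) h : ℝ) ≠ 0 := fun h => by
    have := totalD_pos (F := F) (one_le_expBase (X := X) hL) h
    positivity
  have hb : ((expBase L X : ℕ) : ℝ) ≠ 0 := by
    have := one_le_expBase (X := X) hL
    positivity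
  rw [expAction, actionWeight, totalD_eq, expWeight]
  push_cast
  rw [weight_eq hL (hY h a) (hY h 0), below]
  rw [show (((L * (L + 1)) ^ X : ℕ) : ℝ) = (expBase L X : ℕ) from rfl]
  -- After the denominators of all children are factored out, only the children under `a` leave a
  -- normalized total behind.
  have hprod : (∏ h', if F.par h' = some (h, a) then
        (F.totalN (expWeight L X Y) (expBase L X) h' : ℝ) else
        if ∃ b, F.par h' = some (h, b) then (F.totalD (expBase L X) h' : ℝ) else 1) =
      (∏ h', if ∃ b, F.par h' = some (h, b) then (F.totalD (expBase L X) h' : ℝ) else 1) *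
        ∏ h', if F.par h' = some (h, a) then F.expZ L X Y h' else 1 := by
    rw [← Finset.prod_mul_distrib]
    refine Finset.prod_congr rfl fun h' _ => ?_
    by_cases e : F.par h' = some (h, a)
    · rw [if_pos e, if_pos ⟨a, e⟩, if_pos e, expZ, expTotal, mul_div_cancel₀ _ (hD h')]
    · rw [if_neg e, if_neg e, mul_one]
  rw [hprod]
  ring

theorem expTotal_eq (h : Fin Φ) : F.expTotal L X Y h = ∑ a, F.expAction L X Y h a :=
  totalN_eq h

theorem expTotal_pos (hL : 1 ≤ L) (h : Fin Φ) : 1 ≤ F.expTotal L X Y h :=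
  totalN_pos (one_le_expBase hL) (fun _ _ => one_le_weight hL) h

theorem expTotal_lt (hL : 1 ≤ L) (hΦ : 1 ≤ Φ) (hY : ∀ h a, Y h a ≤ X) (h : Fin Φ) :
    F.expTotal L X Y h < 2 ^ ((n + 2 * X * L) * Φ) := by
  have hn : 1 ≤ n := Nat.one_le_iff_ne_zero.2 (NeZero.ne n)
  have hbase : expBase L X ≤ n * (L + 1) ^ (2 * X) := by
    refine le_trans ?_ (Nat.le_mul_of_pos_left _ hn)
    have := weight_le (L := L) (le_refl X) (le_refl X)
    refine le_trans (le_of_eq ?_) this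
    rw [weight, expBase, mul_pow, mul_comm]
    congr 2 <;> omega
  calc F.expTotal L X Y h ≤ F.totalD (n * (L + 1) ^ (2 * X)) h :=
        totalN_le (fun h a => weight_le (hY h a) (hY h 0)) hbase h
    _ ≤ (n * (L + 1) ^ (2 * X)) ^ Φ := totalD_le (Nat.mul_pos hn (by positivity)) h
    _ < (2 ^ (n + 2 * X * L)) ^ Φ := Nat.pow_lt_pow_left top_lt (by omega)
    _ = _ := by rw [← pow_mul]

theorem totalD_lt (hL : 1 ≤ L) (hΦ : 1 ≤ Φ) (h : Fin Φ) :
    F.totalD (expBase L X) h < 2 ^ ((n + 2 * X * L) * Φ) := by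
  have hn : 1 ≤ n := Nat.one_le_iff_ne_zero.2 (NeZero.ne n)
  have hbase : expBase L X ≤ n * (L + 1) ^ (2 * X) := by
    refine le_trans ?_ (Nat.le_mul_of_pos_left _ hn)
    have := weight_le (L := L) (le_refl X) (le_refl X)
    refine le_trans (le_of_eq ?_) this
    rw [weight, expBase, mul_pow, mul_comm]
    congr 2 <;> omega
  calc F.totalD (expBase L X) h ≤ (expBase L X) ^ Φ := totalD_le (one_le_expBase hL) h
    _ ≤ (n * (L + 1) ^ (2 * X)) ^ Φ := Nat.pow_le_pow_left hbase _
    _ < (2 ^ (n + 2 * X * L)) ^ Φ := Nat.pow_lt_pow_left top_lt (by omega)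
    _ = _ := by rw [← pow_mul]

theorem partition_expZ (hL : 1 ≤ L) (hY : ∀ h a, Y h a ≤ X) :
    F.Partition (fun h a => (1 + 1 / (L : ℝ)) ^ ((Y h a : ℤ) - Y h 0)) (F.expZ L X Y) := by
  have hD : ∀ h, (0 : ℝ) < F.totalD (expBase L X) h := fun h => by
    have := totalD_pos (F := F) (one_le_expBase (X := X) hL) h
    positivity
  have hN : ∀ h, (0 : ℝ) < F.expTotal L X Y h := fun h => by
    have := expTotal_pos (F := F) (X := X) (Y := Y) hL h
    positivity
  refine ⟨fun h a => by positivity, fun h => div_pos (hN h) (hD h), fun h => ?_⟩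
  rw [expZ, expTotal_eq]
  push_cast
  simp only [expAction_eq hL hY]
  rw [← Finset.mul_sum, mul_div_cancel_left₀ _ (hD h).ne']

theorem expAction_div (hL : 1 ≤ L) (hY : ∀ h a, Y h a ≤ X) (h : Fin Φ) (a : Fin n) :
    (F.expAction L X Y h a : ℝ) / F.expTotal L X Y h =
      (1 + 1 / (L : ℝ)) ^ ((Y h a : ℤ) - Y h 0) * F.below (F.expZ L X Y) h a /
        F.expZ L X Y h := by
  have hD : (0 : ℝ) < F.totalD (expBase L X) h := by
    have := totalD_pos (F := F) (one_le_expBase (X := X) hL) h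
    positivity
  have hN : (0 : ℝ) < F.expTotal L X Y h := by
    have := expTotal_pos (F := F) (X := X) (Y := Y) hL h
    positivity
  rw [expAction_eq hL hY, expZ]
  field_simp

end Forest

/-! ### Sampling from a uniformly random number -/

/-- Decode a number, read in the mixed radix system `N`, as a strategy. -/
def sample (n Φ : ℕ) [NeZero n] (W : ℕ → ℕ → ℕ) (N : ℕ → ℕ) (v : ℕ) : Strategy n Φ :=
  fun h => Fin.ofNat n (pick n (W h) ((v / ∏ h' ∈ Finset.range h, N h') % N h))

theorem pick_eq {n a y : ℕ} {W : ℕ → ℕ} (ha : a < n) (h1 : ∑ b ∈ Finset.range a, W b ≤ y)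
    (h2 : y < ∑ b ∈ Finset.range (a + 1), W b) : pick n W y = a := by
  have : (Finset.range n).filter (fun b => ∑ b' ∈ Finset.range (b + 1), W b' ≤ y) =
      Finset.range a := by
    ext b
    simp only [Finset.mem_filter, Finset.mem_range]
    constructor
    · rintro ⟨-, hb⟩
      by_contra hab
      have : ∑ b' ∈ Finset.range (a + 1), W b' ≤ ∑ b' ∈ Finset.range (b + 1), W b' :=
        Finset.sum_le_sum_of_subset (Finset.range_subset_range.2 (by omega))
      omega
    · intro hb
      refine ⟨by omega, le_trans ?_ h1⟩
      exact Finset.sum_le_sum_of_subset (Finset.range_subset_range.2 (by omega))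
  rw [pick, this, Finset.card_range]

/-- In each complete period of length `∏ N` every combination of digits occurs once, and `P`
contains `P / ∏ N` complete periods; the remainder is discarded. The induction splits off the lowest
digit. -/
theorem card_digits (Φ : ℕ) : ∀ (N lo w : ℕ → ℕ) (P : ℕ),
    (∀ h < Φ, lo h + w h ≤ N h) → (P / ∏ h ∈ Finset.range Φ, N h) * ∏ h ∈ Finset.range Φ, w h ≤
      ((Finset.range P).filter fun v => ∀ h < Φ,
        lo h ≤ (v / ∏ h' ∈ Finset.range h, N h') % N h ∧
        (v / ∏ h' ∈ Finset.range h, N h') % N h < lo h + w h).card := by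
  induction Φ with
  | zero => intro N lo w P _; simp
  | succ Φ ih =>
    intro N lo w P hN
    set A := (Finset.range (P / N 0)).filter fun v => ∀ h < Φ,
      lo (h + 1) ≤ (v / ∏ h' ∈ Finset.range h, N (h' + 1)) % N (h + 1) ∧
      (v / ∏ h' ∈ Finset.range h, N (h' + 1)) % N (h + 1) < lo (h + 1) + w (h + 1) with hA
    have h1 := ih (fun h => N (h + 1)) (fun h => lo (h + 1)) (fun h => w (h + 1)) (P / N 0)
      (fun h hh => hN (h + 1) (by omega))
    rw [← hA, Nat.div_div_eq_div_mul] at h1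
    rw [Finset.prod_range_succ', Finset.prod_range_succ', ← mul_assoc,
      mul_comm (∏ h ∈ Finset.range Φ, N (h + 1)) (N 0)]
    refine (Nat.mul_le_mul_right _ h1).trans ?_
    rw [← Nat.card_Ico (lo 0) (lo 0 + w 0) |>.trans (by omega : _ = w 0),
      ← Finset.card_product]
    have hlt : ∀ y ∈ Finset.Ico (lo 0) (lo 0 + w 0), y < N 0 := by
      intro y hy
      have := hN 0 (by omega)
      rw [Finset.mem_Ico] at hy
      omega
    refine Finset.card_le_card_of_injOn (fun p => p.2 + N 0 * p.1) ?_ ?_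
    · rintro ⟨x, y⟩ hp
      simp only [Finset.coe_product, Set.mem_prod, Finset.mem_coe] at hp
      have hy := hlt y hp.2
      have hx := hp.1
      rw [hA, Finset.mem_filter, Finset.mem_range] at hx
      have hdiv : (y + N 0 * x) / N 0 = x := by
        rw [Nat.add_mul_div_left _ _ (by omega), Nat.div_eq_of_lt hy, zero_add]
      have hmod : (y + N 0 * x) % N 0 = y := by
        rw [Nat.add_mul_mod_self_left, Nat.mod_eq_of_lt hy]
      simp only [Finset.coe_filter, Finset.mem_range, Set.mem_ofPred_eq]
      constructor
      · have h2 : x + 1 ≤ P / N 0 := hx.1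
        have h3 := Nat.mul_le_mul_left (N 0) h2
        have h4 := Nat.mul_div_le P (N 0)
        rw [mul_add] at h3
        omega
      · intro h hh
        cases h with
        | zero =>
          have := Finset.mem_Ico.1 hp.2
          simpa [hmod] using this
        | succ h =>
          have e : (y + N 0 * x) / ∏ h' ∈ Finset.range (h + 1), N h' =
              x / ∏ h' ∈ Finset.range h, N (h' + 1) := by
            rw [Finset.prod_range_succ', mul_comm _ (N 0), ← Nat.div_div_eq_div_mul, hdiv]
          rw [e]
          exact hx.2 h (by omega)
    · rintro ⟨x, y⟩ hp ⟨x', y'⟩ hp' e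
      simp only [Finset.coe_product, Set.mem_prod, Finset.mem_coe] at hp hp'
      simp only at e
      have := index_inj (n := N 0) (h := x) (h' := x') (hlt y hp.2) (hlt y' hp'.2)
        (by rw [mul_comm x, mul_comm x']; omega)
      rw [this.1, this.2]

/-- The action `s h` is picked when the digit at `h` lies in an interval of length `W h (s h)` that
starts at the cumulative weight of the preceding actions. -/
theorem card_sample {n Φ : ℕ} [NeZero n] {W : ℕ → ℕ → ℕ} {N : ℕ → ℕ}
    (hN : ∀ h < Φ, N h = ∑ a ∈ Finset.range n, W h a) (P : ℕ) (s : Strategy n Φ) :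
    (P / ∏ h ∈ Finset.range Φ, N h) * ∏ h : Fin Φ, W h (s h) ≤
      ((Finset.range P).filter fun v => sample n Φ W N v = s).card := by
  set s' : ℕ → ℕ := fun h => if hh : h < Φ then s ⟨h, hh⟩ else 0 with hs'
  have h1 := card_digits Φ N (fun h => ∑ a ∈ Finset.range (s' h), W h a)
    (fun h => W h (s' h)) P ?_
  · have h2 : ∏ h ∈ Finset.range Φ, W h (s' h) = ∏ h : Fin Φ, W h (s h) := by
      rw [Finset.prod_range]
      simp [hs']
    rw [h2] at h1
    refine h1.trans (Finset.card_le_card fun v hv => ?_)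
    rw [Finset.mem_filter] at hv ⊢
    refine ⟨hv.1, ?_⟩
    funext h
    have h3 := hv.2 h h.2
    rw [← Finset.sum_range_succ] at h3
    have hsh : s' h = s h := by simp [hs']
    rw [sample, pick_eq (a := s' h) (by rw [hsh]; exact (s h).2) h3.1 h3.2, hsh]
    simp
  · intro h hh
    rw [← Finset.sum_range_succ, hN h hh]
    refine Finset.sum_le_sum_of_subset (Finset.range_subset_range.2 ?_)
    simp only [hs', dif_pos hh]
    exact (s ⟨h, hh⟩).2

end EFG

end

/-! ### Programs with a single toss, and what the players' program reads -/

noncomputable section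

namespace EFG

/-- The law of a program that tosses coins only once. -/
theorem exec_toss {O : Oracle} {ν e : ℕ} (hO : O.len ≤ ν) (he : e ≤ ν) {c d : Cmd} {t : Term}
    {μ : Store} (hμ : μ.Bounded ν) (hlc : c.LitLe ν) (hld : d.LitLe ν) (hlt : t.LitLe ν)
    (Q : ℕ → Store → Prop)
    (h : c.wp O ν (fun μ' => t.eval μ' = e ∧
      ∀ v < 2 ^ e, d.wp O ν (Q v) (μ'.write 10 0 v)) μ) :
    ∃ f : Fin (2 ^ e) → Store × ℕ,
      (c ;; .toss 10 (.lit 0) t ;; d).exec O μ = (PMF.uniformOfFintype (Fin (2 ^ e))).map f ∧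
      ∀ v : Fin (2 ^ e), Q v (f v).1 ∧ (f v).2 ≤ (ν + 2) ^ (c ;; .toss 10 (.lit 0) t ;; d).deg := by
  obtain ⟨μ₁, t₁, h1, ht1, ⟨rfl, hQ1⟩, hb1⟩ := c.terminates hO _ μ hlc hμ h
  have hsize : ∀ v : Fin (2 ^ t.eval μ₁), (v : ℕ).size ≤ ν := fun v =>
    (Nat.size_le.2 v.2).trans he
  have h2 : ∀ v : Fin (2 ^ t.eval μ₁), Terminates (d.exec O (μ₁.write 10 0 v)) ν
      ((ν + 2) ^ d.deg) (Q v) := fun v =>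
    d.terminates hO _ _ hld (hb1.write 10 0 (hsize v)) (hQ1 v v.2)
  choose g s hg hs hQ hb using h2
  have htc := t.cost_add_size_le hb1 hlt
  refine ⟨fun v => (g v, t₁ + ((2 + t.cost μ₁ + t.eval μ₁) + s v)), ?_, fun v => ⟨hQ v, ?_⟩⟩
  · simp only [Cmd.exec, h1, PMF.pure_bind, PMF.map_bind, PMF.bind_map]
    rw [← PMF.bind_pure_comp]
    change ((PMF.uniformOfFintype (Fin (2 ^ t.eval μ₁))).bind fun a => PMF.pure (a : ℕ)).bind _ = _
    rw [PMF.bind_bind]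
    refine congrArg _ (funext fun v => ?_)
    simp only [PMF.pure_bind, Function.comp_apply, Term.eval, hg, PMF.pure_map, Term.cost]
    congr 2
    simp
    omega
  · simp only [Cmd.deg, Term.deg]
    have hsv := hs v
    have ha : 2 + t.cost μ₁ + t.eval μ₁ ≤ (ν + 2) ^ (t.deg + 2) := by
      have : 1 ≤ (ν + 2) ^ t.deg := Nat.one_le_pow _ _ (by omega)
      rw [pow_add]
      nlinarith [Nat.mul_le_mul_right (ν * ν + 4 * ν) this]
    have hb : (ν + 2) ^ (t.deg + 2) + (ν + 2) ^ d.deg ≤ (ν + 2) ^ (t.deg + d.deg + 3) :=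
      add_two_pow_le (by omega)
    have hc : (ν + 2) ^ c.deg + (ν + 2) ^ (t.deg + d.deg + 3) ≤
        (ν + 2) ^ (c.deg + (t.deg + d.deg + 3) + 1) := add_two_pow_le le_rfl
    have hd : (ν + 2) ^ (c.deg + (t.deg + d.deg + 3) + 1) ≤
        (ν + 2) ^ (c.deg + (1 + t.deg + 5 + d.deg + 1) + 1) :=
      Nat.pow_le_pow_right (by omega) (by omega)
    omega

/-! ### The mixed strategies -/

/-- An upper bound for all numbers of loop iterations, and for the lengths of all numbers. -/
def sizeBound (m n Φ E k : ℕ) : ℕ :=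
  2 * target n Φ E + rounds n Φ E + rate n Φ E + 2 * cap n Φ E +
    days m n Φ E k * prec n Φ E + 2 ^ k + (m * Φ + 1) + Φ * n + bits n Φ E + coins n Φ E + k + 10

/-- The number of days of a round of the learner of level `j`. -/
def block (m n Φ E k j : ℕ) : ℕ := reps m n Φ E k * rounds n Φ E ^ j

namespace Game

variable {m n Φ : ℕ} [NeZero n] (G : Game m n Φ) (i : Fin m)

/-- The strategies played on day `d`. -/
def dayOf (H : List (Profile m n Φ)) (d : ℕ) : Profile m n Φ := H.getD d fun _ _ => 0

/-- The rounded payoff of the strategy that moves to `h` and plays `a` there, on day `d`. -/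
def dayVal (b : ℕ) (H : List (Profile m n Φ)) (d : ℕ) (h : Fin Φ) (a : Fin n) : ℕ :=
  ⌊(2 : ℝ) ^ b * G.u i (Function.update (dayOf H d) i ((G.forest i).path h a))⌋₊

theorem dayVal_le (b : ℕ) (H : List (Profile m n Φ)) (d : ℕ) (h : Fin Φ) (a : Fin n) :
    G.dayVal i b H d h a ≤ 2 ^ b := by
  refine Nat.floor_le_of_le ?_
  push_cast
  exact mul_le_of_le_one_right (by positivity) (G.u_mem_Icc i _).2

/-- The scores of the learner with rounds of `B` days and `M` rounds, after `t` days. -/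
def scores (b B M : ℕ) (H : List (Profile m n Φ)) (t : ℕ) (h : Fin Φ) (a : Fin n) : ℕ :=
  (∑ d ∈ Finset.range (t / B * B - t / (B * M) * (B * M)),
    G.dayVal i b H (t / (B * M) * (B * M) + d) h a) / B

/-- The days since the last restart that belong to completed rounds number `B` times the index of
the round within its run. -/
theorem block_interval (B M t : ℕ) :
    t / B * B - t / (B * M) * (B * M) = t / B % M * B := by
  rw [← Nat.div_div_eq_div_mul, mul_comm B M, ← mul_assoc, ← Nat.sub_mul, sub_div_mul_self]

theorem scores_le {b B M : ℕ} (hM : 1 ≤ M) (H : List (Profile m n Φ)) (t : ℕ)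
    (h : Fin Φ) (a : Fin n) : G.scores i b B M H t h a ≤ M * 2 ^ b := by
  rw [scores, block_interval]
  rcases Nat.eq_zero_or_pos B with rfl | hB
  · simp
  refine Nat.div_le_of_le_mul ?_
  calc _ ≤ ∑ _d ∈ Finset.range (t / B % M * B), 2 ^ b :=
        Finset.sum_le_sum fun d _ => G.dayVal_le i b H _ h a
    _ = t / B % M * B * 2 ^ b := by simp
    _ ≤ M * B * 2 ^ b := by
        gcongr
        exact (Nat.mod_lt _ hM).le
    _ = B * (M * 2 ^ b) := by ring

/-- A function on `Fin Φ × Fin n` as a table. -/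
def toTable (W : Fin Φ → Fin n → ℕ) (h a : ℕ) : ℕ :=
  if hh : h < Φ ∧ a < n then W ⟨h, hh.1⟩ ⟨a, hh.2⟩ else 0

omit [NeZero n] in
@[simp] theorem toTable_val (W : Fin Φ → Fin n → ℕ) (h : Fin Φ) (a : Fin n) :
    toTable W h a = W h a := by
  simp [toTable]

/-- The strategy that is decoded from `v`, with exponential weights for the scores `Y`. -/
def draw (L X : ℕ) (Y : Fin Φ → Fin n → ℕ) (v : ℕ) : Strategy n Φ :=
  sample n Φ (toTable ((G.forest i).expAction L X Y))
    (Forest.toArray ((G.forest i).expTotal L X Y)) v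

theorem codes (H : List (Profile m n Φ)) : (G.forest i).Codes (G.input i H 1) := by
  intro h
  have : G.input i H 1 h = G.parentCode i h := by
    simp [input]
  rw [this]
  rfl

theorem input_code_le (H : List (Profile m n Φ)) (g : ℕ) : G.input i H 1 g ≤ Φ * n := by
  by_cases hg : g < Φ
  · have := G.codes i H ⟨g, hg⟩
    simp only at this
    rw [this, Forest.codeOf]
    split
    · exact Nat.zero_le _
    · rename_i g' a _
      have h1 := g'.2
      have h2 := a.2
      calc (g' : ℕ) * n + a + 1 ≤ g' * n + n := by omega
        _ = (g' + 1) * n := by ring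
        _ ≤ Φ * n := Nat.mul_le_mul_right _ h1
  · simp [input, hg]

theorem profileCell_lt (s : Profile m n Φ) (k : ℕ) : profileCell s k < n := by
  unfold profileCell
  split_ifs with h
  · exact (s _ _).2
  · exact Nat.pos_of_ne_zero (NeZero.ne n)

theorem input_hist_le (H : List (Profile m n Φ)) (x : ℕ) : G.input i H 2 x ≤ n := by
  simp only [input]
  split
  · exact Nat.zero_le _
  · exact (profileCell_lt _ _).le

theorem input_hist (H : List (Profile m n Φ)) {d : ℕ} (hd : d < H.length) (j : Fin m)
    (h : Fin Φ) : G.input i H 2 (d * (m * Φ) + (j * Φ + h)) = dayOf H d j h := by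
  have hj := j.2
  have hh := h.2
  have hk : (j : ℕ) * Φ + h < m * Φ := by
    calc (j : ℕ) * Φ + h < j * Φ + Φ := by omega
      _ = (j + 1) * Φ := by ring
      _ ≤ m * Φ := Nat.mul_le_mul_right _ hj
  have e1 : (d * (m * Φ) + (j * Φ + h)) / (m * Φ) = d := by
    rw [mul_comm d, Nat.mul_add_div (by omega), Nat.div_eq_of_lt hk, add_zero]
  have e2 : (d * (m * Φ) + (j * Φ + h)) % (m * Φ) = j * Φ + h := by
    rw [mul_comm d, Nat.mul_add_mod, Nat.mod_eq_of_lt hk]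
  have e3 : ((j : ℕ) * Φ + h) / Φ = j := by
    rw [mul_comm, Nat.mul_add_div (by omega), Nat.div_eq_of_lt hh, add_zero]
  have e4 : ((j : ℕ) * Φ + h) % Φ = h := by
    rw [mul_comm, Nat.mul_add_mod, Nat.mod_eq_of_lt hh]
  simp only [input, e1, e2, dayOf, List.getElem?_eq_getElem hd, profileCell, e3, e4]
  simp [List.getD_eq_getElem?_getD, List.getElem?_eq_getElem hd, hj, hh]

/-- The query array of the machine holds the intended profile. -/
theorem readProfile_splice (H : List (Profile m n Φ)) {d : ℕ} (hd : d < H.length) (h : Fin Φ)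
    (a : Fin n) {q : ℕ → ℕ} (hq : ∀ k < m * Φ, q k = splice Φ i
      (pathRow n Φ (G.input i H 1) h a) (fun k => G.input i H 2 (d * (m * Φ) + k)) k) :
    readProfile m n Φ q = Function.update (dayOf H d) i ((G.forest i).path h a) := by
  funext j g
  have hj := j.2
  have hg := g.2
  have hk : (j : ℕ) * Φ + g < m * Φ := by
    calc (j : ℕ) * Φ + g < j * Φ + Φ := by omega
      _ = (j + 1) * Φ := by ring
      _ ≤ m * Φ := Nat.mul_le_mul_right _ hj
  rw [readProfile, hq _ hk, splice]
  by_cases e : j = i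
  · subst e
    rw [if_pos (by omega), Nat.add_sub_cancel_left, (G.codes j H).pathRow_eq,
      Function.update_self]
    simp
  · have hne : ¬ ((i : ℕ) * Φ ≤ j * Φ + g ∧ j * Φ + g < i * Φ + Φ) := by
      rintro ⟨h1, h2⟩
      apply e
      apply Fin.ext
      have h3 : (i : ℕ) < j + 1 := by
        by_contra hlt
        have : ((j : ℕ) + 1) * Φ ≤ i * Φ := Nat.mul_le_mul_right _ (by omega)
        rw [add_mul] at this
        omega
      have h4 : (j : ℕ) < i + 1 := by
        by_contra hlt
        have : ((i : ℕ) + 1) * Φ ≤ j * Φ := Nat.mul_le_mul_right _ (by omega)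
        rw [add_mul] at this
        omega
      omega
    rw [if_neg hne, G.input_hist i H hd, Function.update_of_ne e]
    simp

theorem oracle_answer (H : List (Profile m n Φ)) {d : ℕ} (hd : d < H.length) (b : ℕ) (h : Fin Φ)
    (a : Fin n) {q : ℕ → ℕ} (hlast : q (m * Φ) = Φ) (hq : ∀ k < m * Φ, q k = splice Φ i
      (pathRow n Φ (G.input i H 1) h a) (fun k => G.input i H 2 (d * (m * Φ) + k)) k) :
    (G.oracle i).answer q b = G.dayVal i b H d h a := by
  simp only [oracle, hlast, lt_irrefl, dif_neg, not_false_eq_true, dayVal]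
  rw [G.readProfile_splice i H hd h a hq]

end Game

end EFG

end

noncomputable section

namespace EFG

/-! ### Positivity and size of the parameters -/

section

variable {m n Φ E k : ℕ}

theorem one_le_target (hn : 1 ≤ n) (hΦ : 1 ≤ Φ) (hE : 1 ≤ E) : 48 ≤ target n Φ E := by
  have h : 1 ≤ n * Φ * E := Nat.mul_pos (Nat.mul_pos hn hΦ) hE
  have : target n Φ E = 48 * (n * Φ * E) := by rw [target]; ring
  omega

theorem one_le_bits (hn : 1 ≤ n) (hΦ : 1 ≤ Φ) (hE : 1 ≤ E) : 1 ≤ bits n Φ E := by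
  have := one_le_target hn hΦ hE
  exact Nat.clog_pos (by norm_num) (by omega)

theorem one_le_prec : 1 ≤ prec n Φ E := Nat.one_le_two_pow

theorem target_le_prec : target n Φ E ≤ prec n Φ E := Nat.le_pow_clog (by norm_num) _

theorem prec_le (hn : 1 ≤ n) (hΦ : 1 ≤ Φ) (hE : 1 ≤ E) : prec n Φ E ≤ 2 * target n Φ E := by
  have h1 := one_le_bits hn hΦ hE
  have h2 : 2 ^ (bits n Φ E - 1) < target n Φ E :=
    (Nat.lt_clog_iff_pow_lt (by norm_num)).1 (by rw [bits] at h1 ⊢; omega)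
  have h3 : prec n Φ E = 2 ^ (bits n Φ E - 1) * 2 := by
    rw [prec, ← pow_succ, Nat.sub_add_cancel h1]
  omega

theorem le_rounds (hn : 1 ≤ n) (hΦ : 1 ≤ Φ) (hE : 1 ≤ E) : 512 * (E * E) ≤ rounds n Φ E := by
  rw [rounds, mul_assoc]
  exact Nat.le_mul_of_pos_right _ (Nat.mul_pos hΦ (one_le_bits hn hΦ hE))

theorem one_le_rounds (hn : 1 ≤ n) (hΦ : 1 ≤ Φ) (hE : 1 ≤ E) : 1 ≤ rounds n Φ E :=
  le_trans (by nlinarith) (le_rounds hn hΦ hE)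

theorem le_rate : 32 * E ≤ rate n Φ E := Nat.le_mul_of_pos_right _ one_le_prec

theorem le_reps (hm : 1 ≤ m) (hn : 1 ≤ n) (hΦ : 1 ≤ Φ) (hE : 1 ≤ E) :
    5120 * (E * E) * 2 ^ k ≤ reps m n Φ E k := by
  rw [reps]
  simp only [mul_assoc]
  have h : 1 ≤ m * (n * (Φ * rounds n Φ E)) :=
    Nat.mul_pos hm (Nat.mul_pos hn (Nat.mul_pos hΦ (one_le_rounds hn hΦ hE)))
  calc 5120 * (E * (E * 2 ^ k)) ≤ 5120 * (E * (E * 2 ^ k)) * (m * (n * (Φ * rounds n Φ E))) :=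
        Nat.le_mul_of_pos_right _ h
    _ = _ := by ring

theorem reps_le_days (hn : 1 ≤ n) (hΦ : 1 ≤ Φ) (hE : 1 ≤ E) :
    reps m n Φ E k ≤ days m n Φ E k :=
  Nat.le_mul_of_pos_right _ (Nat.pow_pos (one_le_rounds hn hΦ hE))

theorem days_le_sizeBound : days m n Φ E k * prec n Φ E ≤ sizeBound m n Φ E k := by
  have := Nat.two_pow_pos k
  unfold sizeBound
  omega

theorem sum_le_sizeBound (m n Φ E k : ℕ) :
    2 * target n Φ E + rounds n Φ E + rate n Φ E + 2 * cap n Φ E + 2 ^ k + m * Φ + Φ * n +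
      bits n Φ E + coins n Φ E + k + 11 ≤ sizeBound m n Φ E k := by
  unfold sizeBound
  omega

theorem days_le_sizeBound' : days m n Φ E k ≤ sizeBound m n Φ E k :=
  (Nat.le_mul_of_pos_right _ one_le_prec).trans days_le_sizeBound

theorem litLe_player (hm : 1 ≤ m) (hn : 1 ≤ n) (hΦ : 1 ≤ Φ) (hE : 1 ≤ E) :
    (playerCmd E k).LitLe (sizeBound m n Φ E k) := by
  have h1 := one_le_target hn hΦ hE
  have h2 := le_rounds hn hΦ hE
  have h3 := le_rate (n := n) (Φ := Φ) (E := E)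
  have h4 := (le_reps (m := m) (k := k) hm hn hΦ hE).trans ((reps_le_days hn hΦ hE).trans
    days_le_sizeBound')
  have h5 := sum_le_sizeBound m n Φ E k
  have h2k := Nat.two_pow_pos k
  have a0 : (0 : ℕ).size ≤ sizeBound m n Φ E k := size_le_of_le (by omega)
  have a1 : (1 : ℕ).size ≤ sizeBound m n Φ E k := size_le_of_le (by omega)
  have a2 : (2 : ℕ).size ≤ sizeBound m n Φ E k := size_le_of_le (by omega)
  have a3 : (3 : ℕ).size ≤ sizeBound m n Φ E k := size_le_of_le (by omega)
  have a4 : (4 : ℕ).size ≤ sizeBound m n Φ E k := size_le_of_le (by omega)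
  have b1 : (48 : ℕ).size ≤ sizeBound m n Φ E k := size_le_of_le (by omega)
  have b2 : E.size ≤ sizeBound m n Φ E k := size_le_of_le (by omega)
  have b3 : (512 * (E * E)).size ≤ sizeBound m n Φ E k := size_le_of_le (by omega)
  have b4 : (32 * E).size ≤ sizeBound m n Φ E k := size_le_of_le (by omega)
  have b5 : (5120 * (E * E) * 2 ^ k).size ≤ sizeBound m n Φ E k := size_le_of_le h4
  have b6 : (2 ^ k).size ≤ sizeBound m n Φ E k := size_le_of_le (by omega)
  have b7 : k.size ≤ sizeBound m n Φ E k := size_le_of_le (by omega)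
  simp only [playerCmd, setup, decideCmd, scoresCmd, scoreCmd, loadCmd, passesCmd, updateCmd,
    sampleCmd, Cmd.assign, Term.var, Cmd.skip, Term.ne, Cmd.LitLe, Term.LitLe,
    a0, a1, a2, a3, a4, b1, b2, b3, b4, b5, b6, b7, and_self]

theorem litLe_horizon (hm : 1 ≤ m) (hn : 1 ≤ n) (hΦ : 1 ≤ Φ) (hE : 1 ≤ E) :
    (horizonCmd E k).LitLe (sizeBound m n Φ E k) := by
  have h := (litLe_player (k := k) hm hn hΦ hE).1.1
  have h5 := sum_le_sizeBound m n Φ E k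
  have h2k := Nat.two_pow_pos k
  have a0 : (0 : ℕ).size ≤ sizeBound m n Φ E k := size_le_of_le (by omega)
  have b6 : (2 ^ k).size ≤ sizeBound m n Φ E k := size_le_of_le (by omega)
  simp only [horizonCmd, Cmd.assign, Term.var, Cmd.LitLe, Term.LitLe, h, a0, b6, and_self]

/-- The degree of the polynomial that bounds the cost of the programs. -/
def degree : ℕ := (playerCmd 0 0).deg + (horizonCmd 0 0).deg

/-- A literal has degree 1 whatever its value, so `E` and `k` disappear when the degree is computed.
This keeps the exponent of the cost polynomial independent of the accuracy. -/
theorem deg_player_le : (playerCmd E k).deg ≤ degree := Nat.le_add_right (playerCmd 0 0).deg _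

theorem deg_horizon_le : (horizonCmd E k).deg ≤ degree := Nat.le_add_left (horizonCmd 0 0).deg _

theorem pick_congr {W W' : ℕ → ℕ} (h : ∀ a < n, W a = W' a) (y : ℕ) :
    pick n W y = pick n W' y := by
  unfold pick
  congr 1
  refine Finset.filter_congr fun a ha => ?_
  rw [Finset.mem_range] at ha
  rw [Finset.sum_congr rfl fun b hb => h b (by rw [Finset.mem_range] at hb; omega)]

end

/-! ### The program computes the exponential weights -/

namespace Game

variable {m n Φ : ℕ} [NeZero n] (G : Game m n Φ) (i : Fin m) (E k : ℕ)

/-- `dayVal`, with natural numbers for the information set and the action. -/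
def dayTable (b : ℕ) (H : List (Profile m n Φ)) (d h a : ℕ) : ℕ :=
  toTable (fun h a => G.dayVal i b H d h a) h a

theorem dayTable_le (b : ℕ) (H : List (Profile m n Φ)) (d h a : ℕ) :
    G.dayTable i b H d h a ≤ 2 ^ b := by
  unfold dayTable toTable
  split_ifs
  · exact G.dayVal_le i b H d _ _
  · exact Nat.zero_le _

/-- What the program reads after it has drawn the level `j`. -/
def data (H : List (Profile m n Φ)) (j : ℕ) : Data where
  m := m
  n := n
  Φ := Φ
  i := i
  code := G.input i H 1
  hist := G.input i H 2
  b := bits n Φ E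
  L := rate n Φ E
  X := cap n Φ E
  B := block m n Φ E k j
  start := H.length / (block m n Φ E k j * rounds n Φ E) * (block m n Φ E k j * rounds n Φ E)
  len := H.length / block m n Φ E k j * block m n Φ E k j -
    H.length / (block m n Φ E k j * rounds n Φ E) * (block m n Φ E k j * rounds n Φ E)

theorem data_score (H : List (Profile m n Φ)) (j : ℕ) (h : Fin Φ) (a : Fin n) :
    (G.data i E k H j).score (G.dayTable i (bits n Φ E) H) h a =
      G.scores i (bits n Φ E) (block m n Φ E k j) (rounds n Φ E) H H.length h a := by
  simp [Data.score, data, scores, dayTable]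

variable {E k}

theorem data_fits (hE : 1 ≤ E) (hΦ : 1 ≤ Φ) {H : List (Profile m n Φ)}
    (hH : H.length ≤ days m n Φ E k) (j : ℕ) :
    (G.data i E k H j).Fits (G.oracle i) (sizeBound m n Φ E k)
      (G.dayTable i (bits n Φ E) H) := by
  have hn : 1 ≤ n := Nat.one_le_iff_ne_zero.2 (NeZero.ne n)
  have hm : 1 ≤ m := by have := i.2; omega
  have hs := sum_le_sizeBound m n Φ E k
  have h2k := Nat.two_pow_pos k
  have hlen : (G.data i E k H j).len ≤ days m n Φ E k :=
    ((Nat.sub_le _ _).trans (Nat.div_mul_le_self _ _)).trans hH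
  refine ⟨hm, hn, i.2, G.input_code_le i H, fun x => ?_, ?_, ?_, ?_, ?_, fun d h a => ?_,
    fun l hl h a => ?_, ?_⟩
  · refine size_le_of_le ((G.input_hist_le i H x).trans ?_)
    have : n ≤ Φ * n := Nat.le_mul_of_pos_left _ hΦ
    omega
  · change m * Φ ≤ _; omega
  · change Φ * n ≤ _; omega
  · change bits n Φ E ≤ _; omega
  · exact hlen.trans days_le_sizeBound'
  · have := prec_le hn hΦ hE
    have h2 : G.dayTable i (bits n Φ E) H d h a ≤ prec n Φ E := G.dayTable_le i _ H d h a
    omega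
  · calc _ ≤ ∑ _d ∈ Finset.range l, 2 ^ bits n Φ E :=
          Finset.sum_le_sum fun d _ => G.dayTable_le i _ H _ h a
      _ = l * prec n Φ E := by simp [prec]
      _ ≤ days m n Φ E k * prec n Φ E := Nat.mul_le_mul_right _ (hl.trans hlen)
      _ ≤ _ := days_le_sizeBound
  · intro d hd h hh a ha q hlast hq
    have hd' : d < H.length := by
      refine lt_of_lt_of_le hd ?_
      rw [data]
      simp only
      have h1 : H.length / (block m n Φ E k j * rounds n Φ E) *
          (block m n Φ E k j * rounds n Φ E) ≤ H.length := Nat.div_mul_le_self _ _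
      have h2 := Nat.div_mul_le_self H.length (block m n Φ E k j)
      omega
    have := G.oracle_answer i H hd' (bits n Φ E) ⟨h, hh⟩ ⟨a, ha⟩ hlast hq
    rw [dayTable, toTable, dif_pos ⟨hh, ha⟩]
    exact this

theorem scores_le_cap (hE : 1 ≤ E) (hΦ : 1 ≤ Φ) (H : List (Profile m n Φ)) (B t : ℕ) (h : Fin Φ)
    (a : Fin n) : G.scores i (bits n Φ E) B (rounds n Φ E) H t h a ≤ cap n Φ E :=
  G.scores_le i (one_le_rounds (Nat.one_le_iff_ne_zero.2 (NeZero.ne n)) hΦ hE) H t h a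

theorem one_le_rate (n Φ : ℕ) {E : ℕ} (hE : 1 ≤ E) : 2 ≤ rate n Φ E :=
  le_trans (by omega) le_rate

theorem data_solves (hE : 1 ≤ E) (hΦ : 1 ≤ Φ) (H : List (Profile m n Φ)) (j : ℕ) :
    (G.data i E k H j).Solves (sizeBound m n Φ E k)
      ((rate n Φ E * (rate n Φ E + 1)) ^ cap n Φ E)
      ((G.data i E k H j).score (G.dayTable i (bits n Φ E) H))
      (Forest.toArray ((G.forest i).expTotal (rate n Φ E) (cap n Φ E)
        (G.scores i (bits n Φ E) (block m n Φ E k j) (rounds n Φ E) H H.length)))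
      (Forest.toArray ((G.forest i).totalD (Forest.expBase (rate n Φ E) (cap n Φ E)))) := by
  have hn : 1 ≤ n := Nat.one_le_iff_ne_zero.2 (NeZero.ne n)
  have hL : 1 ≤ rate n Φ E := by have := one_le_rate n Φ hE; omega
  have hY := G.scores_le_cap i hE hΦ H (block m n Φ E k j) H.length
  have hcoins : (n + 2 * cap n Φ E * rate n Φ E) * Φ ≤ sizeBound m n Φ E k := by
    have : (n + 2 * cap n Φ E * rate n Φ E) * Φ ≤ coins n Φ E := by
      rw [coins]
      refine le_add_right (Nat.mul_le_mul_left _ ?_)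
      exact Nat.le_mul_self Φ
    have := sum_le_sizeBound m n Φ E k
    have := Nat.two_pow_pos k
    omega
  have hw : ∀ (h : Fin Φ) (a : Fin n), weight (rate n Φ E) (cap n Φ E)
      ((G.data i E k H j).score (G.dayTable i (bits n Φ E) H) h a)
      ((G.data i E k H j).score (G.dayTable i (bits n Φ E) H) h 0) =
      Forest.expWeight (rate n Φ E) (cap n Φ E)
        (G.scores i (bits n Φ E) (block m n Φ E k j) (rounds n Φ E) H H.length) h a := by
    intro h a
    have := G.data_score i E k H j h 0
    rw [Fin.val_zero] at this
    rw [Forest.expWeight, data_score, this]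
  have hs := sum_le_sizeBound m n Φ E k
  have h2k := Nat.two_pow_pos k
  refine ⟨fun h hh => ?_, fun h hh => ?_, ?_, hL, hn, fun h hh => ?_, fun h hh => ?_,
    fun h hh => ?_, fun h hh => ?_, fun h hh a ha => ?_, ?_, hΦ, ?_, ?_⟩
  · exact (Forest.toArray_val _ ⟨h, hh⟩).trans
      (Forest.Codes.nextD_eq (G.codes i H) ⟨h, hh⟩).symm
  · exact (Forest.toArray_val _ ⟨h, hh⟩).trans
      (Forest.Codes.nextN_eq (G.codes i H) hw ⟨h, hh⟩).symm
  · exact Forest.one_le_expBase hL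
  · obtain ⟨h, rfl⟩ : ∃ g : Fin Φ, (g : ℕ) = h := ⟨⟨h, hh⟩, rfl⟩
    rw [Forest.toArray_val]
    exact Forest.totalD_pos (Forest.one_le_expBase hL) _
  · obtain ⟨h, rfl⟩ : ∃ g : Fin Φ, (g : ℕ) = h := ⟨⟨h, hh⟩, rfl⟩
    rw [Forest.toArray_val]
    exact Forest.expTotal_pos hL _
  · obtain ⟨h, rfl⟩ : ∃ g : Fin Φ, (g : ℕ) = h := ⟨⟨h, hh⟩, rfl⟩
    rw [Forest.toArray_val]
    exact (Nat.size_le.2 (Forest.totalD_lt hL hΦ _)).trans hcoins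
  · obtain ⟨h, rfl⟩ : ∃ g : Fin Φ, (g : ℕ) = h := ⟨⟨h, hh⟩, rfl⟩
    rw [Forest.toArray_val]
    exact (Nat.size_le.2 (Forest.expTotal_lt hL hΦ hY _)).trans hcoins
  · rw [G.data_score i E k H j ⟨h, hh⟩ ⟨a, ha⟩]
    exact hY _ _
  · change 2 * cap n Φ E ≤ _
    omega
  · change Φ ≤ _
    have : Φ ≤ Φ * n := Nat.le_mul_of_pos_right _ hn
    omega
  · change n ≤ _
    have : n ≤ Φ * n := Nat.le_mul_of_pos_left _ hΦ
    omega

theorem input_bounded (hΦ : 1 ≤ Φ) {H : List (Profile m n Φ)}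
    (hH : H.length ≤ days m n Φ E k) : (G.input i H).Bounded (sizeBound m n Φ E k) := by
  have hn : 1 ≤ n := Nat.one_le_iff_ne_zero.2 (NeZero.ne n)
  have hs := sum_le_sizeBound m n Φ E k
  have h2k := Nat.two_pow_pos k
  have h1 : n ≤ Φ * n := Nat.le_mul_of_pos_left _ hΦ
  have h2 : Φ ≤ Φ * n := Nat.le_mul_of_pos_right _ hn
  have h3 : m ≤ m * Φ := Nat.le_mul_of_pos_right _ hΦ
  have h4 := days_le_sizeBound' (m := m) (n := n) (Φ := Φ) (E := E) (k := k)
  have h5 := i.2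
  intro a x
  refine size_le_of_le ?_
  match a with
  | 0 =>
    match x with
    | 0 => simp only [input, List.getD_cons_zero]; omega
    | 1 => simp only [input, List.getD_cons_zero, List.getD_cons_succ]; omega
    | 2 => simp only [input, List.getD_cons_zero, List.getD_cons_succ]; omega
    | 3 => simp only [input, List.getD_cons_zero, List.getD_cons_succ]; omega
    | 4 => simp only [input, List.getD_cons_zero, List.getD_cons_succ]; omega
    | x + 5 => simp [input]
  | 1 => exact (G.input_code_le i H x).trans (by omega)
  | 2 => exact (G.input_hist_le i H x).trans (by omega)
  | a + 3 => simp [input]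

/-- Number of days, level, and coins determine the strategy. -/
def play (E k : ℕ) (H : List (Profile m n Φ)) (j v : ℕ) : Strategy n Φ :=
  G.draw i (rate n Φ E) (cap n Φ E)
    (G.scores i (bits n Φ E) (block m n Φ E k j) (rounds n Φ E) H H.length) v

theorem player_exec (hE : 1 ≤ E) (hΦ : 1 ≤ Φ) {H : List (Profile m n Φ)}
    (hH : H.length ≤ days m n Φ E k) : ∃ f : Fin (2 ^ (k + coins n Φ E)) → Store × ℕ,
      (playerCmd E k).exec (G.oracle i) (G.input i H) =
        (PMF.uniformOfFintype (Fin (2 ^ (k + coins n Φ E)))).map f ∧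
      ∀ v, (∀ h : Fin Φ, Fin.ofNat n ((f v).1 3 h) = G.play i E k H (v % 2 ^ k) (v / 2 ^ k) h) ∧
        (f v).2 ≤ (sizeBound m n Φ E k + 2) ^ degree := by
  have hn : 1 ≤ n := Nat.one_le_iff_ne_zero.2 (NeZero.ne n)
  have hm : 1 ≤ m := by have := i.2; omega
  have hs := sum_le_sizeBound m n Φ E k
  have h2k := Nat.two_pow_pos k
  have hlit := litLe_player (k := k) hm hn hΦ hE
  have ht := one_le_target hn hΦ hE
  have hdays := days_le_sizeBound' (m := m) (n := n) (Φ := Φ) (E := E) (k := k)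
  obtain ⟨f, hf, hQ⟩ := exec_toss (O := G.oracle i) (ν := sizeBound m n Φ E k)
    (e := k + coins n Φ E) (c := setup E k ;; .assign 36 (.lit k +ₜ
      ((.get 0 (.lit 1) +ₜ .lit 2 *ₜ .var 8 *ₜ .var 7) *ₜ
      (.get 0 (.lit 2) *ₜ .get 0 (.lit 2)) +ₜ .var 7))) (d := decideCmd k) (t := .var 36)
    (μ := G.input i H) (by change m * Φ + 1 ≤ _; omega) (by omega)
    (G.input_bounded i hΦ hH) hlit.1 hlit.2.2 hlit.2.1.2
    (fun v μ => ∀ h : Fin Φ, Fin.ofNat n (μ 3 h) = G.play i E k H (v % 2 ^ k) (v / 2 ^ k) h) (by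
      rw [wp_seq]
      refine setup_wp (m := m) (n := n) (Φ := Φ) rfl rfl rfl (by omega) (by omega) (by omega)
        (by omega) (by omega) ((reps_le_days hn hΦ hE).trans hdays) ?_
      intro μ₁ hoff h4 h5 h6 h7 h8 h9
      have i0 : μ₁ 0 0 = m := congrFun (hoff 0 (by decide)) 0
      have i1 : μ₁ 0 1 = n := congrFun (hoff 0 (by decide)) 1
      have i2 : μ₁ 0 2 = Φ := congrFun (hoff 0 (by decide)) 2
      have i3 : μ₁ 0 3 = i := congrFun (hoff 0 (by decide)) 3
      have i4 : μ₁ 0 4 = H.length := congrFun (hoff 0 (by decide)) 4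
      have j1 : μ₁ 1 = G.input i H 1 := hoff 1 (by decide)
      have j2 : μ₁ 2 = G.input i H 2 := hoff 2 (by decide)
      have j26 : ∀ x, μ₁ 26 x = 0 := congrFun (hoff 26 (by decide))
      have j27 : ∀ x, μ₁ 27 x = 0 := congrFun (hoff 27 (by decide))
      have he : k + ((n + 2 * cap n Φ E * rate n Φ E) * (Φ * Φ) + rate n Φ E) =
          k + coins n Φ E := rfl
      simp only [wp_set, Term.eval, Op.apply, Store.write_apply, i1, i2, h7, h8, he]
      refine ⟨size_le_of_le (by omega), by simp, ?_⟩
      intro v hv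
      have j1' : ((μ₁.write 36 0 (k + coins n Φ E)).write 10 0 v) 1 =
          (G.data i E k H (v % 2 ^ k)).code := by
        funext x
        simp [j1, data]
      have j2' : ((μ₁.write 36 0 (k + coins n Φ E)).write 10 0 v) 2 =
          (G.data i E k H (v % 2 ^ k)).hist := by
        funext x
        simp [j2, data]
      have i0' : μ₁ 0 0 = (G.data i E k H (v % 2 ^ k)).m := i0
      have i1' : μ₁ 0 1 = (G.data i E k H (v % 2 ^ k)).n := i1
      have i2' : μ₁ 0 2 = (G.data i E k H (v % 2 ^ k)).Φ := i2
      have i3' : μ₁ 0 3 = (G.data i E k H (v % 2 ^ k)).i := i3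
      have h5' : μ₁ 5 0 = (G.data i E k H (v % 2 ^ k)).b := h5
      have h7' : μ₁ 7 0 = (G.data i E k H (v % 2 ^ k)).L := h7
      have h8' : μ₁ 8 0 = (G.data i E k H (v % 2 ^ k)).X := h8
      refine decideCmd_wp (c := G.data i E k H (v % 2 ^ k)) (t := H.length) (v := v)
        (M := rounds n Φ E) (R := reps m n Φ E k)
        (dep := Forest.toArray (G.forest i).dep) (by simpa using i0') (by simpa using i1')
        (by simpa using i2') (by simpa using i3') (by simpa using i4)
        j1' j2' (by simpa using h5') (by simpa using h6)
        (by simpa using h7') (by simpa using h8') (by simpa using h9) (by simp)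
        (by simpa using j26) (by simpa using j27) rfl rfl rfl
        (G.data_fits i hE hΦ hH _) (G.data_solves i hE hΦ H _) ?_ ?_ (hH.trans hdays)
        ((Nat.size_le.2 hv).trans (by omega)) (by omega) (one_le_rounds hn hΦ hE) hdays ?_
      · intro h' hh' hne
        have hc : G.input i H 1 h' = _ := G.codes i H ⟨h', hh'⟩
        obtain ⟨g, a, hga⟩ : ∃ g a, (G.forest i).par ⟨h', hh'⟩ = some (g, a) := by
          cases hp : (G.forest i).par ⟨h', hh'⟩ with
          | none =>
            refine absurd ?_ hne
            change G.input i H 1 h' = 0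
            rw [hc, Forest.par_eq_none.1 hp]
            rfl
          | some p => exact ⟨p.1, p.2, rfl⟩
        have hd := Forest.dep_of_par hga
        have hcode : (G.data i E k H (v % 2 ^ k)).code h' = (g : ℕ) * n + a + 1 :=
          (Forest.Codes.eq_iff (G.codes i H) (h' := ⟨h', hh'⟩)).2 hga
        rw [hcode]
        change Forest.toArray (G.forest i).dep (((g : ℕ) * n + a + 1 - 1) / n) < _
        have h' := Forest.toArray_val (G.forest i).dep ⟨h', hh'⟩
        simp only at h'
        rw [Forest.codeOf_div, Forest.toArray_val, h']
        omega
      · intro h hh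
        obtain ⟨h, rfl⟩ : ∃ g : Fin Φ, (g : ℕ) = h := ⟨⟨h, hh⟩, rfl⟩
        rw [Forest.toArray_val]
        exact (G.forest i).dep_lt _
      · intro μ' hμ' h
        rw [hμ' h h.2, play, draw, sample]
        congr 1
        refine pick_congr (fun a ha => ?_) _
        obtain ⟨a, rfl⟩ : ∃ b : Fin n, (b : ℕ) = a := ⟨⟨a, ha⟩, rfl⟩
        rw [toTable_val]
        refine Forest.Codes.nextW_eq (G.codes i H) (fun h a => ?_) h a
        have := G.data_score i E k H (v % 2 ^ k) h 0
        rw [Fin.val_zero] at this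
        rw [Forest.expWeight, data_score, this]
        rfl)
  refine ⟨f, hf, fun v => ⟨(hQ v).1, (hQ v).2.trans ?_⟩⟩
  exact Nat.pow_le_pow_right (by omega) (deg_player_le (E := E) (k := k))

end Game

theorem horizon_exec {m n Φ E k : ℕ} (hm : 1 ≤ m) (hn : 1 ≤ n) (hE : 1 ≤ E) (hΦ : 1 ≤ Φ) :
    ∃ (μ : Store) (t : ℕ), (horizonCmd E k).exec ⟨0, fun _ _ => 0⟩
        (fun a k => if a = 0 then [m, n, Φ].getD k 0 else 0) = PMF.pure (μ, t) ∧
      μ 3 0 = days m n Φ E k ∧ t ≤ (sizeBound m n Φ E k + 2) ^ degree := by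
  have hs := sum_le_sizeBound m n Φ E k
  have h2k := Nat.two_pow_pos k
  have ht := one_le_target hn hΦ hE
  have h1 : n ≤ Φ * n := Nat.le_mul_of_pos_left _ hΦ
  have h2 : Φ ≤ Φ * n := Nat.le_mul_of_pos_right _ hn
  have h3 : m ≤ m * Φ := Nat.le_mul_of_pos_right _ hΦ
  obtain ⟨μ, t, h, ht, hμ, -⟩ := (horizonCmd E k).terminates
    (O := ⟨0, fun _ _ => 0⟩) (ν := sizeBound m n Φ E k) (Nat.zero_le _) _
    (fun a k => if a = 0 then [m, n, Φ].getD k 0 else 0) (litLe_horizon hm hn hΦ hE) (by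
      intro a x
      refine size_le_of_le ?_
      by_cases ha : a = 0
      · simp only [ha, if_true]
        match x with
        | 0 => simp only [List.getD_cons_zero]; omega
        | 1 => simp only [List.getD_cons_zero, List.getD_cons_succ]; omega
        | 2 => simp only [List.getD_cons_zero, List.getD_cons_succ]; omega
        | x + 3 => simp
      · simp [ha])
    (horizonCmd_wp (m := m) (n := n) (Φ := Φ) rfl rfl rfl (by omega) (by omega) (by omega)
      (by omega) (by omega) days_le_sizeBound' (by omega) (one_le_rounds hn hΦ hE))
  exact ⟨μ, t, h, hμ, ht.trans (Nat.pow_le_pow_right (by omega) (deg_horizon_le (E := E) (k := k)))⟩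

end EFG

end

noncomputable section

namespace EFG

/-! ### The mixed strategies of the dynamics -/

theorem toReal_map_uniform {α : Type*} {N : ℕ} [NeZero N] [DecidableEq α] (g : Fin N → α)
    (s : α) : ((PMF.uniformOfFintype (Fin N)).map g s).toReal =
      (Finset.univ.filter fun v => g v = s).card / (N : ℝ) := by
  rw [PMF.map_apply, tsum_fintype]
  simp only [PMF.uniformOfFintype_apply, Fintype.card_fin]
  rw [← Finset.sum_filter, Finset.sum_const, nsmul_eq_mul, ENNReal.toReal_mul,
    ENNReal.toReal_natCast, ENNReal.toReal_inv, ENNReal.toReal_natCast, div_eq_mul_inv]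
  simp only [eq_comm]

theorem sum_range_divMod {M : Type*} [AddCommMonoid M] {K N : ℕ} (hK : 0 < K)
    (f : ℕ → ℕ → M) : ∑ v ∈ Finset.range (K * N), f (v % K) (v / K) =
      ∑ j ∈ Finset.range K, ∑ w ∈ Finset.range N, f j w := by
  rw [← Finset.sum_product']
  refine Finset.sum_nbij' (fun v => (v % K, v / K)) (fun p => p.1 + K * p.2) ?_ ?_ ?_ ?_ ?_
  · intro v hv
    simp only [Finset.mem_range, Finset.mem_product] at hv ⊢
    exact ⟨Nat.mod_lt _ hK, Nat.div_lt_of_lt_mul hv⟩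
  · rintro ⟨j, w⟩ hp
    simp only [Finset.mem_range, Finset.mem_product] at hp ⊢
    calc j + K * w < K * (w + 1) := by rw [mul_add]; omega
      _ ≤ K * N := Nat.mul_le_mul_left _ hp.2
  · intro v _
    exact Nat.mod_add_div v K
  · rintro ⟨j, w⟩ hp
    simp only [Finset.mem_range, Finset.mem_product] at hp ⊢
    rw [Nat.add_mul_mod_self_left, Nat.mod_eq_of_lt hp.1, Nat.add_mul_div_left _ _ hK,
      Nat.div_eq_of_lt hp.1, zero_add]
  · intro v _
    rfl

namespace Game

variable {m n Φ : ℕ} [NeZero n] (G : Game m n Φ) (i : Fin m) (E k : ℕ)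

/-- The mixed strategy of the learner of level `j` after the history `H`. -/
def law (H : List (Profile m n Φ)) (j : ℕ) (s : Strategy n Φ) : ℝ :=
  ((Finset.range (2 ^ coins n Φ E)).filter fun v => G.play i E k H j v = s).card /
    2 ^ coins n Φ E

theorem law_nonneg (H : List (Profile m n Φ)) (j : ℕ) (s : Strategy n Φ) :
    0 ≤ G.law i E k H j s := by
  unfold law
  positivity

theorem sum_law (H : List (Profile m n Φ)) (j : ℕ) : ∑ s, G.law i E k H j s = 1 := by
  simp only [law]
  rw [← Finset.sum_div, ← Nat.cast_sum,
    ← Finset.card_eq_sum_card_fiberwise (fun _ _ => Finset.mem_coe.2 (Finset.mem_univ _)),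
    Finset.card_range]
  push_cast
  exact div_self (by positivity)

variable {E k}

/-- The exponential weights, up to the sampling error. -/
theorem le_law (hE : 1 ≤ E) (hΦ : 1 ≤ Φ) (H : List (Profile m n Φ)) (j : ℕ)
    (s : Strategy n Φ) : (1 - 1 / (rate n Φ E : ℝ)) * ∏ h,
      ((G.forest i).expAction (rate n Φ E) (cap n Φ E)
        (G.scores i (bits n Φ E) (block m n Φ E k j) (rounds n Φ E) H H.length) h (s h) : ℝ) /
      (G.forest i).expTotal (rate n Φ E) (cap n Φ E)
        (G.scores i (bits n Φ E) (block m n Φ E k j) (rounds n Φ E) H H.length) h ≤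
      G.law i E k H j s := by
  set Y := G.scores i (bits n Φ E) (block m n Φ E k j) (rounds n Φ E) H H.length with hY
  set L := rate n Φ E with hL
  set X := cap n Φ E with hX
  have hL1 : 1 ≤ L := by have := one_le_rate n Φ hE; omega
  have hYX : ∀ h a, Y h a ≤ X := G.scores_le_cap i hE hΦ H _ _
  set W : Fin Φ → Fin n → ℕ := (G.forest i).expAction L X Y with hW
  set N : Fin Φ → ℕ := (G.forest i).expTotal L X Y with hN
  have hN1 : ∀ h, 1 ≤ N h := Forest.expTotal_pos hL1
  have hcard := card_sample (n := n) (Φ := Φ) (W := toTable W) (N := Forest.toArray N) (by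
    intro h hh
    obtain ⟨h, rfl⟩ : ∃ g : Fin Φ, (g : ℕ) = h := ⟨⟨h, hh⟩, rfl⟩
    rw [Forest.toArray_val, hN, Forest.expTotal_eq, Finset.sum_range]
    simp [W]) (2 ^ coins n Φ E) s
  simp only [toTable_val] at hcard
  have hprod : ∏ h ∈ Finset.range Φ, Forest.toArray N h = ∏ h, N h := by
    rw [Finset.prod_range]
    simp
  rw [hprod] at hcard
  have hP0 : (0 : ℝ) < ∏ h, (N h : ℝ) :=
    Finset.prod_pos fun h _ => by exact_mod_cast hN1 h
  -- There are at least `L` complete periods of the mixed radix system among the random numbers.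
  -- Discarding the incomplete one then costs at most the fraction `1 / L`.
  have hsmall : (L : ℝ) * ∏ h, (N h : ℝ) ≤ 2 ^ coins n Φ E := by
    have h1 : ∏ h, N h ≤ 2 ^ ((n + 2 * X * L) * (Φ * Φ)) := by
      calc ∏ h, N h ≤ ∏ _h : Fin Φ, 2 ^ ((n + 2 * X * L) * Φ) :=
            Finset.prod_le_prod' fun h _ => (Forest.expTotal_lt hL1 hΦ hYX h).le
        _ = _ := by
            rw [Finset.prod_const, Finset.card_univ, Fintype.card_fin, ← pow_mul, mul_assoc]
    have h2 : L ≤ 2 ^ L := Nat.lt_two_pow_self.le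
    have h3 : L * ∏ h, N h ≤ 2 ^ coins n Φ E := by
      calc L * ∏ h, N h ≤ 2 ^ L * 2 ^ ((n + 2 * X * L) * (Φ * Φ)) := Nat.mul_le_mul h2 h1
        _ = _ := by rw [← pow_add, coins, add_comm]
    exact_mod_cast h3
  have hfloor : (2 : ℝ) ^ coins n Φ E / ∏ h, (N h : ℝ) - 1 ≤
      ((2 ^ coins n Φ E / ∏ h, N h : ℕ) : ℝ) := by
    have h := Nat.lt_div_mul_add (a := 2 ^ coins n Φ E) (b := ∏ h, N h)
      (Finset.prod_pos fun h _ => hN1 h)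
    have h' : (2 : ℝ) ^ coins n Φ E ≤
        ((2 ^ coins n Φ E / ∏ h, N h : ℕ) : ℝ) * ∏ h, (N h : ℝ) + ∏ h, (N h : ℝ) := by
      exact_mod_cast h.le
    rw [sub_le_iff_le_add, div_le_iff₀ hP0]
    linarith
  have hL0 : (0 : ℝ) < L := by exact_mod_cast hL1
  have hlaw : G.law i E k H j s = ((Finset.range (2 ^ coins n Φ E)).filter fun v =>
      sample n Φ (toTable W) (Forest.toArray N) v = s).card / 2 ^ coins n Φ E := rfl
  have hP : (0 : ℝ) < 2 ^ coins n Φ E := by positivity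
  rw [hlaw, le_div_iff₀ hP, Finset.prod_div_distrib]
  have hW0 : (0 : ℝ) ≤ ∏ h, (W h (s h) : ℝ) := Finset.prod_nonneg fun h _ => Nat.cast_nonneg _
  calc (1 - 1 / (L : ℝ)) * ((∏ h, (W h (s h) : ℝ)) / ∏ h, (N h : ℝ)) * 2 ^ coins n Φ E
      = (2 ^ coins n Φ E / (∏ h, (N h : ℝ)) - 2 ^ coins n Φ E / (L * ∏ h, (N h : ℝ))) *
          ∏ h, (W h (s h) : ℝ) := by
        field_simp
    _ ≤ (2 ^ coins n Φ E / (∏ h, (N h : ℝ)) - 1) * ∏ h, (W h (s h) : ℝ) := by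
        refine mul_le_mul_of_nonneg_right ?_ hW0
        have : 1 ≤ 2 ^ coins n Φ E / (L * ∏ h, (N h : ℝ)) := by
          rw [one_le_div (by positivity)]
          exact hsmall
        linarith
    _ ≤ ((2 ^ coins n Φ E / ∏ h, N h : ℕ) : ℝ) * ∏ h, (W h (s h) : ℝ) :=
        mul_le_mul_of_nonneg_right hfloor hW0
    _ ≤ _ := by exact_mod_cast hcard

end Game

/-- The dynamics with target accuracy `1 / E` and `2 ^ k` learners per player. -/
def dynamics (E k : ℕ) : Dynamics := ⟨horizonCmd E k, playerCmd E k⟩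

section

variable {m n Φ : ℕ} [NeZero n] (G : Game m n Φ) (i : Fin m) {E k : ℕ}

theorem move_eq (hE : 1 ≤ E) (hΦ : 1 ≤ Φ) {H : List (Profile m n Φ)}
    (hH : H.length ≤ days m n Φ E k) : ∃ f : Fin (2 ^ (k + coins n Φ E)) → Strategy n Φ × ℕ,
      (dynamics E k).move G i H =
        (PMF.uniformOfFintype (Fin (2 ^ (k + coins n Φ E)))).map f ∧
      ∀ v, (f v).1 = G.play i E k H (v % 2 ^ k) (v / 2 ^ k) ∧
        (f v).2 ≤ (sizeBound m n Φ E k + 2) ^ degree + Φ * n.size := by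
  obtain ⟨f, hf, h⟩ := G.player_exec i (k := k) hE hΦ hH
  refine ⟨fun v => (fun h : Fin Φ => Fin.ofNat n ((f v).1 3 h), (f v).2 + Φ * n.size), ?_,
    fun v => ⟨funext (h v).1, Nat.add_le_add_right (h v).2 _⟩⟩
  rw [Dynamics.move]
  change PMF.map _ ((playerCmd E k).exec _ _) = _
  rw [hf, PMF.map_comp]
  rfl

theorem move_time_le (hE : 1 ≤ E) (hΦ : 1 ≤ Φ) {H : List (Profile m n Φ)}
    (hH : H.length ≤ days m n Φ E k) {r : Strategy n Φ × ℕ}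
    (hr : r ∈ ((dynamics E k).move G i H).support) :
    r.2 ≤ (sizeBound m n Φ E k + 2) ^ degree + Φ * n.size := by
  obtain ⟨f, hf, h⟩ := move_eq G i (k := k) hE hΦ hH
  rw [hf, PMF.mem_support_map_iff] at hr
  obtain ⟨v, -, rfl⟩ := hr
  exact (h v).2

/-- The mixed strategy of a player is the average of the mixed strategies of its learners. -/
theorem mixed_toReal (hE : 1 ≤ E) (hΦ : 1 ≤ Φ) {H : List (Profile m n Φ)}
    (hH : H.length ≤ days m n Φ E k) (s : Strategy n Φ) :
    ((dynamics E k).mixed G i H s).toReal =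
      (∑ j ∈ Finset.range (2 ^ k), G.law i E k H j s) / 2 ^ k := by
  obtain ⟨f, hf, h⟩ := move_eq G i (k := k) hE hΦ hH
  rw [Dynamics.mixed, hf, PMF.map_comp, toReal_map_uniform]
  have hf1 : ∀ v, (Prod.fst ∘ f) v = G.play i E k H (v % 2 ^ k) (v / 2 ^ k) := fun v => (h v).1
  simp only [hf1]
  have h1 : (Finset.univ.filter fun v : Fin (2 ^ (k + coins n Φ E)) =>
      G.play i E k H (v % 2 ^ k) (v / 2 ^ k) = s).card =
      ∑ j ∈ Finset.range (2 ^ k), ((Finset.range (2 ^ coins n Φ E)).filter fun v =>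
        G.play i E k H j v = s).card := by
    simp only [Finset.card_filter]
    rw [← sum_range_divMod (by positivity)
      (fun j w => if G.play i E k H j w = s then 1 else 0), Finset.sum_range, pow_add]
  rw [h1]
  simp only [Game.law]
  rw [← Finset.sum_div, div_div]
  push_cast
  rw [pow_add, mul_comm ((2 : ℝ) ^ k)]

end

end EFG

end

/-! ### Rounding errors and the regret of a single learner -/

noncomputable section

namespace EFG

theorem sum_range_blocks {α : Type*} [AddCommMonoid α] (f : ℕ → α) (M B : ℕ) :
    ∑ d ∈ Finset.range (M * B), f d =
      ∑ r ∈ Finset.range M, ∑ e ∈ Finset.range B, f (r * B + e) := by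
  induction M with
  | zero => simp
  | succ M ih => rw [add_mul, one_mul, Finset.sum_range_add, ih, Finset.sum_range_succ]

/-- Each of the two integer quotients loses less than 1. The lower end is weaker because the
increment itself may already fall short by `B`, the rounding of `B` single payoffs, which is 1 after
the division. -/
theorem abs_div_sub_div_sub_le {A A' B : ℕ} (hB : 1 ≤ B) {x : ℝ}
    (h1 : x - B ≤ (A' : ℝ) - A) (h2 : (A' : ℝ) - A ≤ x) :
    -2 ≤ ((A' / B : ℕ) : ℝ) - (A / B : ℕ) - x / B ∧
      ((A' / B : ℕ) : ℝ) - (A / B : ℕ) - x / B ≤ 1 := by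
  have hB0 : (0 : ℝ) < B := by exact_mod_cast hB
  have a1 : ((A / B : ℕ) : ℝ) ≤ A / B := Nat.cast_div_le
  have a2 : ((A' / B : ℕ) : ℝ) ≤ A' / B := Nat.cast_div_le
  have b : ∀ A : ℕ, (A : ℝ) / B ≤ ((A / B : ℕ) : ℝ) + 1 := by
    intro A
    have := Nat.lt_div_mul_add (a := A) hB
    rw [div_le_iff₀ hB0]
    have h : (A : ℝ) ≤ ((A / B : ℕ) : ℝ) * B + B := by exact_mod_cast this.le
    linarith
  have b1 := b A
  have b2 := b A'
  have c1 : x / B - 1 ≤ (A' : ℝ) / B - A / B := by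
    rw [← sub_div, le_div_iff₀ hB0, sub_mul, div_mul_cancel₀ _ hB0.ne']
    linarith
  have c2 : (A' : ℝ) / B - A / B ≤ x / B := by
    rw [← sub_div]
    exact div_le_div_of_nonneg_right h2 hB0.le
  constructor <;> linarith

namespace Game

variable {m n Φ : ℕ} [NeZero n] (G : Game m n Φ) (i : Fin m) {E k : ℕ}

/-! ### The regret of one learner -/

/-- The payoff of the strategy `s` on day `d`. -/
def dayU (H : List (Profile m n Φ)) (d : ℕ) (s : Strategy n Φ) : ℝ :=
  G.u i (Function.update (dayOf H d) i s)

theorem dayU_mem (H : List (Profile m n Φ)) (d : ℕ) (s : Strategy n Φ) :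
    G.dayU i H d s ∈ Set.Icc (0 : ℝ) 1 := G.u_mem_Icc i _

/-- The scores after `r` rounds of `B` days, starting on day `a`. -/
def cumScore (b B : ℕ) (H : List (Profile m n Φ)) (a r : ℕ) (h : Fin Φ) (c : Fin n) : ℕ :=
  (∑ d ∈ Finset.range (r * B), G.dayVal i b H (a + d) h c) / B

theorem dayOf_take (H : List (Profile m n Φ)) {t d : ℕ} (hd : d < t) :
    dayOf (H.take t) d = dayOf H d := by
  simp [dayOf, List.getD_eq_getElem?_getD, hd]

/-- On day `e` of round `r` of run `c`, only the `r` completed rounds of this run enter the score.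
The right-hand side does not involve `e`. -/
theorem scores_take {b B M : ℕ} {H : List (Profile m n Φ)} {c r e : ℕ} (hr : r < M)
    (he : e < B) (hH : c * (B * M) + (r * B + e) ≤ H.length) :
    G.scores i b B M (H.take (c * (B * M) + (r * B + e)))
      (H.take (c * (B * M) + (r * B + e))).length = G.cumScore i b B H (c * (B * M)) r := by
  have hlen : (H.take (c * (B * M) + (r * B + e))).length = c * (B * M) + (r * B + e) := by
    simpa using hH
  have h1 : (c * (B * M) + (r * B + e)) / B = c * M + r := by
    rw [show c * (B * M) + (r * B + e) = e + B * (c * M + r) by ring,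
      Nat.add_mul_div_left _ _ (by omega), Nat.div_eq_of_lt he, zero_add]
  have h2 : (c * (B * M) + (r * B + e)) / (B * M) = c := by
    rw [← Nat.div_div_eq_div_mul, h1, mul_comm, Nat.mul_add_div (by omega),
      Nat.div_eq_of_lt hr, add_zero]
  have h3 : (c * M + r) % M = r := by
    rw [mul_comm, Nat.mul_add_mod, Nat.mod_eq_of_lt hr]
  funext h a
  rw [hlen, scores, block_interval, h1, h2, h3, cumScore]
  congr 1
  refine Finset.sum_congr rfl fun d hd => ?_
  rw [Finset.mem_range] at hd
  rw [dayVal, dayOf_take H (by omega), dayVal]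

theorem law_congr {H H' : List (Profile m n Φ)} {j : ℕ}
    (h : G.scores i (bits n Φ E) (block m n Φ E k j) (rounds n Φ E) H H.length =
      G.scores i (bits n Φ E) (block m n Φ E k j) (rounds n Φ E) H' H'.length) :
    G.law i E k H j = G.law i E k H' j := by
  have hp : G.play i E k H j = G.play i E k H' j := by
    funext v
    simp only [play, h]
  funext s
  unfold law
  rw [hp]

theorem one_le_block (hm : 1 ≤ m) (hE : 1 ≤ E) (hΦ : 1 ≤ Φ) (j : ℕ) :
    1 ≤ block m n Φ E k j := by
  have hn : 1 ≤ n := Nat.one_le_iff_ne_zero.2 (NeZero.ne n)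
  have h2k := Nat.two_pow_pos k
  refine Nat.mul_pos (lt_of_lt_of_le ?_ (le_reps hm hn hΦ hE)) (Nat.pow_pos
    (one_le_rounds hn hΦ hE))
  positivity

/-- The mixed strategy of a learner does not change during a round. -/
theorem law_take {H : List (Profile m n Φ)} {j c r e : ℕ} (hr : r < rounds n Φ E)
    (he : e < block m n Φ E k j)
    (hH : c * (block m n Φ E k j * rounds n Φ E) + (r * block m n Φ E k j + e) ≤ H.length) :
    G.law i E k (H.take (c * (block m n Φ E k j * rounds n Φ E) +
        (r * block m n Φ E k j + e))) j =
      G.law i E k (H.take (c * (block m n Φ E k j * rounds n Φ E) +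
        (r * block m n Φ E k j + 0))) j := by
  refine G.law_congr i ?_
  rw [G.scores_take i hr he hH, G.scores_take i hr (by omega) (by omega)]

theorem dayVal_bounds (b : ℕ) (H : List (Profile m n Φ)) (d : ℕ) (h : Fin Φ) (a : Fin n) :
    (2 : ℝ) ^ b * G.dayU i H d ((G.forest i).path h a) - 1 ≤ G.dayVal i b H d h a ∧
      (G.dayVal i b H d h a : ℝ) ≤ 2 ^ b * G.dayU i H d ((G.forest i).path h a) := by
  have h0 : 0 ≤ (2 : ℝ) ^ b * G.dayU i H d ((G.forest i).path h a) :=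
    mul_nonneg (by positivity) (G.dayU_mem i H d _).1
  refine ⟨?_, Nat.floor_le h0⟩
  have := Nat.lt_floor_add_one ((2 : ℝ) ^ b * G.dayU i H d ((G.forest i).path h a))
  rw [dayVal]
  exact (sub_le_iff_le_add).2 this.le

/-- The scores, relative to the score of the reference action. -/
def relScore (b B : ℕ) (H : List (Profile m n Φ)) (a r : ℕ) (h : Fin Φ) (c : Fin n) : ℤ :=
  (G.cumScore i b B H a r h c : ℤ) - G.cumScore i b B H a r h 0

/-- The gain in one round approximates the payoff in this round. -/
theorem abs_gain_sub_le {b B : ℕ} (hB : 1 ≤ B) (H : List (Profile m n Φ)) (a r : ℕ)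
    (s : Strategy n Φ) :
    |(G.forest i).gain (G.relScore i b B H a r) (G.relScore i b B H a (r + 1)) s -
      2 ^ b / B * ∑ e ∈ Finset.range B,
        (G.dayU i H (a + (r * B + e)) s - G.dayU i H (a + (r * B + e)) 0)| ≤ 3 * Φ := by
  classical
  have hinc : ∀ h c, -2 ≤ ((G.cumScore i b B H a (r + 1) h c : ℕ) : ℝ) -
      (G.cumScore i b B H a r h c : ℕ) - (2 ^ b * ∑ e ∈ Finset.range B,
        G.dayU i H (a + (r * B + e)) ((G.forest i).path h c)) / B ∧
      ((G.cumScore i b B H a (r + 1) h c : ℕ) : ℝ) -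
      (G.cumScore i b B H a r h c : ℕ) - (2 ^ b * ∑ e ∈ Finset.range B,
        G.dayU i H (a + (r * B + e)) ((G.forest i).path h c)) / B ≤ 1 := by
    intro h c
    have hsum : ((∑ d ∈ Finset.range ((r + 1) * B), G.dayVal i b H (a + d) h c : ℕ) : ℝ) -
        (∑ d ∈ Finset.range (r * B), G.dayVal i b H (a + d) h c : ℕ) =
        ∑ e ∈ Finset.range B, (G.dayVal i b H (a + (r * B + e)) h c : ℝ) := by
      rw [add_mul, one_mul, Finset.sum_range_add]
      push_cast
      ring
    refine abs_div_sub_div_sub_le hB ?_ ?_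
    · rw [hsum, Finset.mul_sum]
      calc _ = ∑ e ∈ Finset.range B,
            ((2 : ℝ) ^ b * G.dayU i H (a + (r * B + e)) ((G.forest i).path h c) - 1) := by
            simp
        _ ≤ _ := Finset.sum_le_sum fun e _ => (G.dayVal_bounds i b H _ h c).1
    · rw [hsum, Finset.mul_sum]
      exact Finset.sum_le_sum fun e _ => (G.dayVal_bounds i b H _ h c).2
  have hU : ∀ d, G.dayU i H d s - G.dayU i H d 0 = ∑ h, if (G.forest i).Reach s h then
      G.dayU i H d ((G.forest i).path h (s h)) - G.dayU i H d ((G.forest i).path h 0)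
      else 0 := by
    intro d
    have := G.u_eq_add_sum i (dayOf H d) s
    simp only [dayU]
    rw [this]
    ring_nf
  simp only [hU]
  rw [Finset.sum_comm, Finset.mul_sum, Forest.gain, ← Finset.sum_sub_distrib]
  refine (Finset.abs_sum_le_sum_abs _ _).trans ?_
  -- Every reached information set contributes the difference of two errors from the interval `[-2,
  -- 1]`.
  calc _ ≤ ∑ _h : Fin Φ, (3 : ℝ) := Finset.sum_le_sum fun h _ => ?_
    _ = 3 * Φ := by simp [mul_comm]
  split_ifs with hR
  · obtain ⟨h1, h2⟩ := hinc h (s h)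
    obtain ⟨h3, h4⟩ := hinc h 0
    rw [Finset.sum_sub_distrib]
    simp only [relScore]
    push_cast
    rw [abs_le, mul_sub, div_mul_eq_mul_div, div_mul_eq_mul_div]
    constructor <;> linarith
  · simp

theorem cumScore_le {b B : ℕ} (H : List (Profile m n Φ)) (a r : ℕ) (h : Fin Φ)
    (c : Fin n) : G.cumScore i b B H a r h c ≤ r * 2 ^ b := by
  refine Nat.div_le_of_le_mul ?_
  calc _ ≤ ∑ _d ∈ Finset.range (r * B), 2 ^ b :=
        Finset.sum_le_sum fun d _ => G.dayVal_le i b H _ h c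
    _ = r * B * 2 ^ b := by simp
    _ = B * (r * 2 ^ b) := by ring

/-- This is `hedge` translated from scores to payoffs: one unit of score stands for a total payoff
of `B / prec`. The term `6 * Φ` per round pays for rounding, once for the comparator and once for
the mean of the learner. -/
theorem learner_regret (hE : 1 ≤ E) (hΦ : 1 ≤ Φ) (H : List (Profile m n Φ)) (j c : ℕ)
    (hH : c * (block m n Φ E k j * rounds n Φ E) + block m n Φ E k j * rounds n Φ E ≤ H.length)
    (s' : Strategy n Φ) :
    ∑ r ∈ Finset.range (rounds n Φ E), ∑ e ∈ Finset.range (block m n Φ E k j),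
      (G.dayU i H (c * (block m n Φ E k j * rounds n Φ E) + (r * block m n Φ E k j + e)) s' -
        ∑ s, G.law i E k (H.take (c * (block m n Φ E k j * rounds n Φ E) +
          (r * block m n Φ E k j + e))) j s *
        G.dayU i H (c * (block m n Φ E k j * rounds n Φ E) + (r * block m n Φ E k j + e)) s) ≤
      block m n Φ E k j / prec n Φ E * (2 * rate n Φ E * (Φ * Real.log n) +
        rounds n Φ E * (4 * prec n Φ E ^ 2 / rate n Φ E + 4 + 6 * Φ)) := by
  have hn : 1 ≤ n := Nat.one_le_iff_ne_zero.2 (NeZero.ne n)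
  have hm : 1 ≤ m := by have := i.2; omega
  have hB := one_le_block (n := n) (k := k) hm hE hΦ j
  set B := block m n Φ E k j with hBdef
  set M := rounds n Φ E with hM
  set b := bits n Φ E with hb
  set q : ℝ := ((prec n Φ E : ℕ) : ℝ) with hq
  have hqb : q = 2 ^ b := by rw [hq, prec]; push_cast; rfl
  have hq1 : (1 : ℝ) ≤ q := by rw [hq]; exact_mod_cast one_le_prec
  have hB0 : (0 : ℝ) < B := by exact_mod_cast hB
  have hL : (rate n Φ E : ℝ) = 32 * E * q := by rw [rate, hq]; push_cast; rfl
  have hE1 : (1 : ℝ) ≤ E := by exact_mod_cast hE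
  -- Makes the gain of a round at most `q + 3 * Φ ≤ 2 * q`, as `hedge` requires.
  have h3q : 3 * (Φ : ℝ) ≤ q := by
    have h := target_le_prec (n := n) (Φ := Φ) (E := E)
    rw [target] at h
    have h1 : 3 * Φ ≤ 48 * n * Φ * E := by
      calc 3 * Φ ≤ 48 * 1 * Φ * 1 := by omega
        _ ≤ _ := by gcongr
    rw [hq]
    exact_mod_cast h1.trans h
  set a := c * (B * M) with ha
  set P : ℕ → Strategy n Φ → ℝ := fun r => G.law i E k (H.take (a + (r * B + 0))) j with hP
  have hlt : ∀ r < M, ∀ e < B, a + (r * B + e) < H.length := by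
    intro r hr e he
    have : r * B + e < B * M := by
      calc r * B + e < (r + 1) * B := by rw [add_mul]; omega
        _ ≤ M * B := Nat.mul_le_mul_right _ hr
        _ = B * M := mul_comm _ _
    omega
  have hlaw : ∀ r < M, ∀ e < B, G.law i E k (H.take (a + (r * B + e))) j = P r :=
    fun r hr e he => G.law_take i hr he (hlt r hr e he).le
  have hcum : ∀ r ≤ M, ∀ h x, G.cumScore i b B H a r h x ≤ cap n Φ E := by
    intro r hr h x
    refine (G.cumScore_le i H a r h x).trans ?_
    exact Nat.mul_le_mul_right _ hr
  have hL1 : 1 ≤ rate n Φ E := by have := one_le_rate n Φ hE; omega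
  have hround : ∀ r s, |(G.forest i).gain (G.relScore i b B H a r)
      (G.relScore i b B H a (r + 1)) s - q / B * ∑ e ∈ Finset.range B,
        (G.dayU i H (a + (r * B + e)) s - G.dayU i H (a + (r * B + e)) 0)| ≤ 3 * Φ := by
    intro r s
    rw [hqb]
    exact G.abs_gain_sub_le i hB H a r s
  have hedge := (G.forest i).hedge (L := rate n Φ E) (q := q) (M := M)
    (by exact_mod_cast one_le_rate n Φ hE) (by rw [hL]; nlinarith)
    (G.relScore i b B H a) (by simp [relScore, cumScore])
    (fun r => (G.forest i).expZ (rate n Φ E) (cap n Φ E) (G.cumScore i b B H a r))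
    (fun r hr => Forest.partition_expZ hL1 (hcum r hr)) P
    (fun r _ s => G.law_nonneg i E k _ _ _) (fun r _ => G.sum_law i E k _ _) (by
      intro r hr s
      have := G.le_law i (k := k) hE hΦ (H.take (a + (r * B + 0))) j s
      rw [G.scores_take i hr (by omega) (hlt r hr 0 (by omega)).le] at this
      refine le_trans (le_of_eq ?_) this
      congr 1
      refine Finset.prod_congr rfl fun h _ => ?_
      rw [Forest.expAction_div hL1 (hcum r hr.le)]
      rfl) (by
      intro r hr s
      have h1 := hround r s
      have h2 : |q / B * ∑ e ∈ Finset.range B,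
          (G.dayU i H (a + (r * B + e)) s - G.dayU i H (a + (r * B + e)) 0)| ≤ q := by
        rw [abs_mul, abs_of_nonneg (by positivity)]
        have h3 : |∑ e ∈ Finset.range B,
            (G.dayU i H (a + (r * B + e)) s - G.dayU i H (a + (r * B + e)) 0)| ≤ B := by
          refine (Finset.abs_sum_le_sum_abs _ _).trans ?_
          calc _ ≤ ∑ _e ∈ Finset.range B, (1 : ℝ) := Finset.sum_le_sum fun e _ => by
                have h4 := G.dayU_mem i H (a + (r * B + e)) s
                have h5 := G.dayU_mem i H (a + (r * B + e)) 0
                rw [abs_le]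
                constructor <;> linarith [h4.1, h4.2, h5.1, h5.2]
            _ = B := by simp
        calc q / B * _ ≤ q / B * B := by gcongr
          _ = q := by field_simp
      have h4 := abs_sub_abs_le_abs_sub ((G.forest i).gain (G.relScore i b B H a r)
        (G.relScore i b B H a (r + 1)) s) (q / B * ∑ e ∈ Finset.range B,
        (G.dayU i H (a + (r * B + e)) s - G.dayU i H (a + (r * B + e)) 0))
      linarith) s'
  have hone : ∀ r < M, ∑ e ∈ Finset.range B, (G.dayU i H (a + (r * B + e)) s' -
      ∑ s, G.law i E k (H.take (a + (r * B + e))) j s * G.dayU i H (a + (r * B + e)) s) ≤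
      B / q * ((G.forest i).gain (G.relScore i b B H a r) (G.relScore i b B H a (r + 1)) s' -
        ∑ s, P r s * (G.forest i).gain (G.relScore i b B H a r)
          (G.relScore i b B H a (r + 1)) s + 6 * Φ) := by
    intro r hr
    set V : Strategy n Φ → ℝ := fun s => ∑ e ∈ Finset.range B,
      (G.dayU i H (a + (r * B + e)) s - G.dayU i H (a + (r * B + e)) 0) with hV
    set g : Strategy n Φ → ℝ := (G.forest i).gain (G.relScore i b B H a r)
      (G.relScore i b B H a (r + 1)) with hg
    have hP1 : ∑ s, P r s = 1 := G.sum_law i E k _ _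
    have hP0 : ∀ s, 0 ≤ P r s := fun s => G.law_nonneg i E k _ _ _
    have e1 : ∑ e ∈ Finset.range B, (G.dayU i H (a + (r * B + e)) s' -
        ∑ s, G.law i E k (H.take (a + (r * B + e))) j s * G.dayU i H (a + (r * B + e)) s) =
        V s' - ∑ s, P r s * V s := by
      have : ∀ e ∈ Finset.range B, (G.dayU i H (a + (r * B + e)) s' -
          ∑ s, G.law i E k (H.take (a + (r * B + e))) j s * G.dayU i H (a + (r * B + e)) s) =
          (G.dayU i H (a + (r * B + e)) s' - G.dayU i H (a + (r * B + e)) 0) -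
          ∑ s, P r s *
            (G.dayU i H (a + (r * B + e)) s - G.dayU i H (a + (r * B + e)) 0) := by
        intro e he
        rw [hlaw r hr e (Finset.mem_range.1 he)]
        simp only [mul_sub, Finset.sum_sub_distrib]
        rw [← Finset.sum_mul, hP1]
        ring
      rw [Finset.sum_congr rfl this, Finset.sum_sub_distrib, Finset.sum_comm]
      simp only [hV, Finset.mul_sum]
    have e2 : ∀ s, |g s - q / B * V s| ≤ 3 * Φ := hround r
    have e3 : q / B * (V s' - ∑ s, P r s * V s) ≤ g s' - ∑ s, P r s * g s + 6 * Φ := by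
      have h1 := (abs_le.1 (e2 s')).1
      have h2 : ∑ s, P r s * (g s - q / B * V s) ≤ 3 * Φ := by
        calc _ ≤ ∑ s, P r s * (3 * Φ) := Finset.sum_le_sum fun s _ =>
              mul_le_mul_of_nonneg_left (abs_le.1 (e2 s)).2 (hP0 s)
          _ = 3 * Φ := by rw [← Finset.sum_mul, hP1, one_mul]
      have h3 : ∑ s, P r s * (g s - q / B * V s) =
          ∑ s, P r s * g s - q / B * ∑ s, P r s * V s := by
        rw [Finset.mul_sum, ← Finset.sum_sub_distrib]
        refine Finset.sum_congr rfl fun s _ => ?_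
        ring
      rw [h3] at h2
      rw [mul_sub]
      linarith
    rw [e1]
    have hqB : B / q * (q / B) = 1 := by field_simp
    calc V s' - ∑ s, P r s * V s = B / q * (q / B * (V s' - ∑ s, P r s * V s)) := by
          rw [← mul_assoc, hqB, one_mul]
      _ ≤ _ := mul_le_mul_of_nonneg_left e3 (by positivity)
  calc _ ≤ ∑ r ∈ Finset.range M, B / q *
        ((G.forest i).gain (G.relScore i b B H a r) (G.relScore i b B H a (r + 1)) s' -
        ∑ s, P r s * (G.forest i).gain (G.relScore i b B H a r)
          (G.relScore i b B H a (r + 1)) s + 6 * Φ) :=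
        Finset.sum_le_sum fun r hr => hone r (Finset.mem_range.1 hr)
    _ = B / q * (∑ r ∈ Finset.range M,
        ((G.forest i).gain (G.relScore i b B H a r) (G.relScore i b B H a (r + 1)) s' -
        ∑ s, P r s * (G.forest i).gain (G.relScore i b B H a r)
          (G.relScore i b B H a (r + 1)) s) + M * (6 * Φ)) := by
        rw [← Finset.mul_sum, Finset.sum_add_distrib]
        simp
    _ ≤ _ := by
        refine mul_le_mul_of_nonneg_left ?_ (by positivity)
        calc _ ≤ 2 * (rate n Φ E : ℝ) * (Φ * Real.log n) +
            M * (4 * q ^ 2 / rate n Φ E + 4) + M * (6 * Φ) := by gcongr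
          _ = _ := by ring

end Game

end EFG

end

/-! ### From the regret of the learners to swap regret -/

noncomputable section

namespace EFG

theorem block_succ (m n Φ E k j : ℕ) :
    block m n Φ E k (j + 1) = rounds n Φ E * block m n Φ E k j := by
  rw [block, block, pow_succ]
  ring

namespace Game

variable {m n Φ : ℕ} [NeZero n] (G : Game m n Φ) (i : Fin m) (E k : ℕ)

/-- The mixed strategy of player `i` after the history `H`. -/
def mix (H : List (Profile m n Φ)) (s : Strategy n Φ) : ℝ :=
  (∑ j ∈ Finset.range (2 ^ k), G.law i E k H j s) / 2 ^ k

theorem mix_nonneg (H : List (Profile m n Φ)) (s : Strategy n Φ) : 0 ≤ G.mix i E k H s :=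
  div_nonneg (Finset.sum_nonneg fun _ _ => G.law_nonneg i E k _ _ _) (by positivity)

theorem sum_mix (H : List (Profile m n Φ)) : ∑ s, G.mix i E k H s = 1 := by
  simp only [mix]
  rw [← Finset.sum_div, Finset.sum_comm]
  simp only [G.sum_law]
  simp

/-- The expected payoff of the strategy `s` after the history `H`. -/
def expU (H : List (Profile m n Φ)) (s : Strategy n Φ) : ℝ :=
  ∑ σ : Profile m n Φ, (∏ j, G.mix j E k H (σ j)) * G.u i (Function.update σ i s)

theorem expU_mem (H : List (Profile m n Φ)) (s : Strategy n Φ) :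
    G.expU i E k H s ∈ Set.Icc (0 : ℝ) 1 := by
  have h0 : ∀ σ : Profile m n Φ, 0 ≤ ∏ j, G.mix j E k H (σ j) := fun σ =>
    Finset.prod_nonneg fun j _ => G.mix_nonneg j E k H _
  constructor
  · exact Finset.sum_nonneg fun σ _ => mul_nonneg (h0 σ) (G.u_mem_Icc i _).1
  · rw [← sum_prod_eq_one (fun j => G.mix j E k H) fun j => G.sum_mix j E k H]
    exact Finset.sum_le_sum fun σ _ => mul_le_of_le_one_right (h0 σ) (G.u_mem_Icc i _).2

/-- The payoffs of all strategies are concentrated, for every group of days during which all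
mixed strategies remain the same. -/
def Concentrated (H : List (Profile m n Φ)) : Prop :=
  ∀ (i : Fin m) (s : Strategy n Φ), ∀ g < rounds n Φ E ^ 2 ^ k,
    |∑ e ∈ Finset.range (reps m n Φ E k), (G.dayU i H (g * reps m n Φ E k + e) s -
      G.expU i E k (H.take (g * reps m n Φ E k + e)) s)| ≤ reps m n Φ E k / (16 * E)

variable {E k}

theorem Concentrated.block {G : Game m n Φ} {H : List (Profile m n Φ)}
    (hH : G.Concentrated E k H) (i : Fin m) (s : Strategy n Φ) {g N : ℕ}
    (hg : g + N ≤ rounds n Φ E ^ 2 ^ k) :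
    |∑ e ∈ Finset.range (N * reps m n Φ E k), (G.dayU i H (g * reps m n Φ E k + e) s -
      G.expU i E k (H.take (g * reps m n Φ E k + e)) s)| ≤
      (N * reps m n Φ E k : ℕ) / (16 * E) := by
  rw [sum_range_blocks]
  refine (Finset.abs_sum_le_sum_abs _ _).trans ?_
  calc _ ≤ ∑ _r ∈ Finset.range N, (reps m n Φ E k : ℝ) / (16 * E) := by
        refine Finset.sum_le_sum fun r hr => ?_
        rw [Finset.mem_range] at hr
        have := hH i s (g + r) (by omega)
        simp only [add_mul, add_assoc] at this
        exact this
    _ = _ := by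
        simp
        ring

/-- The error terms of one learner. -/
theorem error_le (hE : 1 ≤ E) (hΦ : 1 ≤ Φ) :
    (2 * rate n Φ E * (Φ * Real.log n) +
      rounds n Φ E * (4 * prec n Φ E ^ 2 / rate n Φ E + 4 + 6 * Φ)) / prec n Φ E ≤
      rounds n Φ E * (5 / (8 * E) : ℝ) := by
  have hn : 1 ≤ n := Nat.one_le_iff_ne_zero.2 (NeZero.ne n)
  have hE1 : (1 : ℝ) ≤ E := by exact_mod_cast hE
  have hΦ1 : (1 : ℝ) ≤ Φ := by exact_mod_cast hΦ
  have hn1 : (1 : ℝ) ≤ n := by exact_mod_cast hn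
  have hb1 : (1 : ℝ) ≤ bits n Φ E := by exact_mod_cast one_le_bits hn hΦ hE
  have hq : (48 : ℝ) * n * Φ * E ≤ prec n Φ E := by
    exact_mod_cast target_le_prec (n := n) (Φ := Φ) (E := E)
  have hlog : Real.log n ≤ bits n Φ E := by
    have h1 : (n : ℝ) ≤ 2 ^ bits n Φ E := by
      have : (n : ℝ) ≤ 48 * n * Φ * E := by
        nlinarith [mul_le_mul hΦ1 hE1 (by norm_num) (by linarith)]
      refine this.trans (hq.trans ?_)
      rw [prec]
      push_cast
      exact le_rfl
    calc Real.log n ≤ Real.log (2 ^ bits n Φ E) := Real.log_le_log (by linarith) h1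
      _ = bits n Φ E * Real.log 2 := Real.log_pow _ _
      _ ≤ bits n Φ E * 1 := by
          gcongr
          linarith [Real.log_two_lt_d9]
      _ = _ := mul_one _
  have hL : (rate n Φ E : ℝ) = 32 * E * prec n Φ E := by rw [rate]; push_cast; rfl
  have hM : (rounds n Φ E : ℝ) = 512 * (E * E) * Φ * bits n Φ E := by rw [rounds]; push_cast; rfl
  set q : ℝ := ((prec n Φ E : ℕ) : ℝ) with hqdef
  set b : ℝ := ((bits n Φ E : ℕ) : ℝ) with hbdef
  have hq0 : 0 < q := lt_of_lt_of_le (by positivity) hq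
  have hM0 : (0 : ℝ) < rounds n Φ E := by rw [hM]; positivity
  -- Four error terms, each at most `1 / (8 * E)` per round: the initial potential by the choice of
  -- `rounds`, the second-order term by the choice of `rate`, the other two because `q ≥ 48 * n * Φ
  -- * E`.
  have t1 : 2 * (32 * E * q) * (Φ * Real.log n) / q ≤ rounds n Φ E * (1 / (8 * E)) := by
    rw [hM]
    calc 2 * (32 * E * q) * (Φ * Real.log n) / q = 64 * E * Φ * Real.log n := by field_simp; ring
      _ ≤ 64 * E * Φ * b := by gcongr
      _ = _ := by field_simp; ring
  have t2 : 4 * q ^ 2 / (32 * E * q) / q = 1 / (8 * E) := by field_simp; ring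
  have t3 : 4 / q ≤ 1 / (8 * E) := by
    rw [div_le_div_iff₀ hq0 (by positivity)]
    have : (E : ℝ) ≤ n * Φ * E := by nlinarith [mul_le_mul hn1 hΦ1 (by norm_num) (by linarith)]
    nlinarith
  have t4 : 6 * Φ / q ≤ 1 / (8 * E) := by
    rw [div_le_div_iff₀ hq0 (by positivity)]
    have : (Φ : ℝ) * E ≤ n * (Φ * E) := le_mul_of_one_le_left (by positivity) hn1
    nlinarith
  rw [hL]
  calc _ = 2 * (32 * E * q) * (Φ * Real.log n) / q + rounds n Φ E *
        (4 * q ^ 2 / (32 * E * q) / q + 4 / q + 6 * Φ / q) := by ring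
    _ ≤ rounds n Φ E * (1 / (8 * E)) + rounds n Φ E *
        (1 / (8 * E) + 1 / (8 * E) + 1 / (8 * E)) := by
        rw [t2]
        gcongr
    _ ≤ rounds n Φ E * (5 / (8 * E)) := by
        rw [← mul_add]
        refine mul_le_mul_of_nonneg_left ?_ hM0.le
        have : (0 : ℝ) ≤ 1 / (8 * E) := by positivity
        have e : (5 / (8 * E) : ℝ) = 5 * (1 / (8 * E)) := by ring
        rw [e]
        linarith

/-- A round of level `j` consists of `M ^ j` whole groups, and the law of the learner is constant in
it. Replacing realized by expected payoffs therefore costs `B / (16 * E)` for the comparator and the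
same for the mean of the learner; together with `5 / (8 * E)` from `error_le` this is `3 / (4 * E)`.
-/
theorem learner_regret_expU (hE : 1 ≤ E) (hΦ : 1 ≤ Φ) {H : List (Profile m n Φ)}
    (hlen : H.length = days m n Φ E k) (hH : G.Concentrated E k H) {j c : ℕ}
    (hc : (c + 1) * rounds n Φ E ^ (j + 1) ≤ rounds n Φ E ^ 2 ^ k) (s' : Strategy n Φ) :
    ∑ d ∈ Finset.range (block m n Φ E k (j + 1)),
      (G.expU i E k (H.take (c * block m n Φ E k (j + 1) + d)) s' -
        ∑ s, G.law i E k (H.take (c * block m n Φ E k (j + 1) + d)) j s *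
          G.expU i E k (H.take (c * block m n Φ E k (j + 1) + d)) s) ≤
      block m n Φ E k (j + 1) * (3 / (4 * E)) := by
  have hm : 1 ≤ m := by have := i.2; omega
  have hB := one_le_block (n := n) (k := k) hm hE hΦ j
  have hblock : (c + 1) * block m n Φ E k (j + 1) ≤ H.length := by
    rw [hlen, days, block]
    calc (c + 1) * (reps m n Φ E k * rounds n Φ E ^ (j + 1)) =
        reps m n Φ E k * ((c + 1) * rounds n Φ E ^ (j + 1)) := by ring
      _ ≤ _ := Nat.mul_le_mul_left _ hc
  rw [block_succ, mul_comm (rounds n Φ E)] at hblock ⊢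
  rw [mul_comm (block m n Φ E k j), sum_range_blocks, mul_comm (rounds n Φ E)]
  have hreg := G.learner_regret i (k := k) hE hΦ H j c
    (by rw [add_mul, one_mul] at hblock; omega) s'
  set B := block m n Φ E k j with hBdef
  set M := rounds n Φ E with hM
  set a := c * (B * M) with ha
  have hB0 : (0 : ℝ) < B := by exact_mod_cast hB
  have hlt : ∀ r < M, ∀ e < B, a + (r * B + e) < H.length := by
    intro r hr e he
    have : r * B + e < B * M := by
      calc r * B + e < (r + 1) * B := by rw [add_mul]; omega
        _ ≤ M * B := Nat.mul_le_mul_right _ hr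
        _ = B * M := mul_comm _ _
    rw [add_mul, one_mul] at hblock
    omega
  have hconc : ∀ r < M, ∀ s, |∑ e ∈ Finset.range B, (G.dayU i H (a + (r * B + e)) s -
      G.expU i E k (H.take (a + (r * B + e))) s)| ≤ B / (16 * E) := by
    intro r hr s
    have h := hH.block i s (g := c * M ^ (j + 1) + r * M ^ j) (N := M ^ j) (by
      refine le_trans ?_ hc
      rw [add_mul, one_mul, add_assoc, pow_succ]
      refine Nat.add_le_add_left ?_ _
      calc r * M ^ j + M ^ j = (r + 1) * M ^ j := by ring
        _ ≤ M * M ^ j := Nat.mul_le_mul_right _ hr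
        _ = _ := mul_comm _ _)
    have e1 : M ^ j * reps m n Φ E k = B := by rw [hBdef, block, mul_comm]
    have e2 : (c * M ^ (j + 1) + r * M ^ j) * reps m n Φ E k = a + r * B := by
      rw [ha, ← e1, pow_succ]
      ring
    simp only [e1, e2, add_assoc] at h
    exact h
  have hone : ∀ r ∈ Finset.range M, ∑ e ∈ Finset.range B,
      (G.expU i E k (H.take (a + (r * B + e))) s' -
        ∑ s, G.law i E k (H.take (a + (r * B + e))) j s *
          G.expU i E k (H.take (a + (r * B + e))) s) ≤
      ∑ e ∈ Finset.range B, (G.dayU i H (a + (r * B + e)) s' -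
        ∑ s, G.law i E k (H.take (a + (r * B + e))) j s * G.dayU i H (a + (r * B + e)) s) +
      B * (1 / (8 * E)) := by
    intro r hr
    rw [Finset.mem_range] at hr
    set P := G.law i E k (H.take (a + (r * B + 0))) j with hP
    have hlaw : ∀ e ∈ Finset.range B, G.law i E k (H.take (a + (r * B + e))) j = P :=
      fun e he => G.law_take i hr (Finset.mem_range.1 he)
        (hlt r hr e (Finset.mem_range.1 he)).le
    have hP1 : ∑ s, P s = 1 := G.sum_law i E k _ _
    have hP0 : ∀ s, 0 ≤ P s := fun s => G.law_nonneg i E k _ _ _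
    set f : Strategy n Φ → ℝ := fun s => ∑ e ∈ Finset.range B, (G.dayU i H (a + (r * B + e)) s -
      G.expU i E k (H.take (a + (r * B + e))) s) with hf
    have key : ∑ e ∈ Finset.range B, (G.dayU i H (a + (r * B + e)) s' -
        ∑ s, G.law i E k (H.take (a + (r * B + e))) j s * G.dayU i H (a + (r * B + e)) s) -
        ∑ e ∈ Finset.range B, (G.expU i E k (H.take (a + (r * B + e))) s' -
        ∑ s, G.law i E k (H.take (a + (r * B + e))) j s *
          G.expU i E k (H.take (a + (r * B + e))) s) = f s' - ∑ s, P s * f s := by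
      simp only [hf, Finset.mul_sum]
      rw [Finset.sum_comm (s := Finset.univ), ← Finset.sum_sub_distrib, ← Finset.sum_sub_distrib]
      refine Finset.sum_congr rfl fun e he => ?_
      rw [hlaw e he]
      simp only [mul_sub, Finset.sum_sub_distrib]
      ring
    have h1 := (abs_le.1 (hconc r hr s')).1
    have h2 : ∑ s, P s * f s ≤ B / (16 * E) := by
      calc _ ≤ ∑ s, P s * (B / (16 * E)) := Finset.sum_le_sum fun s _ =>
            mul_le_mul_of_nonneg_left (abs_le.1 (hconc r hr s)).2 (hP0 s)
        _ = _ := by rw [← Finset.sum_mul, hP1, one_mul]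
    have h3 : (B : ℝ) * (1 / (8 * E)) = B / (16 * E) + B / (16 * E) := by ring
    rw [h3]
    linarith
  have herr := error_le (n := n) (Φ := Φ) hE hΦ
  calc _ ≤ _ := Finset.sum_le_sum hone
    _ = _ + M * (B * (1 / (8 * E))) := by
        rw [Finset.sum_add_distrib, Finset.sum_const, Finset.card_range, nsmul_eq_mul]
    _ ≤ B / prec n Φ E * (2 * rate n Φ E * (Φ * Real.log n) +
        M * (4 * prec n Φ E ^ 2 / rate n Φ E + 4 + 6 * Φ)) + M * (B * (1 / (8 * E))) := by
        gcongr
    _ = B * ((2 * rate n Φ E * (Φ * Real.log n) +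
        M * (4 * prec n Φ E ^ 2 / rate n Φ E + 4 + 6 * Φ)) / prec n Φ E) +
        M * (B * (1 / (8 * E))) := by ring
    _ ≤ B * (M * (5 / (8 * E))) + M * (B * (1 / (8 * E))) := by gcongr
    _ = _ := by
        push_cast
        ring

/-- A learner does not lose much against the deviations of the learner of the next level. -/
theorem deviation_le (hE : 1 ≤ E) (hΦ : 1 ≤ Φ) {H : List (Profile m n Φ)}
    (hlen : H.length = days m n Φ E k) (hH : G.Concentrated E k H) {j : ℕ} (hj : j + 1 < 2 ^ k)
    (φ : Strategy n Φ → Strategy n Φ) :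
    ∑ t ∈ Finset.range (days m n Φ E k), ∑ s, G.law i E k (H.take t) (j + 1) s *
        G.expU i E k (H.take t) (φ s) ≤
      ∑ t ∈ Finset.range (days m n Φ E k), ∑ s, G.law i E k (H.take t) j s *
        G.expU i E k (H.take t) s + days m n Φ E k * (3 / (4 * E)) := by
  have hn : 1 ≤ n := Nat.one_le_iff_ne_zero.2 (NeZero.ne n)
  have hM1 := one_le_rounds hn hΦ hE
  set M := rounds n Φ E with hM
  set B := block m n Φ E k (j + 1) with hB
  set Q := M ^ (2 ^ k - (j + 1)) with hQ
  have hQM : Q * M ^ (j + 1) = M ^ 2 ^ k := by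
    rw [hQ, ← pow_add, Nat.sub_add_cancel hj.le]
  have hdays : days m n Φ E k = Q * B := by
    rw [days, hB, block, ← hM, ← hQM]
    ring
  rw [hdays, sum_range_blocks, sum_range_blocks]
  have hone : ∀ c ∈ Finset.range Q, ∑ d ∈ Finset.range B,
      ∑ s, G.law i E k (H.take (c * B + d)) (j + 1) s *
        G.expU i E k (H.take (c * B + d)) (φ s) ≤
      ∑ d ∈ Finset.range B, ∑ s, G.law i E k (H.take (c * B + d)) j s *
        G.expU i E k (H.take (c * B + d)) s + B * (3 / (4 * E)) := by
    intro c hc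
    rw [Finset.mem_range] at hc
    set P := G.law i E k (H.take (c * B + 0)) (j + 1) with hP
    have hlaw : ∀ d ∈ Finset.range B, G.law i E k (H.take (c * B + d)) (j + 1) = P := by
      intro d hd
      rw [Finset.mem_range] at hd
      -- Block number `c` of level `j + 1` is round `c % M` of its run number `c / M`.
      have e : ∀ x, c / M * (B * M) + (c % M * B + x) = c * B + x := by
        intro x
        have := Nat.div_add_mod c M
        calc _ = (M * (c / M) + c % M) * B + x := by ring
          _ = _ := by rw [this]
      have hle : c * B + d ≤ H.length := by
        rw [hlen, hdays]
        calc c * B + d ≤ (c + 1) * B := by rw [add_mul]; omega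
          _ ≤ Q * B := Nat.mul_le_mul_right _ hc
      have := G.law_take i (E := E) (k := k) (H := H) (j := j + 1) (c := c / M) (r := c % M)
        (Nat.mod_lt _ hM1) hd (by rw [← hM, ← hB, e]; exact hle)
      rw [← hM, ← hB, e, e] at this
      exact this
    have hP1 : ∑ s, P s = 1 := G.sum_law i E k _ _
    have hP0 : ∀ s, 0 ≤ P s := fun s => G.law_nonneg i E k _ _ _
    have hreg := fun s' => G.learner_regret_expU i (c := c) (j := j) hE hΦ hlen hH (by
      rw [← hM, ← hQM]
      exact Nat.mul_le_mul_right _ hc) s'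
    -- Since `P` does not change during the block, the sum over the days can be taken for each `s`
    -- separately, and then `φ s` is a fixed comparator for the learner of level `j`.
    calc _ = ∑ s, P s * ∑ d ∈ Finset.range B, G.expU i E k (H.take (c * B + d)) (φ s) := by
          simp only [Finset.mul_sum]
          rw [Finset.sum_comm (s := Finset.univ)]
          refine Finset.sum_congr rfl fun d hd => ?_
          rw [hlaw d hd]
      _ ≤ ∑ s, P s * (∑ d ∈ Finset.range B, ∑ s, G.law i E k (H.take (c * B + d)) j s *
            G.expU i E k (H.take (c * B + d)) s + B * (3 / (4 * E))) := by
          refine Finset.sum_le_sum fun s _ => mul_le_mul_of_nonneg_left ?_ (hP0 s)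
          have := hreg (φ s)
          rw [Finset.sum_sub_distrib] at this
          linarith
      _ = _ := by rw [← Finset.sum_mul, hP1, one_mul]
  calc _ ≤ _ := Finset.sum_le_sum hone
    _ = _ := by
        rw [Finset.sum_add_distrib, Finset.sum_const, Finset.card_range, nsmul_eq_mul]
        push_cast
        ring

/-- The swap regret of every player is small. -/
theorem swap_regret (hE : 1 ≤ E) (hΦ : 1 ≤ Φ) (hk : 4 * E ≤ 2 ^ k)
    {H : List (Profile m n Φ)} (hlen : H.length = days m n Φ E k)
    (hH : G.Concentrated E k H) (φ : Strategy n Φ → Strategy n Φ) :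
    ∑ t ∈ Finset.range (days m n Φ E k), ∑ s, G.mix i E k (H.take t) s *
        G.expU i E k (H.take t) (φ s) ≤
      ∑ t ∈ Finset.range (days m n Φ E k), ∑ s, G.mix i E k (H.take t) s *
        G.expU i E k (H.take t) s + days m n Φ E k * (1 / E) := by
  have hE0 : (0 : ℝ) < E := by exact_mod_cast hE
  set T := days m n Φ E k with hT
  set K := 2 ^ k with hK
  have hK0 : (0 : ℝ) < K := by rw [hK]; positivity
  set dev : ℕ → ℝ := fun j => ∑ t ∈ Finset.range T, ∑ s, G.law i E k (H.take t) j s *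
    G.expU i E k (H.take t) (φ s) with hdev
  set act : ℕ → ℝ := fun j => ∑ t ∈ Finset.range T, ∑ s, G.law i E k (H.take t) j s *
    G.expU i E k (H.take t) s with hact
  have hmix : ∀ ψ : Strategy n Φ → Strategy n Φ,
      ∑ t ∈ Finset.range T, ∑ s, G.mix i E k (H.take t) s * G.expU i E k (H.take t) (ψ s) =
      (∑ j ∈ Finset.range K, ∑ t ∈ Finset.range T, ∑ s, G.law i E k (H.take t) j s *
        G.expU i E k (H.take t) (ψ s)) / K := by
    intro ψ
    rw [Finset.sum_comm (s := Finset.range K), Finset.sum_div]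
    refine Finset.sum_congr rfl fun t _ => ?_
    rw [Finset.sum_comm (s := Finset.range K), Finset.sum_div]
    refine Finset.sum_congr rfl fun s _ => ?_
    rw [mix, ← Finset.sum_mul, hK]
    push_cast
    ring
  have h1 := hmix φ
  have h2 := hmix id
  simp only [id] at h2
  rw [h1, h2]
  have hact0 : ∀ j, 0 ≤ act j := fun j => Finset.sum_nonneg fun t _ => Finset.sum_nonneg
    fun s _ => mul_nonneg (G.law_nonneg i E k _ _ _) (G.expU_mem i E k _ _).1
  -- No learner lies below level 0, so only the trivial bound is available for its deviation.
  have hdev0 : dev 0 ≤ T := by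
    calc dev 0 ≤ ∑ t ∈ Finset.range T, ∑ s, G.law i E k (H.take t) 0 s :=
          Finset.sum_le_sum fun t _ => Finset.sum_le_sum fun s _ =>
            mul_le_of_le_one_right (G.law_nonneg i E k _ _ _) (G.expU_mem i E k _ _).2
      _ = T := by simp [G.sum_law]
  have hstep : ∀ j, j + 1 < K → dev (j + 1) ≤ act j + T * (3 / (4 * E)) := fun j hj =>
    G.deviation_le i hE hΦ hlen hH hj φ
  -- The deviation of level `j + 1` is charged to the payoff of level `j`. The payoff of the top
  -- level is not needed and is added at the end, being nonnegative.
  have hsum : ∀ N, N + 1 ≤ K → ∑ j ∈ Finset.range (N + 1), dev j ≤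
      T + ∑ j ∈ Finset.range N, act j + N * (T * (3 / (4 * E))) := by
    intro N
    induction N with
    | zero => intro _; simpa using hdev0
    | succ N ih =>
      intro hN
      rw [Finset.sum_range_succ dev (N + 1), Finset.sum_range_succ act N]
      have := ih (by omega)
      have := hstep N (by omega)
      push_cast
      linarith
  have hKpos : 1 ≤ K := Nat.two_pow_pos k
  have hfin := hsum (K - 1) (by omega)
  rw [Nat.sub_add_cancel hKpos] at hfin
  have hact' : ∑ j ∈ Finset.range (K - 1), act j ≤ ∑ j ∈ Finset.range K, act j :=
    Finset.sum_le_sum_of_subset_of_nonneg (Finset.range_subset_range.2 (by omega))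
      fun j _ _ => hact0 j
  have hTE : (0 : ℝ) ≤ T * (3 / (4 * E)) := by positivity
  have hK1 : ((K - 1 : ℕ) : ℝ) ≤ K := by exact_mod_cast Nat.sub_le _ _
  have h4 : (T : ℝ) ≤ K * (T * (1 / (4 * E))) := by
    have : (4 : ℝ) * E ≤ K := by exact_mod_cast hk
    calc (T : ℝ) = 4 * E * (T * (1 / (4 * E))) := by field_simp
      _ ≤ _ := by gcongr
  rw [div_le_iff₀ hK0, add_mul, div_mul_cancel₀ _ hK0.ne']
  calc ∑ j ∈ Finset.range K, dev j ≤ T + ∑ j ∈ Finset.range (K - 1), act j +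
        ((K - 1 : ℕ) : ℝ) * (T * (3 / (4 * E))) := hfin
    _ ≤ K * (T * (1 / (4 * E))) + ∑ j ∈ Finset.range K, act j + K * (T * (3 / (4 * E))) := by
        gcongr
    _ = _ := by
        simp only [hact]
        field_simp
        ring

end Game

end EFG

end

noncomputable section

namespace EFG

/-! ### Independent products -/

theorem indep_apply {α : Type} : ∀ {m : ℕ} (p : Fin m → PMF α) (f : Fin m → α),
    indep p f = ∏ i, p i (f i)
  | 0, p, f => by
    simp only [indep, Finset.univ_eq_empty, Finset.prod_empty]
    rw [PMF.pure_apply, if_pos (Subsingleton.elim _ _)]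
  | m + 1, p, f => by
    rw [indep, PMF.bind_apply, tsum_eq_single (f 0), Fin.prod_univ_succ]
    · congr 1
      rw [PMF.map_apply, tsum_eq_single (Fin.tail f)]
      · rw [if_pos (Fin.cons_self_tail f).symm, indep_apply]
        rfl
      · intro g hg
        rw [if_neg]
        intro e
        refine hg ?_
        rw [e, Fin.tail_cons]
    · intro x hx
      rw [PMF.map_apply, mul_eq_zero]
      right
      refine ENNReal.tsum_eq_zero.2 fun g => if_neg ?_
      rintro rfl
      exact hx rfl

theorem indep_map {α β : Type} (g : α → β) : ∀ {m : ℕ} (p : Fin m → PMF α),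
    indep (fun i => (p i).map g) = (indep p).map fun f i => g (f i)
  | 0, p => by
    simp only [indep, PMF.pure_map]
    congr 1
    exact Subsingleton.elim _ _
  | m + 1, p => by
    rw [indep, indep, PMF.bind_map, PMF.map_bind]
    refine congrArg _ (funext fun x => ?_)
    rw [Function.comp_apply, indep_map g, PMF.map_comp, PMF.map_comp]
    refine congrArg (fun F => PMF.map F _) (funext fun f => ?_)
    funext i
    refine Fin.cases ?_ (fun i => ?_) i
    · simp
    · simp

theorem mem_support_indep {α : Type} {m : ℕ} {p : Fin m → PMF α} {f : Fin m → α}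
    (hf : f ∈ (indep p).support) (i : Fin m) : f i ∈ (p i).support := by
  rw [PMF.mem_support_iff, indep_apply] at hf
  rw [PMF.mem_support_iff]
  exact Finset.prod_ne_zero_iff.1 hf i (Finset.mem_univ i)

section

variable {m n Φ : ℕ} [NeZero n] (G : Game m n Φ) {E k : ℕ}

theorem indep_mixed_toReal (hE : 1 ≤ E) (hΦ : 1 ≤ Φ) {H : List (Profile m n Φ)}
    (hH : H.length ≤ days m n Φ E k) (σ : Profile m n Φ) :
    (indep (fun i => (dynamics E k).mixed G i H) σ).toReal = ∏ i, G.mix i E k H (σ i) := by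
  rw [indep_apply, ENNReal.toReal_prod]
  exact Finset.prod_congr rfl fun i _ => mixed_toReal G i hE hΦ hH (σ i)

theorem output_toReal (hE : 1 ≤ E) (hΦ : 1 ≤ Φ) {H : List (Profile m n Φ)} (hpos : 0 < H.length)
    (hH : H.length ≤ days m n Φ E k) (σ : Profile m n Φ) :
    ((dynamics E k).output G H hpos σ).toReal =
      (∑ t ∈ Finset.range H.length, ∏ i, G.mix i E k (H.take t) (σ i)) / H.length := by
  rw [Dynamics.output, PMF.bind_apply, tsum_eq_sum (s := Finset.range H.length)]
  · rw [ENNReal.toReal_sum, Finset.sum_div]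
    · refine Finset.sum_congr rfl fun t ht => ?_
      rw [PMF.uniformOfFinset_apply_of_mem _ ht, ENNReal.toReal_mul, ENNReal.toReal_inv,
        ENNReal.toReal_natCast, Finset.card_range,
        indep_mixed_toReal G hE hΦ ((List.length_take_le' _ _).trans hH)]
      ring
    · intro t _
      exact ENNReal.mul_ne_top (PMF.apply_ne_top _ _) (PMF.apply_ne_top _ _)
  · intro t ht
    rw [PMF.uniformOfFinset_apply_of_notMem _ ht, zero_mul]

/-- Concentration implies that the empirical distribution is an approximate equilibrium. -/
theorem isNFCE_of_concentrated (hE : 1 ≤ E) (hΦ : 1 ≤ Φ) (hk : 4 * E ≤ 2 ^ k)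
    {H : List (Profile m n Φ)} (hlen : H.length = days m n Φ E k) (hpos : 0 < H.length)
    (hH : G.Concentrated E k H) {ε : ℝ} (hε : 1 / (E : ℝ) ≤ ε) :
    G.IsNFCE ε ((dynamics E k).output G H hpos) := by
  intro i φ
  have hT : (0 : ℝ) < H.length := by exact_mod_cast hpos
  -- The own strategy is independent of the others on each day, so its law can be separated by
  -- `sum_prod_resample`. What remains is `expU`, which ignores the own coordinate of the profile.
  have key : ∀ ψ : Strategy n Φ → Strategy n Φ,
      ∑ σ, ((dynamics E k).output G H hpos σ).toReal * G.u i (Function.update σ i (ψ (σ i))) =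
      (∑ t ∈ Finset.range H.length, ∑ s, G.mix i E k (H.take t) s *
        G.expU i E k (H.take t) (ψ s)) / H.length := by
    intro ψ
    simp only [output_toReal G hE hΦ hpos hlen.le]
    have h1 : ∀ t, ∑ σ : Profile m n Φ, (∏ j, G.mix j E k (H.take t) (σ j)) *
        G.u i (Function.update σ i (ψ (σ i))) =
        ∑ s, G.mix i E k (H.take t) s * G.expU i E k (H.take t) (ψ s) := fun t =>
      sum_prod_resample (fun j => G.mix j E k (H.take t)) (fun j => G.sum_mix j E k _) i
        (fun a σ => G.u i (Function.update σ i (ψ a))) fun a s b => by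
          rw [Function.update_idem]
    simp only [← h1]
    rw [Finset.sum_comm, Finset.sum_div]
    refine Finset.sum_congr rfl fun σ _ => ?_
    rw [← Finset.sum_mul]
    ring
  have h1 := key φ
  have h2 := key id
  simp only [id, Function.update_eq_self] at h2
  rw [h1, h2, ge_iff_le, sub_le_iff_le_add]
  have h3 := G.swap_regret i hE hΦ hk hlen hH φ
  rw [← hlen] at h3
  rw [div_le_iff₀ hT, add_mul, div_mul_cancel₀ _ hT.ne', mul_comm ε]
  refine h3.trans (add_le_add_right ?_ _)
  exact mul_le_mul_of_nonneg_left hε hT.le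

/-! ### The history of play -/

/-- The law of the history of the first `T` days. -/
def history (E k : ℕ) (G : Game m n Φ) (T : ℕ) : PMF (List (Profile m n Φ)) :=
  ((dynamics E k).play G T).map Prod.fst

/-- Running times do not influence later moves, and forgetting them commutes with the independent
product (`indep_map`). -/
theorem history_succ (T : ℕ) : history E k G (T + 1) = (history E k G T).bind fun H =>
    (indep fun i => (dynamics E k).mixed G i H).map fun f => H ++ [f] := by
  rw [history, Dynamics.play, PMF.map_bind, history, PMF.bind_map]
  refine congrArg _ (funext fun r => ?_)
  rw [Function.comp_apply, PMF.map_comp]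
  simp only [Dynamics.mixed]
  rw [indep_map, PMF.map_comp]
  rfl

theorem play_support (hE : 1 ≤ E) (hΦ : 1 ≤ Φ) : ∀ {T : ℕ}, T ≤ days m n Φ E k →
    ∀ r ∈ ((dynamics E k).play G T).support, r.1.length = T ∧
      r.2 ≤ T * (m * ((sizeBound m n Φ E k + 2) ^ degree + Φ * n.size)) := by
  intro T
  induction T with
  | zero =>
    intro _ r hr
    rw [Dynamics.play, PMF.support_pure, Set.mem_singleton_iff] at hr
    subst hr
    simp
  | succ T ih =>
    intro hT r hr
    rw [Dynamics.play, PMF.mem_support_bind_iff] at hr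
    obtain ⟨r', hr', hr⟩ := hr
    rw [PMF.mem_support_map_iff] at hr
    obtain ⟨f, hf, rfl⟩ := hr
    obtain ⟨h1, h2⟩ := ih (by omega) r' hr'
    refine ⟨by simp [h1], ?_⟩
    have h3 : ∑ i, (f i).2 ≤ m * ((sizeBound m n Φ E k + 2) ^ degree + Φ * n.size) := by
      calc _ ≤ ∑ _i : Fin m, ((sizeBound m n Φ E k + 2) ^ degree + Φ * n.size) :=
            Finset.sum_le_sum fun i _ => move_time_le G i hE hΦ (by omega)
              (mem_support_indep hf i)
        _ = _ := by simp
    simp only [add_mul, one_mul]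
    exact Nat.add_le_add h2 h3

end

end EFG

end

noncomputable section

namespace EFG

/-! ### Expectations with respect to discrete distributions -/

theorem tsum_bind_mul {α β : Type*} (p : PMF α) (q : α → PMF β) (F : β → ENNReal) :
    ∑' b, (p.bind q) b * F b = ∑' a, p a * ∑' b, q a b * F b := by
  simp only [PMF.bind_apply, ← ENNReal.tsum_mul_right, ← ENNReal.tsum_mul_left]
  rw [ENNReal.tsum_comm]
  simp only [mul_assoc]

theorem tsum_map_mul {α β : Type*} (p : PMF α) (g : α → β) (F : β → ENNReal) :
    ∑' b, (p.map g) b * F b = ∑' a, p a * F (g a) := by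
  rw [← PMF.bind_pure_comp, tsum_bind_mul]
  refine tsum_congr fun a => ?_
  rw [tsum_eq_single (g a)]
  · simp
  · intro b hb
    simp [hb]

/-- Markov's inequality. -/
theorem toOuterMeasure_le_tsum {α : Type*} (p : PMF α) (S : Set α) (F : α → ENNReal)
    (hF : ∀ a ∈ p.support, a ∈ S → 1 ≤ F a) : p.toOuterMeasure S ≤ ∑' a, p a * F a := by
  rw [PMF.toOuterMeasure_apply]
  refine ENNReal.tsum_le_tsum fun a => ?_
  by_cases ha : a ∈ S
  · rw [Set.indicator_of_mem ha]
    by_cases h0 : p a = 0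
    · simp [h0]
    · exact le_mul_of_one_le_right zero_le (hF a ((PMF.mem_support_iff _ _).2 h0) ha)
  · rw [Set.indicator_of_notMem ha]
    exact zero_le

theorem exp_le_one_add_add_sq {x : ℝ} (hx : |x| ≤ 1) : Real.exp x ≤ 1 + x + x ^ 2 := by
  have := (abs_le.1 (Real.abs_exp_sub_one_sub_id_le hx)).2
  linarith

section

variable {m n Φ : ℕ} [NeZero n] (G : Game m n Φ) {E k : ℕ}

/-- One day of the supermartingale. -/
theorem sum_exp_le (i : Fin m) (s : Strategy n Φ) (H : List (Profile m n Φ)) {c : ℝ}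
    (hc : |c| ≤ 1) : ∑ f : Profile m n Φ, (∏ j, G.mix j E k H (f j)) *
      Real.exp (c * (G.u i (Function.update f i s) - G.expU i E k H s)) ≤ Real.exp (c ^ 2) := by
  have h0 : ∀ σ : Profile m n Φ, 0 ≤ ∏ j, G.mix j E k H (σ j) := fun σ =>
    Finset.prod_nonneg fun j _ => G.mix_nonneg j E k H _
  have h1 : ∑ σ : Profile m n Φ, ∏ j, G.mix j E k H (σ j) = 1 :=
    sum_prod_eq_one _ fun j => G.sum_mix j E k H
  have hX : ∀ f : Profile m n Φ,
      |G.u i (Function.update f i s) - G.expU i E k H s| ≤ 1 := by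
    intro f
    have h2 := G.u_mem_Icc i (Function.update f i s)
    have h3 := G.expU_mem i E k H s
    rw [abs_le]
    constructor <;> linarith [h2.1, h2.2, h3.1, h3.2]
  calc _ ≤ ∑ f : Profile m n Φ, (∏ j, G.mix j E k H (f j)) *
        (1 + c * (G.u i (Function.update f i s) - G.expU i E k H s) + c ^ 2) := by
        refine Finset.sum_le_sum fun f _ => mul_le_mul_of_nonneg_left ?_ (h0 f)
        have hcX : |c * (G.u i (Function.update f i s) - G.expU i E k H s)| ≤ 1 := by
          rw [abs_mul]
          exact mul_le_one₀ hc (abs_nonneg _) (hX f)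
        refine (exp_le_one_add_add_sq hcX).trans ?_
        have : (G.u i (Function.update f i s) - G.expU i E k H s) ^ 2 ≤ 1 :=
          (sq_le_one_iff_abs_le_one _).2 (hX f)
        rw [mul_pow]
        nlinarith [sq_nonneg c]
    _ = (1 + c ^ 2) * ∑ f : Profile m n Φ, (∏ j, G.mix j E k H (f j)) +
        c * (∑ f : Profile m n Φ, (∏ j, G.mix j E k H (f j)) *
          G.u i (Function.update f i s) -
          (∑ f : Profile m n Φ, (∏ j, G.mix j E k H (f j))) * G.expU i E k H s) := by
        rw [Finset.sum_mul, ← Finset.sum_sub_distrib, Finset.mul_sum, Finset.mul_sum,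
          ← Finset.sum_add_distrib]
        refine Finset.sum_congr rfl fun f _ => ?_
        ring
    -- The first-order term vanishes, because `expU` is the mean of the payoff.
    _ = 1 + c ^ 2 := by
        rw [h1, Game.expU]
        ring
    _ ≤ Real.exp (c ^ 2) := by
        rw [add_comm]
        exact Real.add_one_le_exp _

theorem history_support (hE : 1 ≤ E) (hΦ : 1 ≤ Φ) {T : ℕ} (hT : T ≤ days m n Φ E k)
    {H : List (Profile m n Φ)} (hH : H ∈ (history E k G T).support) : H.length = T := by
  rw [history, PMF.mem_support_map_iff] at hH
  obtain ⟨r, hr, rfl⟩ := hH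
  exact (play_support G hE hΦ hT r hr).1

/-- The exponential moments of a weighted sum of the deviations from the mean. -/
theorem exp_moment_le (hE : 1 ≤ E) (hΦ : 1 ≤ Φ) (i : Fin m) (s : Strategy n Φ) (c : ℕ → ℝ)
    (hc : ∀ d, |c d| ≤ 1) : ∀ {T : ℕ}, T ≤ days m n Φ E k →
    ∑' H, history E k G T H * ENNReal.ofReal (Real.exp (∑ d ∈ Finset.range T,
      c d * (G.dayU i H d s - G.expU i E k (H.take d) s))) ≤
      ENNReal.ofReal (Real.exp (∑ d ∈ Finset.range T, c d ^ 2)) := by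
  intro T
  induction T with
  | zero =>
    intro _
    simp only [Finset.range_zero, Finset.sum_empty, Real.exp_zero, ENNReal.ofReal_one, mul_one]
    exact (PMF.tsum_coe _).le
  | succ T ih =>
    intro hT
    rw [history_succ, tsum_bind_mul]
    have hstep : ∀ H, history E k G T H * ∑' b, ((indep fun i =>
        (dynamics E k).mixed G i H).map fun f => H ++ [f]) b *
        ENNReal.ofReal (Real.exp (∑ d ∈ Finset.range (T + 1),
          c d * (G.dayU i b d s - G.expU i E k (b.take d) s))) ≤
        history E k G T H * (ENNReal.ofReal (Real.exp (∑ d ∈ Finset.range T,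
          c d * (G.dayU i H d s - G.expU i E k (H.take d) s))) *
          ENNReal.ofReal (Real.exp (c T ^ 2))) := by
      intro H
      by_cases h0 : history E k G T H = 0
      · simp [h0]
      have hlen := history_support G hE hΦ (by omega) ((PMF.mem_support_iff _ _).2 h0)
      refine mul_le_mul_right ?_ _
      rw [tsum_map_mul, tsum_fintype]
      -- Appending a day leaves the terms of the earlier days unchanged, so conditioning on `H`
      -- isolates a single new factor.
      have hsum : ∀ f, ∑ d ∈ Finset.range (T + 1),
          c d * (G.dayU i (H ++ [f]) d s - G.expU i E k ((H ++ [f]).take d) s) =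
          ∑ d ∈ Finset.range T, c d * (G.dayU i H d s - G.expU i E k (H.take d) s) +
          c T * (G.u i (Function.update f i s) - G.expU i E k H s) := by
        intro f
        rw [Finset.sum_range_succ]
        congr 1
        · refine Finset.sum_congr rfl fun d hd => ?_
          rw [Finset.mem_range] at hd
          have e1 : Game.dayOf (H ++ [f]) d = Game.dayOf H d := by
            rw [Game.dayOf, Game.dayOf, List.getD_append _ _ _ _ (by omega)]
          rw [List.take_append_of_le_length (by omega), Game.dayU, Game.dayU, e1]
        · have e1 : Game.dayOf (H ++ [f]) T = f := by
            rw [Game.dayOf, List.getD_append_right _ _ _ _ (by omega), hlen]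
            simp
          have e2 : (H ++ [f]).take T = H := by
            rw [List.take_append_of_le_length (by omega), List.take_of_length_le (by omega)]
          rw [e2, Game.dayU, e1]
      have hmix : ∀ f, indep (fun i => (dynamics E k).mixed G i H) f =
          ENNReal.ofReal (∏ j, G.mix j E k H (f j)) := by
        intro f
        rw [← indep_mixed_toReal G hE hΦ (by omega), ENNReal.ofReal_toReal
          (PMF.apply_ne_top _ _)]
      have h0 : ∀ σ : Profile m n Φ, 0 ≤ ∏ j, G.mix j E k H (σ j) := fun σ =>
        Finset.prod_nonneg fun j _ => G.mix_nonneg j E k H _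
      calc _ = ENNReal.ofReal (∑ f : Profile m n Φ, (∏ j, G.mix j E k H (f j)) *
            (Real.exp (∑ d ∈ Finset.range T,
              c d * (G.dayU i H d s - G.expU i E k (H.take d) s)) *
            Real.exp (c T * (G.u i (Function.update f i s) - G.expU i E k H s)))) := by
            rw [ENNReal.ofReal_sum_of_nonneg fun f _ => mul_nonneg (h0 f) (by positivity)]
            refine Finset.sum_congr rfl fun f _ => ?_
            rw [hmix, hsum, ← ENNReal.ofReal_mul (h0 f), Real.exp_add]
        _ ≤ ENNReal.ofReal (Real.exp (∑ d ∈ Finset.range T,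
              c d * (G.dayU i H d s - G.expU i E k (H.take d) s)) * Real.exp (c T ^ 2)) := by
            refine ENNReal.ofReal_le_ofReal ?_
            have := mul_le_mul_of_nonneg_left (sum_exp_le G (E := E) (k := k) i s H (hc T))
              (Real.exp_pos (∑ d ∈ Finset.range T,
                c d * (G.dayU i H d s - G.expU i E k (H.take d) s))).le
            refine le_trans (le_of_eq ?_) this
            rw [Finset.mul_sum]
            refine Finset.sum_congr rfl fun f _ => ?_
            ring
        _ = _ := ENNReal.ofReal_mul (Real.exp_pos _).le
    calc _ ≤ ∑' H, history E k G T H * (ENNReal.ofReal (Real.exp (∑ d ∈ Finset.range T,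
          c d * (G.dayU i H d s - G.expU i E k (H.take d) s))) *
          ENNReal.ofReal (Real.exp (c T ^ 2))) := ENNReal.tsum_le_tsum hstep
      _ = (∑' H, history E k G T H * ENNReal.ofReal (Real.exp (∑ d ∈ Finset.range T,
          c d * (G.dayU i H d s - G.expU i E k (H.take d) s)))) *
          ENNReal.ofReal (Real.exp (c T ^ 2)) := by
          rw [← ENNReal.tsum_mul_right]
          simp only [mul_assoc]
      _ ≤ ENNReal.ofReal (Real.exp (∑ d ∈ Finset.range T, c d ^ 2)) *
          ENNReal.ofReal (Real.exp (c T ^ 2)) := mul_le_mul_left (ih (by omega)) _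
      _ = _ := by
          rw [← ENNReal.ofReal_mul (Real.exp_pos _).le, ← Real.exp_add, Finset.sum_range_succ]

end

end EFG

end

/-! ### Concentration, the success probability and the total time -/

noncomputable section

namespace EFG

section

variable {m n Φ : ℕ} [NeZero n] (G : Game m n Φ) {E k : ℕ}

/-- Concentration of the payoff of one strategy of one player in one group of days. -/
theorem tail_le (hE : 1 ≤ E) (hΦ : 1 ≤ Φ) (i : Fin m) (s : Strategy n Φ) {g : ℕ}
    (hg : g < rounds n Φ E ^ 2 ^ k) {ς : ℝ} (hς : ς ^ 2 = 1) :
    (history E k G (days m n Φ E k)).toOuterMeasure {H | (reps m n Φ E k : ℝ) / (16 * E) <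
      ς * ∑ e ∈ Finset.range (reps m n Φ E k), (G.dayU i H (g * reps m n Φ E k + e) s -
        G.expU i E k (H.take (g * reps m n Φ E k + e)) s)} ≤
      ENNReal.ofReal (Real.exp (-(reps m n Φ E k / (1024 * E ^ 2)))) := by
  set R := reps m n Φ E k with hR
  have hE1 : (1 : ℝ) ≤ E := by exact_mod_cast hE
  have hς1 : |ς| = 1 := by
    rw [← sq_eq_sq₀ (abs_nonneg _) zero_le_one, sq_abs, hς, one_pow]
  -- Weights that vanish outside the group `g` let the moment bound for the whole history speak
  -- about this group alone. The value `1 / (32 * E)` minimizes `c ^ 2 - c / (16 * E)`, and the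
  -- minimum is `-1 / (1024 * E ^ 2)`.
  set c : ℕ → ℝ := fun d => if d / R = g then ς * (1 / (32 * E)) else 0 with hc
  have hc1 : ∀ d, |c d| ≤ 1 := by
    intro d
    simp only [hc]
    split_ifs
    · rw [abs_mul, hς1, one_mul, abs_of_nonneg (by positivity), div_le_one (by positivity)]
      linarith
    · simp
  have hsplit : ∀ f : ℕ → ℝ → ℝ, (∀ d, f d 0 = 0) → ∑ d ∈ Finset.range (days m n Φ E k), f d (c d) =
      ∑ e ∈ Finset.range R, f (g * R + e) (ς * (1 / (32 * E))) := by
    intro f hf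
    rw [days, mul_comm, sum_range_blocks, Finset.sum_eq_single g]
    · refine Finset.sum_congr rfl fun e he => ?_
      rw [Finset.mem_range] at he
      have : (g * R + e) / R = g := by
        rw [mul_comm, Nat.mul_add_div (by omega), Nat.div_eq_of_lt he, add_zero]
      simp only [hc]
      rw [if_pos this]
    · intro r _ hrg
      refine Finset.sum_eq_zero fun e he => ?_
      rw [Finset.mem_range] at he
      have : (r * R + e) / R = r := by
        rw [mul_comm, Nat.mul_add_div (by omega), Nat.div_eq_of_lt he, add_zero]
      simp only [hc]
      rw [← hR, this, if_neg hrg, hf]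
    · intro h
      exact absurd (Finset.mem_range.2 hg) h
  have hmom := exp_moment_le G (k := k) hE hΦ i s c hc1 le_rfl
  have e1 : ∑ d ∈ Finset.range (days m n Φ E k), c d ^ 2 = R / (1024 * E ^ 2) := by
    rw [hsplit (fun _ x => x ^ 2) (by simp), Finset.sum_const, Finset.card_range, mul_pow, hς]
    simp
    ring
  have e2 : ∀ H : List (Profile m n Φ), ∑ d ∈ Finset.range (days m n Φ E k),
      c d * (G.dayU i H d s - G.expU i E k (H.take d) s) = 1 / (32 * E) *
        (ς * ∑ e ∈ Finset.range R, (G.dayU i H (g * R + e) s -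
          G.expU i E k (H.take (g * R + e)) s)) := by
    intro H
    rw [hsplit (fun d x => x * (G.dayU i H d s - G.expU i E k (H.take d) s)) (by simp),
      ← Finset.mul_sum]
    ring
  rw [e1] at hmom
  simp only [e2] at hmom
  have e3 : -((R : ℝ) / (1024 * E ^ 2)) =
      R / (1024 * E ^ 2) + -(1 / (32 * E) * (R / (16 * E))) := by
    field_simp
    ring
  rw [e3, Real.exp_add, ENNReal.ofReal_mul (Real.exp_pos _).le]
  refine le_trans ?_ (mul_le_mul_left hmom _)
  rw [← ENNReal.tsum_mul_right]
  simp only [mul_assoc]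
  refine toOuterMeasure_le_tsum _ _ _ fun H _ hH => ?_
  rw [Set.mem_ofPred_eq] at hH
  rw [← ENNReal.ofReal_mul (Real.exp_pos _).le, ← Real.exp_add, ENNReal.one_le_ofReal,
    Real.one_le_exp_iff]
  have : (0 : ℝ) < 1 / (32 * E) := by positivity
  nlinarith

/-- Union bound over the players, their pure strategies, the groups of days and the two signs of the
deviation. -/
theorem not_concentrated_le (hE : 1 ≤ E) (hΦ : 1 ≤ Φ) :
    (history E k G (days m n Φ E k)).toOuterMeasure {H | ¬ G.Concentrated E k H} ≤
      ENNReal.ofReal (m * (n ^ Φ * (rounds n Φ E ^ 2 ^ k * 2)) *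
        Real.exp (-(reps m n Φ E k / (1024 * E ^ 2)))) := by
  set R := reps m n Φ E k with hR
  set B : Fin m × Strategy n Φ × Fin (rounds n Φ E ^ 2 ^ k) × Bool → Set (List (Profile m n Φ)) :=
    fun p => {H | (R : ℝ) / (16 * E) < (if p.2.2.2 then 1 else -1 : ℝ) *
      ∑ e ∈ Finset.range R, (G.dayU p.1 H (p.2.2.1 * R + e) p.2.1 -
        G.expU p.1 E k (H.take (p.2.2.1 * R + e)) p.2.1)} with hB
  have hsub : {H | ¬ G.Concentrated E k H} ⊆ ⋃ p, B p := by
    intro H hH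
    rw [Set.mem_ofPred_eq, Game.Concentrated] at hH
    push Not at hH
    obtain ⟨i, s, g, hg, h⟩ := hH
    rw [Set.mem_iUnion]
    rcases lt_abs.1 h with h | h
    · exact ⟨(i, s, ⟨g, hg⟩, true), by simpa [hB] using h⟩
    · refine ⟨(i, s, ⟨g, hg⟩, false), ?_⟩
      simp only [hB, Set.mem_ofPred_eq]
      rw [if_neg (by simp), neg_one_mul]
      exact h
  refine (MeasureTheory.measure_mono hsub).trans ((MeasureTheory.measure_iUnion_le _).trans ?_)
  rw [tsum_fintype]
  calc _ ≤ ∑ _p : Fin m × Strategy n Φ × Fin (rounds n Φ E ^ 2 ^ k) × Bool,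
        ENNReal.ofReal (Real.exp (-(R / (1024 * E ^ 2)))) := by
        refine Finset.sum_le_sum fun p _ => ?_
        exact tail_le G hE hΦ p.1 p.2.1 p.2.2.1.2 (by split_ifs <;> norm_num)
    _ = _ := by
        rw [Finset.sum_const, Finset.card_univ, nsmul_eq_mul, ENNReal.ofReal_mul (by positivity)]
        congr 1
        rw [← ENNReal.ofReal_natCast]
        congr 1
        simp

/-- With `N = K * m * n * Φ * M`, the choice of `reps` makes the exponent exactly `-5 * N`. Each of
the five factors `m`, `n ^ Φ`, `M ^ K`, `2` and `2 ^ (m * n * Φ)` is at most `exp N`. -/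
theorem failure_le (hm : 1 ≤ m) (hn : 1 ≤ n) (hE : 1 ≤ E) (hΦ : 1 ≤ Φ) :
    (m * (n ^ Φ * (rounds n Φ E ^ 2 ^ k * 2)) *
        Real.exp (-(reps m n Φ E k / (1024 * E ^ 2))) : ℝ) ≤ 1 / 2 ^ (m * n * Φ) := by
  have hM := one_le_rounds hn hΦ hE
  have hE1 : (1 : ℝ) ≤ E := by exact_mod_cast hE
  set M := rounds n Φ E with hMdef
  set K := 2 ^ k with hK
  have hK1 : 1 ≤ K := Nat.two_pow_pos k
  set N := K * m * n * Φ * M with hN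
  have hR : (reps m n Φ E k : ℝ) / (1024 * E ^ 2) = 5 * N := by
    rw [reps, ← hMdef, ← hK, hN]
    push_cast
    field_simp
    ring
  have h1 : (m : ℝ) ≤ Real.exp N := by
    have : m ≤ N := by
      calc m = 1 * m * 1 * 1 * 1 := by ring
        _ ≤ N := by rw [hN]; gcongr
    refine le_trans ?_ ((Real.add_one_le_exp (N : ℝ)))
    have : (m : ℝ) ≤ N := by exact_mod_cast this
    linarith
  have h2 : (n : ℝ) ^ Φ ≤ Real.exp N := by
    have h3 : n * Φ ≤ N := by
      calc n * Φ = 1 * 1 * n * Φ * 1 := by ring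
        _ ≤ N := by rw [hN]; gcongr
    have h4 : (n : ℝ) ≤ Real.exp n := by linarith [Real.add_one_le_exp (n : ℝ)]
    calc (n : ℝ) ^ Φ ≤ Real.exp n ^ Φ := by gcongr
      _ = Real.exp (n * Φ : ℕ) := by rw [← Real.exp_nat_mul]; push_cast; ring_nf
      _ ≤ _ := Real.exp_le_exp.2 (by exact_mod_cast h3)
  have h5 : (M : ℝ) ^ K ≤ Real.exp N := by
    have h3 : M * K ≤ N := by
      calc M * K = K * 1 * 1 * 1 * M := by ring
        _ ≤ N := by rw [hN]; gcongr
    have h4 : (M : ℝ) ≤ Real.exp M := by linarith [Real.add_one_le_exp (M : ℝ)]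
    calc (M : ℝ) ^ K ≤ Real.exp M ^ K := by gcongr
      _ = Real.exp (M * K : ℕ) := by rw [← Real.exp_nat_mul]; push_cast; ring_nf
      _ ≤ _ := Real.exp_le_exp.2 (by exact_mod_cast h3)
  have h6 : (2 : ℝ) ≤ Real.exp N := by
    have : 1 ≤ N := by
      rw [hN]
      exact Nat.mul_pos (Nat.mul_pos (Nat.mul_pos (Nat.mul_pos hK1 hm) hn) hΦ) hM
    have h7 : (1 : ℝ) ≤ N := by exact_mod_cast this
    linarith [Real.add_one_le_exp (N : ℝ)]
  have h8 : (2 : ℝ) ^ (m * n * Φ) ≤ Real.exp N := by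
    have h3 : m * n * Φ ≤ N := by
      calc m * n * Φ = 1 * m * n * Φ * 1 := by ring
        _ ≤ N := by rw [hN]; gcongr
    have h4 : (2 : ℝ) ≤ Real.exp 1 := by linarith [Real.add_one_le_exp (1 : ℝ)]
    calc (2 : ℝ) ^ (m * n * Φ) ≤ Real.exp 1 ^ (m * n * Φ) := by gcongr
      _ = Real.exp (m * n * Φ : ℕ) := by rw [← Real.exp_nat_mul, mul_one]
      _ ≤ _ := Real.exp_le_exp.2 (by exact_mod_cast h3)
  rw [hR, le_div_iff₀ (by positivity)]
  calc _ ≤ Real.exp N * (Real.exp N * (Real.exp N * Real.exp N)) * Real.exp (-(5 * N)) *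
        Real.exp N := by gcongr
    _ = 1 := by
        rw [← Real.exp_add, ← Real.exp_add, ← Real.exp_add, ← Real.exp_add, ← Real.exp_add,
          Real.exp_eq_one_iff]
        ring

/-- The total time of the dynamics. -/
def timeBound (m n Φ E k : ℕ) : ℕ :=
  (sizeBound m n Φ E k + 2) ^ degree +
    days m n Φ E k * (m * ((sizeBound m n Φ E k + 2) ^ degree + Φ * n.size))

/-- The program for the horizon tosses no coins, so its result and its running time are
deterministic. -/
theorem run_eq (hm : 1 ≤ m) (hn : 1 ≤ n) (hE : 1 ≤ E) (hΦ : 1 ≤ Φ) :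
    ∃ t ≤ (sizeBound m n Φ E k + 2) ^ degree, (dynamics E k).run G =
      ((dynamics E k).play G (days m n Φ E k)).map fun x => (x.1, t + x.2) := by
  obtain ⟨μ, t, h1, h2, h3⟩ := horizon_exec (k := k) hm hn hE hΦ
  refine ⟨t, h3, ?_⟩
  rw [Dynamics.run]
  change (((horizonCmd E k).exec _ _).bind _) = _
  rw [h1, PMF.pure_bind]
  simp only [h2]

theorem run_time_le (hm : 1 ≤ m) (hn : 1 ≤ n) (hE : 1 ≤ E) (hΦ : 1 ≤ Φ)
    {r : List (Profile m n Φ) × ℕ} (hr : r ∈ ((dynamics E k).run G).support) :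
    r.2 ≤ timeBound m n Φ E k := by
  obtain ⟨t, ht, h⟩ := run_eq G (k := k) hm hn hE hΦ
  rw [h, PMF.mem_support_map_iff] at hr
  obtain ⟨x, hx, rfl⟩ := hr
  exact Nat.add_le_add ht (play_support G hE hΦ le_rfl x hx).2

theorem success_ge (hm : 1 ≤ m) (hn : 1 ≤ n) (hE : 1 ≤ E) (hΦ : 1 ≤ Φ) (hk : 4 * E ≤ 2 ^ k)
    {ε : ℝ} (hε : 1 / (E : ℝ) ≤ ε) :
    1 - 1 / (2 : ℝ) ^ (m * n * Φ) ≤ (((dynamics E k).run G).toOuterMeasure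
      {r | ∃ hr : 0 < r.1.length, G.IsNFCE ε ((dynamics E k).output G r.1 hr)}).toReal := by
  obtain ⟨t, ht, h⟩ := run_eq G (k := k) hm hn hE hΦ
  set p := (dynamics E k).run G with hp
  set S : Set (List (Profile m n Φ) × ℕ) :=
    {r | ∃ hr : 0 < r.1.length, G.IsNFCE ε ((dynamics E k).output G r.1 hr)} with hS
  set B : Set (List (Profile m n Φ) × ℕ) := {r | ¬ G.Concentrated E k r.1} with hB
  -- Only the support matters: on it the history has full length, and a concentrated history yields
  -- an equilibrium. Subadditivity then bounds the probability of `S` from below.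
  have hcover : p.support ⊆ S ∪ B := by
    intro r hr
    rw [h, PMF.mem_support_map_iff] at hr
    obtain ⟨x, hx, rfl⟩ := hr
    have hlen := (play_support G hE hΦ le_rfl x hx).1
    by_cases hc : G.Concentrated E k x.1
    · left
      have hpos : 0 < x.1.length := by
        rw [hlen]
        have h2k := Nat.two_pow_pos k
        have := (le_reps (k := k) hm hn hΦ hE).trans (reps_le_days hn hΦ hE)
        have h1 : 0 < 5120 * (E * E) * 2 ^ k := by positivity
        omega
      exact ⟨hpos, isNFCE_of_concentrated G hE hΦ hk hlen hpos hc hε⟩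
    · right
      exact hc
  have h1 : p.toOuterMeasure (S ∪ B) = 1 := (PMF.toOuterMeasure_apply_eq_one_iff _ _).2 hcover
  have h2 : p.toOuterMeasure (S ∪ B) ≤ p.toOuterMeasure S + p.toOuterMeasure B :=
    MeasureTheory.measure_union_le _ _
  have h3 : p.toOuterMeasure B ≤ ENNReal.ofReal (1 / 2 ^ (m * n * Φ)) := by
    rw [h, PMF.toOuterMeasure_map_apply]
    have h4 := not_concentrated_le G (k := k) hE hΦ
    rw [history, PMF.toOuterMeasure_map_apply] at h4
    exact h4.trans (ENNReal.ofReal_le_ofReal (failure_le hm hn hE hΦ))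
  have hSle : p.toOuterMeasure S ≤ 1 := by
    rw [← h1]
    exact MeasureTheory.measure_mono Set.subset_union_left
  have hSfin : p.toOuterMeasure S ≠ ⊤ := ne_top_of_le_ne_top ENNReal.one_ne_top hSle
  have h5 : (1 : ENNReal) ≤ ENNReal.ofReal ((p.toOuterMeasure S).toReal + 1 / 2 ^ (m * n * Φ)) := by
    rw [ENNReal.ofReal_add ENNReal.toReal_nonneg (by positivity), ENNReal.ofReal_toReal hSfin]
    exact (h1 ▸ h2).trans (add_le_add_right h3 _)
  rw [ENNReal.one_le_ofReal] at h5
  linarith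

end

end EFG

end

noncomputable section

namespace EFG

/-! ### The running time -/

/-- Apart from `rounds ^ 2 ^ k`, every parameter is at most a fixed power of `V = m * n * p`.
Numerical constants are absorbed into further powers, since `V ≥ 4`. -/
theorem timeBound_le {m n Φ E k p : ℕ} (hm : 1 ≤ m) (hn : 2 ≤ n) (hΦ : 1 ≤ Φ) (hE : 1 ≤ E)
    (hp : 2 ≤ p) (hΦp : Φ ≤ p) (hEp : E ≤ p) (hk : 2 ^ k ≤ 8 * p) (hM : rounds n Φ E ≤ p ^ 16) :
    timeBound m n Φ E k ≤
      ((m * n * p) ^ 44 * rounds n Φ E ^ 2 ^ k) ^ (degree + 4) := by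
  rw [timeBound]
  generalize degree = d
  set V := m * n * p with hV
  have hmV : m ≤ V := by
    calc m = m * 1 * 1 := by ring
      _ ≤ V := by rw [hV]; gcongr <;> omega
  have hnV : n ≤ V := by
    calc n = 1 * n * 1 := by ring
      _ ≤ V := by rw [hV]; gcongr; omega
  have hpV : p ≤ V := by
    calc p = 1 * 1 * p := by ring
      _ ≤ V := by rw [hV]; gcongr; omega
  have hV4 : 4 ≤ V := by
    calc 4 = 1 * 2 * 2 := by norm_num
      _ ≤ V := by rw [hV]; gcongr
  have hV1 : 1 ≤ V := by omega
  have hpow : ∀ {a b : ℕ}, a ≤ b → V ^ a ≤ V ^ b := fun h => Nat.pow_le_pow_right hV1 h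
  have c3 : 64 ≤ V ^ 3 := le_trans (by norm_num) (Nat.pow_le_pow_left hV4 3)
  have c2 : 16 ≤ V ^ 2 := le_trans (by norm_num) (Nat.pow_le_pow_left hV4 2)
  have c7 : 5120 ≤ V ^ 7 := le_trans (by norm_num) (Nat.pow_le_pow_left hV4 7)
  have hΦV := hΦp.trans hpV
  have hEV := hEp.trans hpV
  have htarget : target n Φ E ≤ V ^ 6 := by
    calc target n Φ E ≤ V ^ 3 * V * V * V := by rw [target]; gcongr; omega
      _ = V ^ 6 := by ring
  have hprec : prec n Φ E ≤ V ^ 7 := by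
    calc prec n Φ E ≤ 2 * target n Φ E := prec_le (by omega) hΦ hE
      _ ≤ V * V ^ 6 := by gcongr; omega
      _ = V ^ 7 := by ring
  have hbits : bits n Φ E ≤ V ^ 7 := Nat.lt_two_pow_self.le.trans hprec
  have hrate : rate n Φ E ≤ V ^ 11 := by
    calc rate n Φ E ≤ V ^ 3 * V * V ^ 7 := by rw [rate]; gcongr; omega
      _ = V ^ 11 := by ring
  have hrounds : rounds n Φ E ≤ V ^ 16 := hM.trans (Nat.pow_le_pow_left hpV 16)
  have hcap : cap n Φ E ≤ V ^ 23 := by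
    calc cap n Φ E ≤ V ^ 16 * V ^ 7 := by rw [cap]; gcongr
      _ = V ^ 23 := by ring
  have hK : 2 ^ k ≤ V ^ 3 := by
    calc 2 ^ k ≤ 8 * p := hk
      _ ≤ V ^ 2 * V := by gcongr; omega
      _ = V ^ 3 := by ring
  have hreps : reps m n Φ E k ≤ V ^ 31 := by
    calc reps m n Φ E k ≤ V ^ 7 * (V * V) * V ^ 3 * V * V * V * V ^ 16 := by rw [reps]; gcongr
      _ = V ^ 31 := by ring
  have hcoins : coins n Φ E ≤ V ^ 39 := by
    have h1 : coins n Φ E ≤ (V ^ 34 + V * V ^ 23 * V ^ 11) * (V * V) + V ^ 37 := by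
      rw [coins]
      gcongr
      · exact hnV.trans (by simpa using hpow (a := 1) (b := 34) (by norm_num))
      · omega
      · exact hrate.trans (hpow (by norm_num))
    calc _ ≤ _ := h1
      _ = V ^ 36 + V ^ 37 + V ^ 37 := by ring
      _ ≤ V ^ 37 + V ^ 37 + V ^ 37 := by
          have := hpow (a := 36) (b := 37) (by norm_num)
          omega
      _ ≤ V ^ 37 * V ^ 2 := by nlinarith [Nat.one_le_pow 37 V hV1]
      _ = _ := by ring
  set D := rounds n Φ E ^ 2 ^ k with hD
  have hD1 : 1 ≤ D := Nat.one_le_pow _ _ (one_le_rounds (by omega) hΦ hE)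
  have hdays : days m n Φ E k ≤ V ^ 31 * D := by
    rw [days]
    gcongr
  have hdaysp : days m n Φ E k * prec n Φ E ≤ V ^ 41 * D := by
    calc _ ≤ V ^ 31 * D * V ^ 7 := by gcongr
      _ = V ^ 38 * D := by ring
      _ ≤ _ := by gcongr; omega
  have hN : ∀ {x a : ℕ}, x ≤ V ^ a → a ≤ 41 → x ≤ V ^ 41 * D := fun h ha =>
    (h.trans (hpow ha)).trans (Nat.le_mul_of_pos_right _ hD1)
  have hsize : sizeBound m n Φ E k + 2 ≤ V ^ 44 * D := by
    have a1 := hN htarget (by norm_num)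
    have a2 := hN hrounds (by norm_num)
    have a3 := hN hrate (by norm_num)
    have a4 := hN hcap (by norm_num)
    have a5 := hN hK (by norm_num)
    have a6 : m * Φ ≤ V ^ 41 * D := hN (a := 2) (by rw [sq]; gcongr) (by norm_num)
    have a7 : Φ * n ≤ V ^ 41 * D := hN (a := 2) (by rw [sq]; gcongr) (by norm_num)
    have a8 := hN hbits (by norm_num)
    have a9 := hN hcoins (by norm_num)
    have a10 : k ≤ V ^ 41 * D := Nat.lt_two_pow_self.le.trans a5
    have a11 : 16 ≤ V ^ 41 * D := hN c2 (by norm_num)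
    have a12 : V ^ 44 * D = V ^ 3 * (V ^ 41 * D) := by ring
    have a13 : 64 * (V ^ 41 * D) ≤ V ^ 3 * (V ^ 41 * D) := Nat.mul_le_mul_right _ c3
    unfold sizeBound
    rw [a12]
    omega
  set U := V ^ 44 * D with hU
  have hVU : V ≤ U := by
    calc V = V ^ 1 * 1 := by ring
      _ ≤ U := Nat.mul_le_mul (hpow (by norm_num)) hD1
  have hU1 : 1 ≤ U := hV1.trans hVU
  have hVdays : days m n Φ E k * V * V * V ≤ U := by
    calc days m n Φ E k * V * V * V ≤ V ^ 31 * D * V * V * V := by gcongr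
      _ = V ^ 34 * D := by ring
      _ ≤ U := Nat.mul_le_mul_right _ (hpow (by norm_num))
  have hsz : n.size ≤ V := (size_le_of_le le_rfl).trans hnV
  have hUd : 1 ≤ U ^ d := Nat.one_le_pow _ _ hU1
  have hUd' : (sizeBound m n Φ E k + 2) ^ d ≤ U ^ d := Nat.pow_le_pow_left hsize _
  have hday : m * ((sizeBound m n Φ E k + 2) ^ d + Φ * n.size) ≤
      V * (U ^ d * (V * V) + U ^ d * (V * V)) := by
    refine Nat.mul_le_mul hmV (Nat.add_le_add ?_ ?_)
    · exact hUd'.trans (Nat.le_mul_of_pos_right _ (Nat.mul_pos hV1 hV1))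
    · exact (Nat.mul_le_mul hΦV hsz).trans (Nat.le_mul_of_pos_left _ hUd)
  have h4 : 4 ≤ U := hV4.trans hVU
  have h4U : U + 2 * U ≤ U ^ 4 := by
    calc U + 2 * U ≤ 4 * 4 * 4 * U := by omega
      _ ≤ U * U * U * U := by gcongr
      _ = U ^ 4 := by ring
  calc _ ≤ U ^ d + days m n Φ E k * (V * (U ^ d * (V * V) + U ^ d * (V * V))) :=
        Nat.add_le_add hUd' (Nat.mul_le_mul_left _ hday)
    _ = U ^ d * (1 + 2 * (days m n Φ E k * V * V * V)) := by ring
    _ ≤ U ^ d * (U + 2 * U) :=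
        Nat.mul_le_mul_left _ (Nat.add_le_add hU1 (Nat.mul_le_mul_left _ hVdays))
    _ ≤ U ^ d * U ^ 4 := Nat.mul_le_mul_left _ h4U
    _ = _ := by rw [pow_add]

theorem bits_le {n Φ E : ℕ} (hn : 1 ≤ n) (hΦ : 1 ≤ Φ) (hE : 1 ≤ E) :
    (bits n Φ E : ℝ) ≤ 7 + 3 / 2 * (Real.log n + Φ + E) := by
  have hn1 : (1 : ℝ) ≤ n := by exact_mod_cast hn
  have hΦ1 : (1 : ℝ) ≤ Φ := by exact_mod_cast hΦ
  have hE1 : (1 : ℝ) ≤ E := by exact_mod_cast hE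
  have hb := one_le_bits hn hΦ hE
  have h2 : 2 ^ (bits n Φ E - 1) < target n Φ E :=
    (Nat.lt_clog_iff_pow_lt (by norm_num)).1 (by rw [bits] at hb ⊢; omega)
  -- The constant 48 is rounded up to a power of two, so that its logarithm is a multiple of `log
  -- 2`. Division by `log 2 > 2/3` then produces the factor `3 / 2`.
  have h3 : (2 : ℝ) ^ (bits n Φ E - 1) ≤ 64 * n * Φ * E := by
    have h4 : (2 : ℝ) ^ (bits n Φ E - 1) ≤ 48 * n * Φ * E := by exact_mod_cast h2.le
    refine h4.trans ?_
    gcongr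
    norm_num
  have h5 := Real.log_le_log (by positivity) h3
  rw [Real.log_pow, Real.log_mul (by positivity) (by positivity),
    Real.log_mul (by positivity) (by positivity), Real.log_mul (by positivity) (by positivity),
    show (64 : ℝ) = 2 ^ 6 by norm_num, Real.log_pow, Nat.cast_sub hb] at h5
  have h6 : Real.log Φ ≤ Φ := (Real.log_le_sub_one_of_pos (by positivity)).trans (by linarith)
  have h7 : Real.log E ≤ E := (Real.log_le_sub_one_of_pos (by positivity)).trans (by linarith)
  have h8 := Real.log_two_gt_d9
  have h9 : 0 ≤ Real.log n := Real.log_nonneg hn1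
  push_cast at h5
  by_contra hcon
  push Not at hcon
  nlinarith

theorem rounds_le {n Φ E : ℕ} {P : ℝ} (hn : 2 ≤ n) (hΦ : 1 ≤ Φ) (hE : 1 ≤ E) (hP : 1 ≤ P)
    (hΦP : Φ * Real.log n ≤ P) (hEP : (E : ℝ) ≤ 2 * P) :
    (Φ : ℝ) ≤ 3 / 2 * P ∧ (rounds n Φ E : ℝ) ≤ 65536 * P ^ 4 := by
  have hn1 : (2 : ℝ) ≤ n := by exact_mod_cast hn
  have hΦ1 : (1 : ℝ) ≤ Φ := by exact_mod_cast hΦ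
  have hE1 : (1 : ℝ) ≤ E := by exact_mod_cast hE
  have h8 := Real.log_two_gt_d9
  have hlog : Real.log 2 ≤ Real.log n := Real.log_le_log (by norm_num) hn1
  have hΦ' : (Φ : ℝ) ≤ 3 / 2 * P := by nlinarith
  refine ⟨hΦ', ?_⟩
  have hb := bits_le (n := n) (by omega) hΦ hE
  have h1 : (Φ : ℝ) * bits n Φ E ≤ 20 * P ^ 2 := by
    calc (Φ : ℝ) * bits n Φ E ≤ Φ * (7 + 3 / 2 * (Real.log n + Φ + E)) := by gcongr
      _ = 7 * Φ + 3 / 2 * (Φ * Real.log n) + 3 / 2 * (Φ * Φ) + 3 / 2 * (Φ * E) := by ring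
      _ ≤ 7 * (3 / 2 * P) + 3 / 2 * P + 3 / 2 * (3 / 2 * P * (3 / 2 * P)) +
          3 / 2 * (3 / 2 * P * (2 * P)) := by gcongr
      _ ≤ 20 * P ^ 2 := by nlinarith
  rw [rounds]
  push_cast
  calc 512 * ((E : ℝ) * E) * Φ * bits n Φ E = 512 * (E * E) * (Φ * bits n Φ E) := by ring
    _ ≤ 512 * (2 * P * (2 * P)) * (20 * P ^ 2) := by gcongr
    _ ≤ 65536 * P ^ 4 := by nlinarith [pow_nonneg (zero_le_one.trans hP) 4]

/-- For `P ≥ 2` this is monotonicity in the base; otherwise `x ≤ P ≤ 2` and the left side is at most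
4. It removes numerical constants raised to the power `1 / ε`, even if the base of the time bound is
close to 1. -/
theorem two_rpow_le {x P : ℝ} (hx : 0 ≤ x) (hP : 1 ≤ P) (hxP : x ≤ P) :
    (2 : ℝ) ^ x ≤ 4 * P ^ x := by
  rcases le_total 2 P with h | h
  · have h1 := Real.rpow_le_rpow (by norm_num) h hx
    linarith [Real.rpow_nonneg (zero_le_one.trans hP) x]
  · have h1 : (2 : ℝ) ^ x ≤ 2 ^ (2 : ℝ) :=
      Real.rpow_le_rpow_of_exponent_le (by norm_num) (hxP.trans h)
    have h2 : (1 : ℝ) ≤ P ^ x := Real.one_le_rpow hP hx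
    norm_num at h1
    linarith

/-- One natural number `c` serves as the constant factor and as both exponents. -/
theorem pow_le_collect {A B Q : ℝ} (hA : 1 ≤ A) (hB : 0 ≤ B) (hQ : 1 ≤ Q)
    (hBQ : B ≤ 16 * Q ^ 3) {c d : ℕ} (hc : c = 16 ^ (300 * d)) (hd : 1 ≤ d) :
    ((A * B) ^ 44 * B ^ 256) ^ d ≤ c * A ^ c * Q ^ c := by
  have h1 : 300 * d < 2 ^ (300 * d) := Nat.lt_two_pow_self
  have h2 : (2 : ℕ) ^ (300 * d) * 4 ≤ c := by
    rw [hc, show (16 : ℕ) = 2 * 8 by norm_num, mul_pow]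
    refine Nat.mul_le_mul_left _ ?_
    calc 4 ≤ 8 ^ 1 := by norm_num
      _ ≤ 8 ^ (300 * d) := Nat.pow_le_pow_right (by norm_num) (by omega)
  have h3 : 44 * d ≤ c := by omega
  have h4 : 900 * d ≤ c := by omega
  calc ((A * B) ^ 44 * B ^ 256) ^ d = A ^ (44 * d) * B ^ (300 * d) := by
        rw [mul_pow A, mul_assoc, ← pow_add, mul_pow, ← pow_mul, ← pow_mul]
    _ ≤ A ^ (44 * d) * (16 * Q ^ 3) ^ (300 * d) := by gcongr
    _ = 16 ^ (300 * d) * A ^ (44 * d) * Q ^ (900 * d) := by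
        rw [mul_pow, ← pow_mul, ← mul_assoc 3]
        ring
    _ ≤ 16 ^ (300 * d) * A ^ c * Q ^ c :=
        mul_le_mul (mul_le_mul_of_nonneg_left (pow_le_pow_right₀ hA h3) (by positivity))
          (pow_le_pow_right₀ hQ h4) (by positivity) (by positivity)
    _ = _ := by rw [hc]; push_cast; rfl

/-- The exponent in the time bound. -/
def bigConst (d : ℕ) : ℕ := 16 ^ (300 * d)

theorem time_le_rpow {m n Φ k : ℕ} {ε : ℝ} (hε0 : 0 < ε) (hε1 : ε ≤ 1) (hm : 1 ≤ m)
    (hn : 2 ≤ n) (hΦ : 1 ≤ Φ) (hk : 2 ^ k ≤ 8 * ⌈1 / ε⌉₊) :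
    (timeBound m n Φ ⌈1 / ε⌉₊ k : ℝ) ≤
      bigConst (degree + 4) * ((m : ℝ) * n) ^ (bigConst (degree + 4) : ℝ) *
      (max (Φ * Real.log n) (1 / ε)) ^ ((bigConst (degree + 4) : ℝ) / ε) := by
  set x := 1 / ε with hx
  set E := ⌈x⌉₊ with hE
  set P := max (Φ * Real.log n) x with hP
  have hx1 : 1 ≤ x := by rw [hx, le_div_iff₀ hε0]; linarith
  have hxP : x ≤ P := le_max_right _ _
  have hP1 : 1 ≤ P := hx1.trans hxP
  have hE1 : 1 ≤ E := Nat.one_le_ceil_iff.2 (by linarith)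
  have hEx : (E : ℝ) ≤ 2 * x := by
    have := Nat.ceil_lt_add_one (zero_le_one.trans hx1)
    rw [← hE] at this
    linarith
  -- The factor 2 ensures `p ≥ 2` even for `P = 1`, so that powers of `p` can absorb numerical
  -- constants.
  set p := ⌈2 * P⌉₊ with hp
  have hpP : 2 * P ≤ p := Nat.le_ceil _
  have hp4 : (p : ℝ) ≤ 4 * P := by
    have := Nat.ceil_lt_add_one (a := 2 * P) (by linarith)
    rw [← hp] at this
    linarith
  have hp2 : 2 ≤ p := by
    have : (2 : ℝ) ≤ p := by linarith
    exact_mod_cast this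
  obtain ⟨hΦP, hMP⟩ := rounds_le hn hΦ hE1 hP1 (le_max_left _ _) (by linarith)
  have hΦp : Φ ≤ p := by
    have : (Φ : ℝ) ≤ p := by linarith
    exact_mod_cast this
  have hEp : E ≤ p := by
    have : (E : ℝ) ≤ p := by linarith
    exact_mod_cast this
  have hMp : rounds n Φ E ≤ p ^ 16 := by
    have : (rounds n Φ E : ℝ) ≤ p ^ 16 := by
      calc (rounds n Φ E : ℝ) ≤ 65536 * P ^ 4 := hMP
        _ = 2 ^ 12 * (2 * P) ^ 4 := by ring
        _ ≤ (p : ℝ) ^ 12 * p ^ 4 := by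
            gcongr
            exact_mod_cast hp2
        _ = _ := by ring
    exact_mod_cast this
  have hK : ((2 ^ k : ℕ) : ℝ) ≤ 16 * x := by
    have : ((2 ^ k : ℕ) : ℝ) ≤ 8 * E := by exact_mod_cast hk
    linarith
  have hmain := timeBound_le (k := k) hm hn hΦ hE1 hp2 hΦp hEp (hk.trans (by omega)) hMp
  have hd : 1 ≤ degree + 4 := Nat.le_add_left 1 (degree + 3)
  generalize degree + 4 = d at hd hmain ⊢
  have hc : bigConst d = 16 ^ (300 * d) := rfl
  generalize bigConst d = c at hc ⊢
  have hmn : (1 : ℝ) ≤ (m : ℝ) * n := by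
    have : 1 ≤ m * n := Nat.mul_pos hm (by omega)
    exact_mod_cast this
  have h4P : (1 : ℝ) ≤ 4 * P := by linarith
  -- The exponent is `16 * 2 ^ k`, and `2 ^ k ≤ 8 * E ≤ 16 / ε`.
  have hpow1 : ((rounds n Φ E ^ 2 ^ k : ℕ) : ℝ) ≤ ((4 * P) ^ x) ^ 256 := by
    have h1 : ((rounds n Φ E ^ 2 ^ k : ℕ) : ℝ) ≤ ((4 * P) ^ 16) ^ 2 ^ k := by
      push_cast
      gcongr
      calc (rounds n Φ E : ℝ) ≤ p ^ 16 := by exact_mod_cast hMp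
        _ ≤ _ := by gcongr
    calc _ ≤ ((4 * P) ^ 16) ^ 2 ^ k := h1
      _ = (4 * P) ^ ((16 * 2 ^ k : ℕ) : ℝ) := by rw [← pow_mul, Real.rpow_natCast]
      _ ≤ (4 * P) ^ (x * (256 : ℕ)) := by
          refine Real.rpow_le_rpow_of_exponent_le h4P ?_
          push_cast at hK ⊢
          linarith
      _ = _ := by rw [Real.rpow_mul (by linarith), Real.rpow_natCast]
  have hpow2 : (4 * P : ℝ) ≤ (4 * P) ^ x := by
    conv_lhs => rw [← Real.rpow_one (4 * P)]
    exact Real.rpow_le_rpow_of_exponent_le h4P hx1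
  have hpow3 : (4 * P : ℝ) ^ x ≤ 16 * (P ^ x) ^ 3 := by
    have h1 := two_rpow_le (zero_le_one.trans hx1) hP1 hxP
    rw [Real.mul_rpow (by norm_num) (by linarith), show (4 : ℝ) = 2 * 2 by norm_num,
      Real.mul_rpow (by norm_num) (by norm_num)]
    calc (2 : ℝ) ^ x * 2 ^ x * P ^ x ≤ (4 * P ^ x) * (4 * P ^ x) * P ^ x := by gcongr
      _ = _ := by ring
  have hPx : 1 ≤ P ^ x := Real.one_le_rpow hP1 (by linarith)
  have hV : ((m * n * p : ℕ) : ℝ) ≤ (m * n) * (4 * P) ^ x := by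
    push_cast
    gcongr
    exact hp4.trans hpow2
  calc (timeBound m n Φ E k : ℝ)
      ≤ (((m * n * p) ^ 44 * rounds n Φ E ^ 2 ^ k : ℕ) : ℝ) ^ d := by exact_mod_cast hmain
    _ = (((m * n * p : ℕ) : ℝ) ^ 44 * ((rounds n Φ E ^ 2 ^ k : ℕ) : ℝ)) ^ d := by push_cast; rfl
    _ ≤ (((m * n) * (4 * P) ^ x) ^ 44 * ((4 * P) ^ x) ^ 256) ^ d := by gcongr
    _ ≤ c * ((m : ℝ) * n) ^ c * (P ^ x) ^ c :=
        pow_le_collect hmn (by positivity) hPx hpow3 hc hd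
    _ = _ := by
        rw [Real.rpow_natCast, ← Real.rpow_natCast (P ^ x), ← Real.rpow_mul (by linarith),
          hx, one_div_mul_eq_div]

/-! ### The failure probability -/

/-- The exponent in the failure probability. -/
def decayRate (N : ℕ) : ℝ := N * Real.log 2 / Real.log N

/-- Since `log N ≤ 2 * √N`, the rate is at least a constant times `√N`. -/
theorem tendsto_decayRate : Filter.Tendsto decayRate Filter.atTop Filter.atTop := by
  have h1 : Filter.Tendsto (fun N : ℕ => Real.log 2 / 2 * ((N : ℝ) ^ (1 / 2 : ℝ)))
      Filter.atTop Filter.atTop :=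
    ((tendsto_rpow_atTop (by norm_num)).comp tendsto_natCast_atTop_atTop).const_mul_atTop
      (by positivity)
  refine Filter.tendsto_atTop_mono' _ ?_ h1
  filter_upwards [Filter.eventually_ge_atTop 2] with N hN
  have hN2 : (2 : ℝ) ≤ N := by exact_mod_cast hN
  have h2 : Real.log N ≤ (N : ℝ) ^ (1 / 2 : ℝ) / (1 / 2) :=
    Real.log_le_rpow_div (by positivity) (by norm_num)
  have h3 : 0 < Real.log N := Real.log_pos (by linarith)
  have h4 : (N : ℝ) ^ (1 / 2 : ℝ) * (N : ℝ) ^ (1 / 2 : ℝ) = N := by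
    rw [← Real.rpow_add (by linarith)]
    norm_num
  have h5 : 0 < Real.log 2 := Real.log_pos (by norm_num)
  have h6 : 0 ≤ (N : ℝ) ^ (1 / 2 : ℝ) := by positivity
  rw [decayRate, le_div_iff₀ h3]
  calc Real.log 2 / 2 * (N : ℝ) ^ (1 / 2 : ℝ) * Real.log N ≤
        Real.log 2 / 2 * (N : ℝ) ^ (1 / 2 : ℝ) * ((N : ℝ) ^ (1 / 2 : ℝ) / (1 / 2)) := by gcongr
    _ = Real.log 2 * ((N : ℝ) ^ (1 / 2 : ℝ) * (N : ℝ) ^ (1 / 2 : ℝ)) := by ring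
    _ = _ := by rw [h4, mul_comm]

theorem rpow_decayRate {N : ℕ} (hN : 2 ≤ N) : (N : ℝ) ^ decayRate N = 2 ^ N := by
  have hN2 : (2 : ℝ) ≤ N := by exact_mod_cast hN
  have h3 : 0 < Real.log N := Real.log_pos (by linarith)
  rw [Real.rpow_def_of_pos (by linarith), decayRate, mul_div_cancel₀ _ h3.ne', mul_comm,
    ← Real.rpow_def_of_pos (by norm_num), Real.rpow_natCast]

end EFG

end

/-! ### The main theorem -/

theorem corollary7 :
    ∃ C : ℝ, ∃ ω : ℕ → ℝ, Filter.Tendsto ω Filter.atTop Filter.atTop ∧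
      ∀ ε : ℝ, 0 < ε → ε ≤ 1 → ∃ A : EFG.Dynamics,
        ∀ (m n Φ : ℕ) [NeZero n], 1 ≤ m → 2 ≤ n → 1 ≤ Φ → ∀ G : EFG.Game m n Φ,
          (∀ r ∈ (A.run G).support,
            (r.2 : ℝ) ≤ C * ((m : ℝ) * n) ^ C * (max (Φ * Real.log n) (1 / ε)) ^ (C / ε)) ∧
          1 - 1 / ((m : ℝ) * n * Φ) ^ ω (m * n * Φ) ≤
            ((A.run G).toOuterMeasure
              {r | ∃ hr : 0 < r.1.length, G.IsNFCE ε (A.output G r.1 hr)}).toReal := by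
  refine ⟨EFG.bigConst (EFG.degree + 4), EFG.decayRate, EFG.tendsto_decayRate, fun ε hε0 hε1 => ?_⟩
  have hx : 1 ≤ 1 / ε := by rw [le_div_iff₀ hε0]; linarith
  have hE : 1 ≤ ⌈1 / ε⌉₊ := Nat.one_le_ceil_iff.2 (by linarith)
  have hEε : 1 / ((⌈1 / ε⌉₊ : ℕ) : ℝ) ≤ ε := by
    rw [one_div_le (by exact_mod_cast hE) hε0]
    exact Nat.le_ceil _
  -- The number of learners is the least power of two that is at least `4 * E`. The lower bound is
  -- needed for the swap regret, the upper bound `8 * E` for the running time.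
  have hk1 : 4 * ⌈1 / ε⌉₊ ≤ 2 ^ Nat.clog 2 (4 * ⌈1 / ε⌉₊) := Nat.le_pow_clog (by norm_num) _
  have hk2 : 2 ^ Nat.clog 2 (4 * ⌈1 / ε⌉₊) ≤ 8 * ⌈1 / ε⌉₊ := by
    have hb : 1 ≤ Nat.clog 2 (4 * ⌈1 / ε⌉₊) := Nat.clog_pos (by norm_num) (by omega)
    have h2 : 2 ^ (Nat.clog 2 (4 * ⌈1 / ε⌉₊) - 1) < 4 * ⌈1 / ε⌉₊ :=
      (Nat.lt_clog_iff_pow_lt (by norm_num)).1 (by omega)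
    have h3 : 2 ^ Nat.clog 2 (4 * ⌈1 / ε⌉₊) = 2 ^ (Nat.clog 2 (4 * ⌈1 / ε⌉₊) - 1) * 2 := by
      rw [← pow_succ, Nat.sub_add_cancel hb]
    omega
  refine ⟨EFG.dynamics ⌈1 / ε⌉₊ (Nat.clog 2 (4 * ⌈1 / ε⌉₊)), ?_⟩
  intro m n Φ _ hm hn hΦ G
  constructor
  · intro r hr
    refine le_trans ?_ (EFG.time_le_rpow hε0 hε1 hm hn hΦ hk2)
    exact_mod_cast EFG.run_time_le G hm (by omega) hE hΦ hr
  · have hN : 2 ≤ m * n * Φ := by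
      calc 2 = 1 * 2 * 1 := by norm_num
        _ ≤ m * n * Φ := by gcongr
    have h := EFG.rpow_decayRate hN
    push_cast at h
    rw [h]
    exact EFG.success_ge G hm (by omega) hE hΦ hk1 hEε
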